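/- **Setting.** Let $\mathrm{PV}$ be a first-order language with equality that has a function symbol for every polynomial-time clocked machine and no other non-logical symbols, and let $\mathbb N$ be its standard model, in which every symbol denotes the function on natural numbers computed by its machine. Let $T_{\mathrm{PV}}$ be the set of all universal $\mathrm{PV}$-sentences that are true in $\mathbb N$. In formulas, $1$, $2$, $x\le y$, $x\mid y$, $|x|$ (the binary length of $x$) and $[w]_i$ (the $i$-th member of the sequence coded by $w$) are expressed by $\mathrm{PV}$-symbols that compute them. Let $\Sigma^b_0$ be the closure of the atomic $\mathrm{PV}$-formulas under propositional connectives and sharply bounded quantifiers $(\forall v\le|t|)$, $(\exists v\le|t|)$, and let $BB(\Sigma^b_0)$ be the set of the universal closures of $$(\forall i\le|a|)(\exists y\le a)\,\varphi(i,y)\;\to\;(\exists w)(\forall i\le|a|)\,\varphi(i,[w]_i)$$ for all $\varphi\in\Sigma^b_0$; here $\varphi$ may have $a$ and other variables as parameters, but not $w$. Let $\textsc{PrimeFactor}$ be the sentence $$(\forall x\ge 2)(\exists y\le x)(\forall z\le y)\bigl(2\le y\ \wedge\ y\mid x\ \wedge\ (z\mid y\to(z=1\vee z=y))\bigr).$$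 Finally, let $P_n$ be the set of all primes of binary length $n$. **Theorem.** Assume that for every real $r>0$ and every sequence $(C_n)_{n\in\mathbb N}$ of Boolean circuits of polynomial size there is an $n$ with $P_n\ne\emptyset$ such that $$\Pr_{p,q\sim P_n}\bigl[C_n(pq)\in\{p,q\}\bigr]<r,$$ where $p$ and $q$ are sampled uniformly and independently. Then $$T_{\mathrm{PV}}+BB(\Sigma^b_0)\nvdash\textsc{PrimeFactor}.$$ Consequently, there are a model $M$ of $T_{\mathrm{PV}}+BB(\Sigma^b_0)$ and an element $m\in M$ with $M\models 2\le m$ such that no $p\in M$ that is prime in $M$ (that is, $M\models 2\le p\wedge\forall z\,(z\mid p\to(z=1\vee z=p))$) divides $m$ in $M$; in particular, $m$ has no prime factorization in $M$. -/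

import Mathlib

open FirstOrder

namespace BoundedArith

/-! ### Clocked machines

Register machines with finitely many registers holding natural numbers.  One step performs one
addition, truncated subtraction, halving, copy or loading of a fixed constant, or one test of a
register for zero; multiplication is not an instruction.  As one step lengthens the registers by
at most one bit (up to the fixed constants), counting steps is polynomially equivalent to the
running time of a Turing machine. -/

/-- Right-hand sides of assignments: a constant, or an operation on register contents. -/
inductive Op
  | const (n : ℕ)
  | reg (a : ℕ)
  | add (a b : ℕ)
  | sub (a b : ℕ)
  | half (a : ℕ)

/-- The value of a right-hand side when register `a` contains `s a`. -/
def Op.eval : Op → (ℕ → ℕ) → ℕ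
  | .const n, _ => n
  | .reg a, s => s a
  | .add a b, s => s a + s b
  | .sub a b, s => s a - s b
  | .half a, s => s a / 2

/-- Programs. `ite r p q` runs `p` if register `r` is nonzero and `q` otherwise;
`loop r p` runs `p` as long as register `r` is nonzero. -/
inductive Prog
  | skip
  | assign (r : ℕ) (e : Op)
  | seq (p q : Prog)
  | ite (r : ℕ) (p q : Prog)
  | loop (r : ℕ) (p : Prog)

/-- Sequential execution of a list of programs. -/
def Prog.block : List Prog → Prog
  | [] => .skip
  | p :: l => .seq p (Prog.block l)

/-- One step of the machine. A configuration consists of the list of the programs that remain to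
be executed and of the register contents; the machine has halted when the list is empty. -/
def Prog.step : List Prog × (ℕ → ℕ) → List Prog × (ℕ → ℕ)
  | ([], s) => ([], s)
  | (.skip :: k, s) => (k, s)
  | (.assign r e :: k, s) => (k, Function.update s r (e.eval s))
  | (.seq p q :: k, s) => (p :: q :: k, s)
  | (.ite r p q :: k, s) => ((if s r = 0 then q else p) :: k, s)
  | (.loop r p :: k, s) => if s r = 0 then (k, s) else (p :: .loop r p :: k, s)

/-- A polynomial-time clocked machine: a program with a polynomial bound on its running time. -/
structure ClockedMachine where
  prog : Prog
  clock : Polynomial ℕ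

/-- The initial register contents on the input `x`: register `i` contains `x i`, the others `0`. -/
def initRegs {k : ℕ} (x : Fin k → ℕ) : ℕ → ℕ := fun i => if h : i < k then x ⟨i, h⟩ else 0

/-- The total binary length of the input. -/
def inputLength {k : ℕ} (x : Fin k → ℕ) : ℕ := ∑ i, (x i).size

/-- The `k`-ary function computed by a clocked machine: run the program until it halts, but not
for more steps than the clock allows, and output the contents of register `0`. -/
def ClockedMachine.eval (M : ClockedMachine) {k : ℕ} (x : Fin k → ℕ) : ℕ :=
  (Prog.step^[M.clock.eval (inputLength x)] ([M.prog], initRegs x)).2 0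

/-! ### The language PV and its standard model -/

/-- The language with a `k`-ary function symbol for every polynomial-time clocked machine
(for every arity `k`) and no relation symbols besides equality. -/
def PV : FirstOrder.Language.{0, 0} := ⟨fun _ => ClockedMachine, fun _ => Empty⟩

/-- The standard model: each symbol denotes the function computed by its machine. -/
instance natStructure : PV.Structure ℕ where
  funMap {_} (f : ClockedMachine) x := f.eval x
  RelMap r _ := r.elim

/-- The true universal theory `T_PV`: all universal sentences that hold in the standard model. -/
def TPV : PV.Theory := {σ | σ.IsUniversal ∧ ℕ ⊨ σ}

/-! ### Some symbols of PV -/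

/-- A machine that outputs the constant `n`. -/
noncomputable def constMachine (n : ℕ) : ClockedMachine := ⟨.assign 0 (.const n), 1⟩

/-- The constant symbol for `1`. -/
noncomputable def oneSym : PV.Functions 0 := constMachine 1

/-- The constant symbol for `2`. -/
noncomputable def twoSym : PV.Functions 0 := constMachine 2

/-- The characteristic function of `x₀ ≤ x₁`. -/
noncomputable def leSym : PV.Functions 2 :=
  ClockedMachine.mk
    (.block [.assign 2 (.const 1), .assign 0 (.sub 0 1), .assign 0 (.sub 2 0)])
    10

/-- The binary length of `x₀`. -/
noncomputable def lenSym : PV.Functions 1 :=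
  ClockedMachine.mk
    (.block [
      .assign 2 (.const 1),
      .loop 0 (.block [.assign 0 (.half 0), .assign 1 (.add 1 2)]),
      .assign 0 (.reg 1)])
    (20 * Polynomial.X + 20)

/-- The characteristic function of `x₀ ∣ x₁`, computed by long division: register `3` runs
through `x₀ * 2 ^ j`, first upwards until it exceeds `x₁`, and then downwards, being subtracted
from register `1` whenever possible. -/
noncomputable def dvdSym : PV.Functions 2 :=
  ClockedMachine.mk
    (.block [
      .assign 2 (.const 1),
      .ite 0
        (.block [
          .assign 3 (.reg 0),
          .assign 5 (.add 1 2),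
          .assign 4 (.sub 5 3),
          .loop 4 (.block [.assign 3 (.add 3 3), .assign 4 (.sub 5 3)]),
          .assign 4 (.sub 3 0),
          .loop 4 (.block [
            .assign 3 (.half 3),
            .assign 5 (.add 1 2),
            .assign 5 (.sub 5 3),
            .ite 5 (.assign 1 (.sub 1 3)) .skip,
            .assign 4 (.sub 3 0)])])
        .skip,
      .assign 0 (.sub 2 1)])
    (100 * Polynomial.X + 100)

/-- The number spelled in binary (least significant bit first) by the initial base-`4` digits
`0`, `1` of `w`, up to the first digit that is a separator (`2` or `3`). -/
def firstEntry (w : ℕ) : ℕ :=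
  if h : w = 0 then 0
  else if 2 ≤ w % 4 then 0
  else w % 4 + 2 * firstEntry (w / 4)
termination_by w
decreasing_by omega

/-- Delete the initial base-`4` digits of `w` up to and including the `i`-th separator. -/
def dropEntries (w i : ℕ) : ℕ :=
  if h : i = 0 ∨ w = 0 then w
  else dropEntries (w / 4) (if 2 ≤ w % 4 then i - 1 else i)
termination_by w
decreasing_by omega

/-- The `i`-th member (counting from `0`) of the sequence coded by `w`. The base-`4` digits of `w`,
least significant first, list the members in binary, least significant bit first, each of them
followed by a separator digit. -/
def entry (w i : ℕ) : ℕ := firstEntry (dropEntries w i)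

/-- The symbol for `[x₀]_{x₁}`. -/
noncomputable def entrySym : PV.Functions 2 :=
  ClockedMachine.mk
    (.block [
      .assign 2 (.const 1),
      .loop 1 (.ite 0
        (.block [
          .assign 3 (.half 0),
          .assign 3 (.half 3),
          .assign 4 (.add 3 3),
          .assign 4 (.add 4 4),
          .assign 4 (.sub 0 4),
          .assign 4 (.sub 4 2),
          .ite 4 (.assign 1 (.sub 1 2)) .skip,
          .assign 0 (.reg 3)])
        (.assign 1 (.const 0))),
      .assign 5 (.const 1),
      .loop 0 (.block [
        .assign 3 (.half 0),
        .assign 3 (.half 3),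
        .assign 4 (.add 3 3),
        .assign 4 (.add 4 4),
        .assign 4 (.sub 0 4),
        .assign 7 (.sub 4 2),
        .ite 7 (.assign 3 (.const 0)) (.ite 4 (.assign 6 (.add 6 5)) .skip),
        .assign 5 (.add 5 5),
        .assign 0 (.reg 3)]),
      .assign 0 (.reg 6)])
    (100 * Polynomial.X + 100)

/-! ### The symbols compute what they should -/

/-- `p` turns the registers `s` into `t` in exactly `n` steps. -/
def Runs (p : Prog) (s t : ℕ → ℕ) (n : ℕ) : Prop :=
  ∀ k, Prog.step^[n] (p :: k, s) = (k, t)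

theorem Runs.skip (s : ℕ → ℕ) : Runs .skip s s 1 := fun _ => rfl

theorem Runs.assign (r : ℕ) (e : Op) (s : ℕ → ℕ) :
    Runs (.assign r e) s (Function.update s r (e.eval s)) 1 := fun _ => rfl

theorem Runs.seq {p q : Prog} {s t u : ℕ → ℕ} {n m : ℕ} (hp : Runs p s t n) (hq : Runs q t u m) :
    Runs (.seq p q) s u (m + n + 1) := by
  intro k
  rw [Function.iterate_succ_apply, Function.iterate_add_apply]
  change Prog.step^[m] (Prog.step^[n] (p :: q :: k, s)) = _
  rw [hp, hq]

theorem Runs.ite {r : ℕ} {p q : Prog} {s t : ℕ → ℕ} {n : ℕ}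
    (h : Runs (if s r = 0 then q else p) s t n) : Runs (.ite r p q) s t (n + 1) := by
  intro k
  rw [Function.iterate_succ_apply]
  exact h k

theorem Runs.loop_done {r : ℕ} {p : Prog} {s : ℕ → ℕ} (h : s r = 0) : Runs (.loop r p) s s 1 := by
  intro k
  simp [Prog.step, h]

theorem Runs.loop_next {r : ℕ} {p : Prog} {s t u : ℕ → ℕ} {n m : ℕ} (h : s r ≠ 0)
    (hp : Runs p s t n) (hq : Runs (.loop r p) t u m) : Runs (.loop r p) s u (m + n + 1) := by
  intro k
  rw [Function.iterate_succ_apply, Function.iterate_add_apply]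
  have : Prog.step (Prog.loop r p :: k, s) = (p :: .loop r p :: k, s) := by simp [Prog.step, h]
  rw [this, hp, hq]

/-- Loops with an invariant and a decreasing measure. -/
theorem Runs.exists_loop {r : ℕ} {p : Prog} (I : (ℕ → ℕ) → Prop) (μ : (ℕ → ℕ) → ℕ) (B : ℕ)
    (h : ∀ s, I s → s r ≠ 0 → ∃ t, ∃ n ≤ B, Runs p s t n ∧ I t ∧ μ t < μ s)
    (s : ℕ → ℕ) (hs : I s) :
    ∃ t, ∃ n ≤ (B + 1) * μ s + 1, Runs (.loop r p) s t n ∧ I t ∧ t r = 0 := by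
  induction hm : μ s using Nat.strong_induction_on generalizing s with
  | _ m ih =>
    by_cases h0 : s r = 0
    · exact ⟨s, 1, by omega, Runs.loop_done h0, hs, h0⟩
    · obtain ⟨t, n, hn, hr, ht, hlt⟩ := h s hs h0
      obtain ⟨u, n', hn', hr', hu, hu0⟩ := ih (μ t) (hm ▸ hlt) t ht rfl
      refine ⟨u, _, ?_, Runs.loop_next h0 hr hr', hu, hu0⟩
      have : (B + 1) * (μ t + 1) ≤ (B + 1) * m := Nat.mul_le_mul_left _ (by omega)
      rw [Nat.mul_add] at this
      omega

/-- The effect of a program without loops. -/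
def Prog.effect : Prog → (ℕ → ℕ) → (ℕ → ℕ)
  | .skip, s => s
  | .assign r e, s => Function.update s r (e.eval s)
  | .seq p q, s => q.effect (p.effect s)
  | .ite r p q, s => if s r = 0 then q.effect s else p.effect s
  | .loop _ _, s => s

/-- Whether a program has no loops. -/
def Prog.loopFree : Prog → Bool
  | .skip => true
  | .assign _ _ => true
  | .seq p q => p.loopFree && q.loopFree
  | .ite _ p q => p.loopFree && q.loopFree
  | .loop _ _ => false

/-- The size of a program. -/
def Prog.nodes : Prog → ℕ
  | .skip => 1
  | .assign _ _ => 1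
  | .seq p q => p.nodes + q.nodes + 1
  | .ite _ p q => p.nodes + q.nodes + 1
  | .loop _ p => p.nodes + 1

theorem Prog.exists_runs_effect (p : Prog) (hp : p.loopFree = true) (s : ℕ → ℕ) :
    ∃ n ≤ p.nodes, Runs p s (p.effect s) n := by
  induction p generalizing s with
  | skip => exact ⟨1, le_rfl, Runs.skip s⟩
  | assign r e => exact ⟨1, le_rfl, Runs.assign r e s⟩
  | seq p q ihp ihq =>
    simp only [Prog.loopFree, Bool.and_eq_true] at hp
    obtain ⟨n, hn, h⟩ := ihp hp.1 s
    obtain ⟨m, hm, h'⟩ := ihq hp.2 (p.effect s)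
    exact ⟨_, by simp only [Prog.nodes]; omega, Runs.seq h h'⟩
  | ite r p q ihp ihq =>
    simp only [Prog.loopFree, Bool.and_eq_true] at hp
    by_cases h0 : s r = 0
    · obtain ⟨m, hm, h'⟩ := ihq hp.2 s
      refine ⟨m + 1, by simp only [Prog.nodes]; omega, ?_⟩
      apply Runs.ite
      simpa [h0, Prog.effect] using h'
    · obtain ⟨m, hm, h'⟩ := ihp hp.1 s
      refine ⟨m + 1, by simp only [Prog.nodes]; omega, ?_⟩
      apply Runs.ite
      simpa [h0, Prog.effect] using h'
  | loop r p ih => simp [Prog.loopFree] at hp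

theorem Prog.iterate_step_nil (n : ℕ) (s : ℕ → ℕ) : Prog.step^[n] ([], s) = ([], s) :=
  Function.iterate_fixed rfl n

theorem ClockedMachine.eval_eq {M : ClockedMachine} {k : ℕ} {x : Fin k → ℕ} {t : ℕ → ℕ} {n : ℕ}
    (h : Runs M.prog (initRegs x) t n) (hn : n ≤ M.clock.eval (inputLength x)) :
    M.eval x = t 0 := by
  obtain ⟨m, hm⟩ := Nat.exists_eq_add_of_le' hn
  rw [ClockedMachine.eval, hm, Function.iterate_add_apply, h, Prog.iterate_step_nil]

theorem Runs.block_cons {p : Prog} {l : List Prog} {s t u : ℕ → ℕ} {n m : ℕ}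
    (hp : Runs p s t n) (hq : Runs (.block l) t u m) : Runs (.block (p :: l)) s u (m + n + 1) :=
  Runs.seq hp hq

theorem Runs.block_nil (s : ℕ → ℕ) : Runs (.block []) s s 1 := Runs.skip s

theorem size_half_lt {n : ℕ} (h : n ≠ 0) : (n / 2).size + 1 = n.size := by
  conv_rhs => rw [← Nat.bit_bodd_div2 n]
  rw [Nat.size_bit (by rwa [Nat.bit_bodd_div2]), Nat.div2_val]

theorem initRegs_one (x : Fin 1 → ℕ) : initRegs x 0 = x 0 ∧ ∀ i, 1 ≤ i → initRegs x i = 0 :=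
  ⟨by simp [initRegs], fun i hi => by simp [initRegs]; omega⟩

theorem initRegs_two (x : Fin 2 → ℕ) :
    initRegs x 0 = x 0 ∧ initRegs x 1 = x 1 ∧ ∀ i, 2 ≤ i → initRegs x i = 0 :=
  ⟨by simp [initRegs], by simp [initRegs], fun i hi => by simp [initRegs]; omega⟩

theorem constMachine_eval (n : ℕ) {k : ℕ} (x : Fin k → ℕ) : (constMachine n).eval x = n := by
  rw [ClockedMachine.eval_eq (Runs.assign 0 (.const n) _) (by simp [constMachine])]
  simp [Op.eval]

theorem leSym_eval (x : Fin 2 → ℕ) :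
    ClockedMachine.eval leSym x = if x 0 ≤ x 1 then 1 else 0 := by
  obtain ⟨n, hn, h⟩ := Prog.exists_runs_effect (ClockedMachine.prog leSym) rfl (initRegs x)
  rw [ClockedMachine.eval_eq h (hn.trans (by simp [leSym, Prog.block, Prog.nodes]))]
  obtain ⟨h0, h1, -⟩ := initRegs_two x
  simp only [leSym, Prog.block, Prog.effect, Op.eval, Function.update_apply]
  simp [h0, h1]
  split_ifs <;> omega

theorem lenSym_eval (x : Fin 1 → ℕ) : ClockedMachine.eval lenSym x = (x 0).size := by
  obtain ⟨h0, h1⟩ := initRegs_one x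
  obtain ⟨t, n, hn, hr, ht, ht0⟩ := Runs.exists_loop (r := 0)
    (p := .block [.assign 0 (.half 0), .assign 1 (.add 1 2)])
    (fun s => s 2 = 1 ∧ s 1 + (s 0).size = (x 0).size) (fun s => (s 0).size) 10
    (by
      rintro s ⟨hs2, hs⟩ hs0
      obtain ⟨n, hn, h⟩ := Prog.exists_runs_effect
        (.block [.assign 0 (.half 0), .assign 1 (.add 1 2)]) rfl s
      have := size_half_lt hs0
      refine ⟨_, n, hn.trans (by simp [Prog.block, Prog.nodes]), h, ?_, ?_⟩ <;>
        simp [Prog.block, Prog.effect, Op.eval, hs2] <;> omega)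
    (Function.update (initRegs x) 2 1) (by simp [h0, h1])
  have hp := Runs.block_cons (Runs.assign 2 (.const 1) (initRegs x))
    (Runs.block_cons hr (Runs.block_cons (Runs.assign 0 (.reg 1) t) (Runs.block_nil _)))
  have hlen : inputLength x = (x 0).size := by simp [inputLength]
  rw [ClockedMachine.eval_eq (M := lenSym) hp]
  · simp only [Op.eval, Function.update_self]
    simpa [ht0] using ht.2
  · simp [lenSym, hlen]
    simp [h0] at hn
    omega

theorem dvdSym_eval (x : Fin 2 → ℕ) :
    ClockedMachine.eval dvdSym x = if x 0 ∣ x 1 then 1 else 0 := by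
  obtain ⟨h0, h1, h2⟩ := initRegs_two x
  have hlen : inputLength x = (x 0).size + (x 1).size := by simp [inputLength]
  suffices H : ∃ t, ∃ n ≤ 100 * inputLength x + 80,
      Runs (ClockedMachine.prog dvdSym) (initRegs x) t n ∧ t 0 = if x 0 ∣ x 1 then 1 else 0 by
    obtain ⟨t, n, hn, hr, ht⟩ := H
    rw [ClockedMachine.eval_eq hr, ht]
    simp [dvdSym]; omega
  set s₁ := Function.update (initRegs x) 2 1 with hs₁
  have hs₁0 : s₁ 0 = x 0 := by simp [hs₁, h0]
  have hs₁1 : s₁ 1 = x 1 := by simp [hs₁, h1]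
  have hs₁2 : s₁ 2 = 1 := by simp [hs₁]
  by_cases hx : x 0 = 0
  · refine ⟨_, _, ?_, Runs.block_cons (Runs.assign 2 (.const 1) (initRegs x))
      (Runs.block_cons (Runs.ite (n := 1) (t := s₁) ?_)
        (Runs.block_cons (Runs.assign 0 (.sub 2 1) s₁) (Runs.block_nil _))), ?_⟩
    · omega
    · change Runs (if s₁ 0 = 0 then _ else _) s₁ s₁ 1
      rw [if_pos (by rw [hs₁0, hx])]
      exact Runs.skip _
    · simp only [Op.eval, Function.update_self, hs₁1, hs₁2, hx, zero_dvd_iff]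
      split_ifs <;> omega
  -- the state before the first loop
  obtain ⟨s₂, hs₂⟩ : ∃ s₂ : ℕ → ℕ, s₂ = Function.update (Function.update (Function.update s₁ 3 (x 0)) 5
    (x 1 + 1)) 4 (x 1 + 1 - x 0) := ⟨_, rfl⟩
  obtain ⟨t, n, hn, hr, ht, ht4⟩ := Runs.exists_loop (r := 4)
    (p := .block [.assign 3 (.add 3 3), .assign 4 (.sub 5 3)])
    (fun s => s 0 = x 0 ∧ s 1 = x 1 ∧ s 2 = 1 ∧ s 5 = x 1 + 1 ∧ s 4 = x 1 + 1 - s 3 ∧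
      (∃ j, s 3 = x 0 * 2 ^ j) ∧ (s 3).size ≤ (x 0).size + (x 1).size + 1)
    (fun s => (x 1).size + 1 - (s 3).size) 10
    (by
      rintro s ⟨hs0, hs1, hs2, hs5, hs4, ⟨j, hj⟩, hsz⟩ hne
      obtain ⟨n, hn, h⟩ := Prog.exists_runs_effect
        (.block [.assign 3 (.add 3 3), .assign 4 (.sub 5 3)]) rfl s
      have hle : s 3 ≤ x 1 := by omega
      have hle' := Nat.size_le_size hle
      have hpos : s 3 ≠ 0 := by rw [hj]; positivity
      have hd := size_half_lt (n := s 3 + s 3) (by omega)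
      rw [show (s 3 + s 3) / 2 = s 3 by omega] at hd
      refine ⟨_, n, hn.trans (by simp [Prog.block, Prog.nodes]), h, ?_, ?_⟩
      · simp [Prog.block, Prog.effect, Op.eval, hs0, hs1, hs2, hs5]
        refine ⟨⟨j + 1, ?_⟩, ?_⟩
        · rw [hj]; ring
        · omega
      · simp [Prog.block, Prog.effect, Op.eval]
        omega)
    s₂ (by
      simp [hs₂, hs₁0, hs₁1, hs₁2]
      exact ⟨⟨0, by simp⟩, by omega⟩)
  obtain ⟨ht0, ht1, ht2, ht5, ht4', ⟨j, hj⟩, htsz⟩ := ht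
  obtain ⟨u, m, hm, hr', hu, hu4⟩ := Runs.exists_loop (r := 4)
    (p := .block [
            .assign 3 (.half 3),
            .assign 5 (.add 1 2),
            .assign 5 (.sub 5 3),
            .ite 5 (.assign 1 (.sub 1 3)) .skip,
            .assign 4 (.sub 3 0)])
    (fun s => s 0 = x 0 ∧ s 2 = 1 ∧ s 4 = s 3 - x 0 ∧ (∃ j, s 3 = x 0 * 2 ^ j) ∧
      s 1 < s 3 ∧ (x 0 ∣ s 1 ↔ x 0 ∣ x 1))
    (fun s => (s 3).size) 25
    (by
      rintro s ⟨hs0, hs2, hs4, ⟨j, hj⟩, hlt, hdvd⟩ hne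
      obtain ⟨n, hn, h⟩ := Prog.exists_runs_effect
        (.block [
            .assign 3 (.half 3),
            .assign 5 (.add 1 2),
            .assign 5 (.sub 5 3),
            .ite 5 (.assign 1 (.sub 1 3)) .skip,
            .assign 4 (.sub 3 0)]) rfl s
      obtain ⟨i, rfl⟩ : ∃ i, j = i + 1 := by
        rcases j with _ | i
        · simp at hj; omega
        · exact ⟨i, rfl⟩
      have hdbl : s 3 = 2 * (x 0 * 2 ^ i) := by rw [hj]; ring
      have hhalf : s 3 / 2 = x 0 * 2 ^ i := by rw [hdbl]; omega
      have hd := size_half_lt (n := s 3) (by omega)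
      refine ⟨_, n, hn.trans (by simp [Prog.block, Prog.nodes]), h, ?_, ?_⟩
      · simp only [Prog.block, Prog.effect, Op.eval, Function.update_apply]
        by_cases hc : s 1 + 1 - s 3 / 2 = 0
        · simp [hs0, hs2, hc, hdvd]
          exact ⟨⟨i, hhalf⟩, by omega⟩
        · simp [hs0, hs2, hc]
          refine ⟨⟨i, hhalf⟩, by omega, ?_⟩
          rw [← hdvd]
          exact (Nat.dvd_sub_iff_left (by omega) (hhalf ▸ Dvd.intro _ rfl))
      · simp only [Prog.block, Prog.effect, Op.eval, Function.update_apply]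
        by_cases hc : s 1 + 1 - s 3 / 2 = 0 <;> simp [hs2, hc] <;> omega)
    (Function.update t 4 (t 3 - x 0)) (by
      simp [ht0, ht1, ht2]
      exact ⟨⟨j, hj⟩, by omega⟩)
  obtain ⟨hu0, hu2, hu4', ⟨j', hj'⟩, hult, hudvd⟩ := hu
  have hr₀ : Runs (.block [
          .assign 3 (.reg 0),
          .assign 5 (.add 1 2),
          .assign 4 (.sub 5 3),
          .loop 4 (.block [.assign 3 (.add 3 3), .assign 4 (.sub 5 3)]),
          .assign 4 (.sub 3 0),
          .loop 4 (.block [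
            .assign 3 (.half 3),
            .assign 5 (.add 1 2),
            .assign 5 (.sub 5 3),
            .ite 5 (.assign 1 (.sub 1 3)) .skip,
            .assign 4 (.sub 3 0)])]) s₁ u (n + m + 11) := by
    have e4 : Function.update t 4 (t 3 - x 0) = Function.update t 4 ((Op.sub 3 0).eval t) := by
      simp [Op.eval, ht0]
    rw [e4] at hr'
    have key := Runs.block_cons hr (Runs.block_cons (Runs.assign 4 (.sub 3 0) t)
      (Runs.block_cons hr' (Runs.block_nil _)))
    have e₂ : s₂ = Function.update (Function.update (Function.update s₁ 3 ((Op.reg 0).eval s₁)) 5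
        ((Op.add 1 2).eval (Function.update s₁ 3 ((Op.reg 0).eval s₁)))) 4
        ((Op.sub 5 3).eval (Function.update (Function.update s₁ 3 ((Op.reg 0).eval s₁)) 5
        ((Op.add 1 2).eval (Function.update s₁ 3 ((Op.reg 0).eval s₁))))) := by
      rw [hs₂]
      simp [Op.eval, hs₁0, hs₁1, hs₁2]
    rw [e₂] at key
    have := Runs.block_cons (Runs.assign 3 (.reg 0) s₁) (Runs.block_cons (Runs.assign 5 (.add 1 2) _)
      (Runs.block_cons (Runs.assign 4 (.sub 5 3) _) key))
    rw [show n + m + 11 = 1 + m + 1 + 1 + 1 + n + 1 + 1 + 1 + 1 + 1 + 1 + 1 by ring]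
    exact this
  refine ⟨_, _, ?_, Runs.block_cons (Runs.assign 2 (.const 1) (initRegs x))
      (Runs.block_cons (Runs.ite (n := n + m + 11) (t := u) ?_)
        (Runs.block_cons (Runs.assign 0 (.sub 2 1) u) (Runs.block_nil _))), ?_⟩
  · simp only [Function.update_apply] at hm hn
    simp at hm
    omega
  · change Runs (if s₁ 0 = 0 then _ else _) s₁ u _
    rw [if_neg (by rwa [hs₁0])]
    exact hr₀
  · simp only [Op.eval, Function.update_self, hu2]
    have hj0 : u 3 = x 0 := by
      have : x 0 * 1 ≤ x 0 * 2 ^ j' := Nat.mul_le_mul_left _ Nat.one_le_two_pow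
      omega
    rw [hj0] at hult
    by_cases h : u 1 = 0
    · rw [if_pos (hudvd.1 (h ▸ dvd_zero _)), h]
    · rw [if_neg fun h' => Nat.not_dvd_of_pos_of_lt (by omega) hult (hudvd.2 h')]
      omega

theorem dropEntries_zero_left (i : ℕ) : dropEntries 0 i = 0 := by
  rw [dropEntries]; simp

theorem entrySym_eval (x : Fin 2 → ℕ) : ClockedMachine.eval entrySym x = entry (x 0) (x 1) := by
  obtain ⟨h0, h1, h2⟩ := initRegs_two x
  have hlen : inputLength x = (x 0).size + (x 1).size := by simp [inputLength]
  have hq : ∀ w : ℕ, w ≠ 0 → (w / 2 / 2).size < w.size := fun w hw =>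
    lt_of_le_of_lt (Nat.size_le_size (Nat.div_le_self _ 2)) (by have := size_half_lt hw; omega)
  obtain ⟨t, n, hn, hr, ht, ht1⟩ := Runs.exists_loop (r := 1)
    (p := .ite 0
        (.block [
          .assign 3 (.half 0),
          .assign 3 (.half 3),
          .assign 4 (.add 3 3),
          .assign 4 (.add 4 4),
          .assign 4 (.sub 0 4),
          .assign 4 (.sub 4 2),
          .ite 4 (.assign 1 (.sub 1 2)) .skip,
          .assign 0 (.reg 3)])
        (.assign 1 (.const 0)))
    (fun s => s 2 = 1 ∧ s 6 = 0 ∧ (s 0).size ≤ (x 0).size ∧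
      dropEntries (s 0) (s 1) = dropEntries (x 0) (x 1))
    (fun s => (s 0).size + if s 1 = 0 then 0 else 1) 25
    (by
      rintro s ⟨hs2, hs6, hsz, hs⟩ hs1
      obtain ⟨n, hn, h⟩ := Prog.exists_runs_effect (.ite 0
        (.block [
          .assign 3 (.half 0),
          .assign 3 (.half 3),
          .assign 4 (.add 3 3),
          .assign 4 (.add 4 4),
          .assign 4 (.sub 0 4),
          .assign 4 (.sub 4 2),
          .ite 4 (.assign 1 (.sub 1 2)) .skip,
          .assign 0 (.reg 3)])
        (.assign 1 (.const 0))) rfl s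
      refine ⟨_, n, hn.trans (by simp [Prog.block, Prog.nodes]), h, ?_, ?_⟩
      · simp only [Prog.block, Prog.effect, Op.eval, Function.update_apply]
        by_cases hw : s 0 = 0
        · simp [hw, hs2, hs6]
          rw [← hs, hw, dropEntries_zero_left, dropEntries_zero_left]
        · have hlt := hq _ hw
          rw [dropEntries, dif_neg (by omega)] at hs
          by_cases hc : 2 ≤ s 0 % 4
          · have hc' : s 0 - (s 0 / 2 / 2 + s 0 / 2 / 2 + (s 0 / 2 / 2 + s 0 / 2 / 2)) - 1 ≠ 0 := by
              omega
            simp [hw, hs2, hs6, hc']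
            rw [if_pos hc] at hs
            refine ⟨by omega, ?_⟩
            rw [← hs, Nat.div_div_eq_div_mul]
          · have hc' : s 0 - (s 0 / 2 / 2 + s 0 / 2 / 2 + (s 0 / 2 / 2 + s 0 / 2 / 2)) - 1 = 0 := by
              omega
            simp [hw, hs2, hs6, hc']
            rw [if_neg hc] at hs
            refine ⟨by omega, ?_⟩
            rw [← hs, Nat.div_div_eq_div_mul]
      · simp only [Prog.block, Prog.effect, Op.eval, Function.update_apply]
        by_cases hw : s 0 = 0
        · simp [hw, hs1]
        · have hlt := hq _ hw
          by_cases hc' : s 0 - (s 0 / 2 / 2 + s 0 / 2 / 2 + (s 0 / 2 / 2 + s 0 / 2 / 2)) - 1 = 0 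
          · simp [hw, hs2, hc', hs1]; omega
          · simp [hw, hs2, hc', hs1]; split_ifs <;> omega)
    (Function.update (initRegs x) 2 1) (by simp [h0, h1, h2])
  obtain ⟨ht2, ht6, htsz, ht⟩ := ht
  rw [ht1, show dropEntries (t 0) 0 = t 0 by rw [dropEntries]; simp] at ht
  obtain ⟨u, m, hm, hr', ⟨hu2, hu⟩, hu0⟩ := Runs.exists_loop (r := 0)
    (p := .block [
        .assign 3 (.half 0),
        .assign 3 (.half 3),
        .assign 4 (.add 3 3),
        .assign 4 (.add 4 4),
        .assign 4 (.sub 0 4),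
        .assign 7 (.sub 4 2),
        .ite 7 (.assign 3 (.const 0)) (.ite 4 (.assign 6 (.add 6 5)) .skip),
        .assign 5 (.add 5 5),
        .assign 0 (.reg 3)])
    (fun s => s 2 = 1 ∧ s 6 + s 5 * firstEntry (s 0) = entry (x 0) (x 1))
    (fun s => (s 0).size) 25
    (by
      rintro s ⟨hs2, hs⟩ hw
      obtain ⟨n, hn, h⟩ := Prog.exists_runs_effect (.block [
        .assign 3 (.half 0),
        .assign 3 (.half 3),
        .assign 4 (.add 3 3),
        .assign 4 (.add 4 4),
        .assign 4 (.sub 0 4),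
        .assign 7 (.sub 4 2),
        .ite 7 (.assign 3 (.const 0)) (.ite 4 (.assign 6 (.add 6 5)) .skip),
        .assign 5 (.add 5 5),
        .assign 0 (.reg 3)]) rfl s
      have hlt := hq _ hw
      have hdig : s 0 - (s 0 / 2 / 2 + s 0 / 2 / 2 + (s 0 / 2 / 2 + s 0 / 2 / 2)) = s 0 % 4 := by
        omega
      have h4 : s 0 / 2 / 2 = s 0 / 4 := by rw [Nat.div_div_eq_div_mul]
      have hsp := size_half_lt hw
      refine ⟨_, n, hn.trans (by simp [Prog.block, Prog.nodes]), h, ?_, ?_⟩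
      · rw [firstEntry, dif_neg hw] at hs
        simp only [Prog.block, Prog.effect, Op.eval, Function.update_apply]
        by_cases hc : 2 ≤ s 0 % 4
        · have hc' : s 0 % 4 - 1 ≠ 0 := by omega
          simp [hs2, hdig, hc', firstEntry]
          rw [if_pos hc] at hs
          simpa using hs
        · have hc' : s 0 % 4 - 1 = 0 := by omega
          rw [if_neg hc] at hs
          by_cases hz : s 0 % 4 = 0
          · simp [hs2, hdig, hz]
            rw [← hs, hz, h4]; ring
          · simp [hs2, hdig, hc', hz]
            rw [← hs, show s 0 % 4 = 1 by omega, h4]; ring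
      · simp only [Prog.block, Prog.effect, Op.eval, Function.update_apply]
        by_cases hc' : s 0 % 4 - 1 = 0 <;> by_cases hz : s 0 % 4 = 0 <;>
          simp [hs2, hdig, hc', hz] <;> omega)
    (Function.update t 5 1) (by simp [ht2, ht6, ht, entry])
  have hp := Runs.block_cons (Runs.assign 2 (.const 1) (initRegs x))
    (Runs.block_cons hr (Runs.block_cons (Runs.assign 5 (.const 1) t)
      (Runs.block_cons hr' (Runs.block_cons (Runs.assign 0 (.reg 6) u) (Runs.block_nil _)))))
  rw [ClockedMachine.eval_eq (M := entrySym) hp]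
  · simp only [Op.eval, Function.update_self]
    simpa [hu0, firstEntry] using hu
  · simp [entrySym, hlen]
    simp [h0, h1] at hn
    simp  at hm
    split_ifs at hn <;> omega

/-! ### Formulas -/

open FirstOrder.Language

section Formulas

variable {α : Type} {n : ℕ}

/-- The term `1`. -/
noncomputable def one : PV.Term α := Constants.term oneSym

/-- The term `2`. -/
noncomputable def two : PV.Term α := Constants.term twoSym

/-- The formula `t ≤ u`. -/
noncomputable def leF (t u : PV.Term (α ⊕ Fin n)) : PV.BoundedFormula α n :=
  (leSym.apply₂ t u).bdEqual one

/-- The formula `t ∣ u`. -/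
noncomputable def dvdF (t u : PV.Term (α ⊕ Fin n)) : PV.BoundedFormula α n :=
  (dvdSym.apply₂ t u).bdEqual one

/-- The term `|t|`. -/
noncomputable def len (t : PV.Term α) : PV.Term α := lenSym.apply₁ t

/-- A term in the first `n` bound variables, viewed as a term in `n + 1` bound variables. -/
def liftTerm (t : PV.Term (α ⊕ Fin n)) : PV.Term (α ⊕ Fin (n + 1)) :=
  t.relabel (Sum.map id Fin.castSucc)

/-- The formula `(∀ v ≤ t) φ`, where `v` is the last variable of `φ` and does not occur in `t`. -/
noncomputable def ballF (t : PV.Term (α ⊕ Fin n)) (φ : PV.BoundedFormula α (n + 1)) :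
    PV.BoundedFormula α n :=
  ((leF (&(Fin.last n)) (liftTerm t)).imp φ).all

/-- The formula `(∃ v ≤ t) φ`, where `v` is the last variable of `φ` and does not occur in `t`. -/
noncomputable def bexF (t : PV.Term (α ⊕ Fin n)) (φ : PV.BoundedFormula α (n + 1)) :
    PV.BoundedFormula α n :=
  (leF (&(Fin.last n)) (liftTerm t) ⊓ φ).ex

end Formulas

/-- The class `Σ^b_0` of sharply bounded formulas: the closure of the atomic formulas under
propositional connectives and sharply bounded quantifiers `(∀ v ≤ |t|)` and `(∃ v ≤ |t|)`. -/
inductive IsSharplyBounded {α : Type} : ∀ {n : ℕ}, PV.BoundedFormula α n → Prop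
  | atomic {n : ℕ} {φ : PV.BoundedFormula α n} (h : φ.IsAtomic) : IsSharplyBounded φ
  | falsum {n : ℕ} : IsSharplyBounded (BoundedFormula.falsum : PV.BoundedFormula α n)
  | imp {n : ℕ} {φ ψ : PV.BoundedFormula α n} (h₁ : IsSharplyBounded φ)
      (h₂ : IsSharplyBounded ψ) : IsSharplyBounded (φ.imp ψ)
  | ball {n : ℕ} {φ : PV.BoundedFormula α (n + 1)} (t : PV.Term (α ⊕ Fin n))
      (h : IsSharplyBounded φ) : IsSharplyBounded (ballF (len t) φ)
  | bex {n : ℕ} {φ : PV.BoundedFormula α (n + 1)} (t : PV.Term (α ⊕ Fin n))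
      (h : IsSharplyBounded φ) : IsSharplyBounded (bexF (len t) φ)

/-! ### The sharply bounded choice scheme -/

/-- Names for the variables in an instance of the scheme: parameters, and `a`, `i`, `y`. -/
inductive ChoiceVar (m : ℕ)
  | param (j : Fin m)
  | a
  | i
  | y

/-- The positions of the variables under the quantifiers: parameters first, then `a`, and then
two more places. -/
def ChoiceVar.place {m : ℕ} (pi py : Fin (m + 3)) : ChoiceVar m → Empty ⊕ Fin (m + 3)
  | .param j => .inr (j.castAdd 3)
  | .a => .inr (Fin.natAdd m 0)
  | .i => .inr pi
  | .y => .inr py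

/-- The substitution of `[y]_i` for `y`. -/
noncomputable def ChoiceVar.entrySubst {m : ℕ} : ChoiceVar m → PV.Term (ChoiceVar m)
  | .y => entrySym.apply₂ (Term.var .y) (Term.var .i)
  | v => Term.var v

/-- The instance of the sharply bounded choice scheme for a formula `φ(i, y)` with parameters,
among them possibly `a`: the universal closure of
`(∀ i ≤ |a|) (∃ y ≤ a) φ(i, y) → ∃ w, (∀ i ≤ |a|) φ(i, [w]_i)`. -/
noncomputable def choiceAxiom {m : ℕ} (φ : PV.Formula (ChoiceVar m)) : PV.Sentence :=
  BoundedFormula.alls (n := m + 1)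
    ((ballF (len (&(Fin.last m)))
        (bexF (&(Fin.last m).castSucc)
          (BoundedFormula.relabel (k := 0)
            (ChoiceVar.place (Fin.natAdd m 1) (Fin.natAdd m 2)) φ))).imp
      (ballF (len (&(Fin.last m).castSucc))
        (BoundedFormula.relabel (k := 0)
          (ChoiceVar.place (Fin.natAdd m 2) (Fin.natAdd m 1))
          (φ.subst ChoiceVar.entrySubst))).ex)

/-- The sharply bounded choice scheme `BB(Σ^b_0)`. -/
def BB : PV.Theory :=
  {σ | ∃ (m : ℕ) (φ : PV.Formula (ChoiceVar m)), IsSharplyBounded φ ∧ σ = choiceAxiom φ}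

/-! ### The sentence PrimeFactor -/

/-- The open formula `2 ≤ y ∧ y ∣ x ∧ (z ∣ y → z = 1 ∨ z = y)` in the variables `x, y, z`. -/
noncomputable def primeFactor₀ : PV.BoundedFormula Empty 3 :=
  leF two (&1) ⊓ (dvdF (&1) (&0) ⊓
    (dvdF (&2) (&1)).imp (Term.bdEqual (&2) one ⊔ Term.bdEqual (&2) (&1)))

/-- The sentence `(∀ x ≥ 2) (∃ y ≤ x) (∀ z ≤ y) (2 ≤ y ∧ y ∣ x ∧ (z ∣ y → z = 1 ∨ z = y))`. -/
noncomputable def primeFactor : PV.Sentence :=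
  ((leF two (&0)).imp (bexF (&0) (ballF (&1) primeFactor₀))).all

section Models

variable {M : Type} [PV.Structure M]

/-- The element `1` of a structure for PV. -/
noncomputable def oneIn (M : Type) [PV.Structure M] : M := Structure.funMap oneSym ![]

/-- The element `2` of a structure for PV. -/
noncomputable def twoIn (M : Type) [PV.Structure M] : M := Structure.funMap twoSym ![]

/-- The relation `x ≤ y` of a structure for PV. -/
def LeIn (x y : M) : Prop := Structure.funMap leSym ![x, y] = oneIn M

/-- The relation `x ∣ y` of a structure for PV. -/
def DvdIn (x y : M) : Prop := Structure.funMap dvdSym ![x, y] = oneIn M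

/-- `p` is prime in the sense of the structure `M`. -/
def PrimeIn (p : M) : Prop := LeIn (twoIn M) p ∧ ∀ z, DvdIn z p → z = oneIn M ∨ z = p

end Models

/-! ### Boolean circuits and the hardness of factoring -/

/-- Gates of a Boolean circuit; the arguments of a gate are given by their wire numbers. -/
inductive Gate
  | const (b : Bool)
  | not (i : ℕ)
  | and (i j : ℕ)
  | or (i j : ℕ)

/-- The value of a gate, given the values of the preceding wires. Wire numbers that are out of
range stand for the constant `false`. -/
def Gate.eval : Gate → List Bool → Bool
  | .const b, _ => b
  | .not i, v => !v.getD i false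
  | .and i j, v => v.getD i false && v.getD j false
  | .or i j, v => v.getD i false || v.getD j false

/-- A Boolean circuit with `m` inputs and `k` outputs. Wires `0, …, m - 1` carry the inputs, and
wire `m + j` carries the value of the `j`-th gate. -/
structure Circuit (m k : ℕ) where
  gates : List Gate
  out : Fin k → ℕ

/-- The size of a circuit is the number of its gates. -/
def Circuit.size {m k : ℕ} (C : Circuit m k) : ℕ := C.gates.length

/-- The values of all wires of a circuit. -/
def Circuit.wires {m k : ℕ} (C : Circuit m k) (x : Fin m → Bool) : List Bool :=
  C.gates.foldl (fun v g => v ++ [g.eval v]) (List.ofFn x)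

/-- The function computed by a circuit on numbers: the input `N` is given by its `m` least
significant binary digits, and the outputs are the binary digits of the value, both with the least
significant digit first. -/
def Circuit.evalNat {m k : ℕ} (C : Circuit m k) (N : ℕ) : ℕ :=
  ∑ j : Fin k, if (C.wires fun i => N.testBit i).getD (C.out j) false then 2 ^ (j : ℕ) else 0

/-- The set `P_n` of all primes of binary length `n`. -/
def primesOfLength (n : ℕ) : Finset ℕ := {p ∈ Finset.range (2 ^ n) | p.Prime ∧ p.size = n}

/-- The probability that `C(p * q) ∈ {p, q}` for `p` and `q` sampled uniformly and independently
from `P_n`. -/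
noncomputable def factoringProb (n : ℕ) (C : Circuit (2 * n) n) : ℝ :=
  (Finset.card {pq ∈ primesOfLength n ×ˢ primesOfLength n |
      C.evalNat (pq.1 * pq.2) = pq.1 ∨ C.evalNat (pq.1 * pq.2) = pq.2} : ℝ) /
    (Finset.card (primesOfLength n ×ˢ primesOfLength n) : ℝ)

end BoundedArith

/-! The countermodel is a substructure of the ultrapower of the standard model whose elements cannot
tell certain primes apart. At stage `u` there are `2 ^ u` distinct odd primes below `2 ^ n`, indexed
by the cube `Fin u → Bool`. The generators are the product `z 0` of all these primes and, for each
coordinate `v`, the product `z (v + 1)` of the primes whose index is true at `v` (`partProd`). The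
elements of the model are the values of uniform families (`uniformFam`): what can be computed from
the `z v` and from an arbitrary number `j` of polynomial magnitude by functions of PV, by search
over polynomially many numbers, and by collecting polynomially many values in one code.

Hardness of factoring enters as follows. A family that depends on `z 0, …, z k` only sees the first
`k` coordinates of the cube. Let `p` and `q` stand at two places that agree in these coordinates,
and suppose that some value of the family is divisible by `p` but not by `q`. With all other primes
hard-wired, each of `z 0, …, z k` is a constant or a constant times `p * q`, so the value can be
computed from `p * q`, and its gcd with `p * q` is a proper factor (`exists_factoring_circuits`). If
every assignment of primes to places allowed such a separation, averaging
(`exists_fiber_of_forall_injective`) would fix one family, two places and all the other primes for a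
constant fraction of the pairs. Hence for every `u` some assignment is not separated by the first
`u` families (`exists_unseparated`). The circuits exist because uniform families are feasible
(`uniformFam.feasible`), which rests on the simulation of machines in `ClockedMachine.exists_cost`.

Now let `a ≥ 2` divide the element `m` given by `z 0`, and let `a` depend on `z 0, …, z k`. Some
prime `τ s` divides `a`, hence so do the primes at the indices that arise from `s` by setting
coordinate `k` either way. One of them divides `z (k + 1)` and the other does not, so the gcd of `a`
and `z (k + 1)` is neither `1` nor `a` (`gcd_partProd_succ`). Thus no divisor of `m` is prime.

The model satisfies the theory. Universal sentences descend from the ultrapower. Since every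
sequence of small numbers is in the model, Łoś's theorem holds for sharply bounded formulas
(`realize_sharplyBounded`). For sharply bounded choice, a diagonal argument over the countably many
families shows that finitely many of them provide all witnesses at almost all stages
(`exists_uniform_bound`); search finds these witnesses and collection puts them into one sequence.
-/

namespace BoundedArith

open FirstOrder.Language

/-! ### Counting gates -/

section Gates

variable {X : Type}

/-- The functions computed by one gate applied to functions in `Δ`. -/
inductive IsGate (Δ : Set (X → Bool)) : (X → Bool) → Prop
  | const (b : Bool) : IsGate Δ fun _ => b
  | not {f : X → Bool} (hf : f ∈ Δ) : IsGate Δ fun x => !f x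
  | and {f g : X → Bool} (hf : f ∈ Δ) (hg : g ∈ Δ) : IsGate Δ fun x => f x && g x
  | or {f g : X → Bool} (hf : f ∈ Δ) (hg : g ∈ Δ) : IsGate Δ fun x => f x || g x

theorem IsGate.mono {Δ Δ' : Set (X → Bool)} (h : Δ ⊆ Δ') {f : X → Bool} (hf : IsGate Δ f) :
    IsGate Δ' f := by
  cases hf with
  | const b => exact .const b
  | not hf => exact .not (h hf)
  | and hf hg => exact .and (h hf) (h hg)
  | or hf hg => exact .or (h hf) (h hg)

/-- `Built Γ s Δ`: a circuit with `s` gates and inputs `Γ` has precisely the wires `Δ`. -/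
inductive Built (Γ : Set (X → Bool)) : ℕ → Set (X → Bool) → Prop
  | base : Built Γ 0 Γ
  | gate {s : ℕ} {Δ : Set (X → Bool)} {f : X → Bool} (h : Built Γ s Δ) (hf : IsGate Δ f) :
      Built Γ (s + 1) (insert f Δ)

/-- The gates of the second circuit are replayed on top of the first. The composite keeps wires that
the second circuit never had, so it contains `E` without being equal to it. -/
theorem Built.trans {Γ Δ Γ' E : Set (X → Bool)} {s t : ℕ} (h : Built Γ s Δ) (h' : Built Γ' t E)
    (hsub : Γ' ⊆ Δ) : ∃ E', Built Γ (s + t) E' ∧ E ⊆ E' ∧ Δ ⊆ E' := by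
  induction h' with
  | base => exact ⟨Δ, h, hsub, subset_rfl⟩
  | gate _ hf ih =>
    obtain ⟨E', hb, h1, h2⟩ := ih
    exact ⟨_, hb.gate (hf.mono h1), Set.insert_subset_insert h1, h2.trans (Set.subset_insert _ _)⟩

theorem Built.subset {Γ Δ : Set (X → Bool)} {s : ℕ} (h : Built Γ s Δ) : Γ ⊆ Δ := by
  induction h with
  | base => exact subset_rfl
  | gate _ _ ih => exact ih.trans (Set.subset_insert _ _)

/-- `Cost Γ s Δ`: a circuit with at most `s` gates computes all of `Δ` from `Γ`. -/
def Cost (Γ : Set (X → Bool)) (s : ℕ) (Δ : Set (X → Bool)) : Prop :=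
  ∃ s' ≤ s, ∃ Δ', Built Γ s' Δ' ∧ Δ ⊆ Δ'

namespace Cost

variable {Γ Γ' Δ Δ' E : Set (X → Bool)} {s s' t : ℕ}

theorem of_subset (h : Δ ⊆ Γ) (s : ℕ) : Cost Γ s Δ := ⟨0, Nat.zero_le _, Γ, .base, h⟩

theorem mem {f : X → Bool} (h : f ∈ Γ) (s : ℕ) : Cost Γ s {f} := of_subset (by simpa) s

theorem mono (h : Cost Γ s Δ) (hs : s ≤ s') (hΔ : Δ' ⊆ Δ) : Cost Γ s' Δ' := by
  obtain ⟨u, hu, E, hb, hE⟩ := h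
  exact ⟨u, hu.trans hs, E, hb, hΔ.trans hE⟩

theorem le (h : Cost Γ s Δ) (hs : s ≤ s') : Cost Γ s' Δ := h.mono hs subset_rfl

/-- Wires remain available once computed: the second circuit may reuse the inputs, and the
intermediate results are kept. In `comp` both are forgotten. -/
theorem trans (h : Cost Γ s Δ) (h' : Cost (Γ ∪ Δ) t E) : Cost Γ (s + t) (Δ ∪ E) := by
  obtain ⟨u, hu, D, hb, hD⟩ := h
  obtain ⟨v, hv, F, hb', hF⟩ := h'
  obtain ⟨G, hG, h1, h2⟩ := hb.trans hb' (Set.union_subset hb.subset hD)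
  exact ⟨_, by omega, G, hG, Set.union_subset (hD.trans h2) (hF.trans h1)⟩

theorem comp (h : Cost Γ s Δ) (h' : Cost Δ t E) : Cost Γ (s + t) E := by
  obtain ⟨u, hu, D, hb, hD⟩ := h
  obtain ⟨v, hv, F, hb', hF⟩ := h'
  obtain ⟨G, hG, h1, -⟩ := hb.trans hb' hD
  exact ⟨_, by omega, G, hG, hF.trans h1⟩

theorem weaken (h : Cost Γ s Δ) (hΓ : Γ ⊆ Γ') : Cost Γ' s Δ := by
  simpa using (of_subset hΓ 0).comp h

theorem union (h : Cost Γ s Δ) (h' : Cost Γ t E) : Cost Γ (s + t) (Δ ∪ E) :=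
  h.trans (h'.weaken Set.subset_union_left)

theorem biUnion {ι : Type} (I : Finset ι) {D : ι → Set (X → Bool)}
    (h : ∀ i ∈ I, Cost Γ s (D i)) : Cost Γ (I.card * s) (⋃ i ∈ I, D i) := by
  classical
  induction I using Finset.induction_on with
  | empty => exact of_subset (by simp) _
  | insert a I ha ih =>
    have h1 := (h a (by simp)).union (ih fun i hi => h i (by simp [hi]))
    refine h1.mono (by rw [Finset.card_insert_of_notMem ha]; apply le_of_eq; ring) ?_
    simp

theorem chain {D : ℕ → Set (X → Bool)} (n : ℕ) (h : ∀ i < n, Cost (D i) s (D (i + 1))) :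
    Cost (D 0) (n * s) (D n) := by
  induction n with
  | zero => exact of_subset subset_rfl _
  | succ n ih =>
    exact ((ih fun i hi => h i (by omega)).comp (h n (by omega))).le (by apply le_of_eq; ring)

theorem const (b : Bool) : Cost Γ 1 {fun _ => b} :=
  ⟨1, le_rfl, _, Built.base.gate (.const b), by simp⟩

theorem not {f : X → Bool} (h : Cost Γ s {f}) : Cost Γ (s + 1) {fun x => !f x} :=
  h.comp ⟨1, le_rfl, _, Built.base.gate (.not rfl), by simp⟩

theorem and {f g : X → Bool} (h : Cost Γ s {f}) (h' : Cost Γ t {g}) :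
    Cost Γ (s + t + 1) {fun x => f x && g x} :=
  (h.union h').comp ⟨1, le_rfl, _, Built.base.gate (.and (.inl rfl) (.inr rfl)), by simp⟩

theorem or {f g : X → Bool} (h : Cost Γ s {f}) (h' : Cost Γ t {g}) :
    Cost Γ (s + t + 1) {fun x => f x || g x} :=
  (h.union h').comp ⟨1, le_rfl, _, Built.base.gate (.or (.inl rfl) (.inr rfl)), by simp⟩

theorem xor {f g : X → Bool} (h : Cost Γ s {f}) (h' : Cost Γ t {g}) :
    Cost Γ (2 * s + 2 * t + 5) {fun x => f x ^^ g x} := by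
  have := (h.and h'.not).or (h.not.and h')
  convert! this.le (s' := 2 * s + 2 * t + 5) (by omega) using 3
  rename_i x
  cases f x <;> cases g x <;> rfl

theorem any {ι : Type} (I : Finset ι) {f : ι → X → Bool} (h : ∀ i ∈ I, Cost Γ s {f i}) :
    Cost Γ (I.card * (s + 1) + 1) {fun x => decide (∃ i ∈ I, f i x = true)} := by
  classical
  induction I using Finset.induction_on with
  | empty => simpa using const false
  | insert a I ha ih =>
    have h1 := (h a (by simp)).or (ih fun i hi => h i (by simp [hi]))
    rw [Finset.card_insert_of_notMem ha]
    convert! h1.le (s' := (I.card + 1) * (s + 1) + 1) (by apply le_of_eq; ring) using 3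
    simp

/-- Definition by cases. -/
theorem select {ι : Type} [DecidableEq ι] (I : Finset ι) {k : X → ι} (hk : ∀ x, k x ∈ I)
    {f : ι → X → Bool} (h : ∀ i ∈ I, Cost Γ s {f i})
    (h' : ∀ i ∈ I, Cost Γ t {fun x => decide (k x = i)}) :
    Cost Γ (I.card * (s + t + 2) + 1) {fun x => f (k x) x} := by
  -- The indicator of each case masks its branch, so at most one disjunct can be true.
  have h1 := any I (f := fun i x => decide (k x = i) && f i x) fun i hi => (h' i hi).and (h i hi)
  convert! h1.le (s' := I.card * (s + t + 2) + 1) (by apply le_of_eq; ring) using 3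
  rename_i x
  have := hk x
  simp [this]

end Cost

/-! ### Words -/

/-- The functions giving the `w` least significant bits of `A`. -/
def bits (w : ℕ) (A : X → ℕ) : Set (X → Bool) := {f | ∃ i < w, f = fun x => (A x).testBit i}

theorem mem_bits {w i : ℕ} (A : X → ℕ) (h : i < w) : (fun x => (A x).testBit i) ∈ bits w A :=
  ⟨i, h, rfl⟩

namespace Cost

variable {Γ : Set (X → Bool)} {s t v w : ℕ} {A B : X → ℕ}

theorem of_bits (h : ∀ i < w, Cost Γ s {fun x => (A x).testBit i}) : Cost Γ (w * s) (bits w A) := by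
  have := biUnion (Finset.range w) (D := fun i => {fun x => (A x).testBit i})
    fun i hi => h i (Finset.mem_range.1 hi)
  rw [Finset.card_range] at this
  refine this.mono le_rfl ?_
  rintro _ ⟨i, hi, rfl⟩
  simp
  exact ⟨i, hi, rfl⟩

/-- Positions from `w` on carry zeros, which one constant gate supplies. -/
theorem testBit (h : bits w A ⊆ Γ) (hA : ∀ x, A x < 2 ^ w) (i : ℕ) :
    Cost Γ 1 {fun x => (A x).testBit i} := by
  by_cases hi : i < w
  · exact mem (h (mem_bits A hi)) 1
  · convert! const false using 3
    rename_i x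
    exact Nat.testBit_lt_two_pow ((hA x).trans_le (Nat.pow_le_pow_right (by omega) (by omega)))

theorem bits_extend (h : bits w A ⊆ Γ) (hA : ∀ x, A x < 2 ^ w) (v : ℕ) :
    Cost Γ v (bits v A) :=
  (of_bits fun i _ => testBit h hA i).le (by omega)

theorem bits_const (n w : ℕ) : Cost Γ w (bits w fun _ => n) :=
  (of_bits fun _ _ => const _).le (by omega)

end Cost

/-! ### Binary arithmetic with carries -/

theorem mod_two_pow_succ' (a i : ℕ) :
    a % 2 ^ (i + 1) = 2 ^ i * (a.testBit i).toNat + a % 2 ^ i := by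
  rw [pow_succ, Nat.mod_mul, Nat.testBit_eq_decide_div_mod_eq]
  rcases Nat.mod_two_eq_zero_or_one (a / 2 ^ i) with h | h <;> simp [h, add_comm]

/-- The carry into position `i` in the addition of `a`, `b` and `c`. -/
def carryAt (i a b c : ℕ) : Bool := decide (2 ^ i ≤ a % 2 ^ i + b % 2 ^ i + c)

/-- The full adder: the new carry is the majority of two digits and the old carry. As `c ≤ 1`, the
sum of the low parts stays below `2 * 2 ^ i`, so a carry never exceeds one. -/
theorem carryAt_succ (i a b c : ℕ) (hc : c ≤ 1) : carryAt (i + 1) a b c =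
    ((a.testBit i && b.testBit i) || (carryAt i a b c && (a.testBit i || b.testBit i))) := by
  have ha := Nat.mod_lt a (y := 2 ^ i) (by positivity)
  have hb := Nat.mod_lt b (y := 2 ^ i) (by positivity)
  simp only [carryAt, mod_two_pow_succ']
  rw [pow_succ]
  cases a.testBit i <;> cases b.testBit i <;>
    by_cases h : 2 ^ i ≤ a % 2 ^ i + b % 2 ^ i + c <;> simp [h] <;> omega

theorem testBit_add_carry (i a b c : ℕ) (hc : c ≤ 1) : (a + b + c).testBit i =
    (a.testBit i ^^ (b.testBit i ^^ carryAt i a b c)) := by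
  have ha := Nat.mod_lt a (y := 2 ^ i) (by positivity)
  have hb := Nat.mod_lt b (y := 2 ^ i) (by positivity)
  have key : (a + b + c) / 2 ^ i = a / 2 ^ i + b / 2 ^ i + (carryAt i a b c).toNat := by
    conv_lhs => rw [← Nat.div_add_mod a (2 ^ i), ← Nat.div_add_mod b (2 ^ i)]
    rw [show 2 ^ i * (a / 2 ^ i) + a % 2 ^ i + (2 ^ i * (b / 2 ^ i) + b % 2 ^ i) + c =
      a % 2 ^ i + b % 2 ^ i + c + 2 ^ i * (a / 2 ^ i + b / 2 ^ i) by ring,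
      Nat.add_mul_div_left _ _ (by positivity), add_comm]
    congr 1
    by_cases h : 2 ^ i ≤ a % 2 ^ i + b % 2 ^ i + c
    · simp only [carryAt, h, decide_true, Bool.toNat_true]
      rw [Nat.div_eq_iff (by positivity)]
      omega
    · simp only [carryAt, h, decide_false, Bool.toNat_false]
      exact Nat.div_eq_of_lt (by omega)
  rw [Nat.testBit_eq_decide_div_mod_eq, Nat.testBit_eq_decide_div_mod_eq,
    Nat.testBit_eq_decide_div_mod_eq, key]
  cases carryAt i a b c <;> rcases Nat.mod_two_eq_zero_or_one (a / 2 ^ i) with h | h <;>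
    rcases Nat.mod_two_eq_zero_or_one (b / 2 ^ i) with h' | h' <;>
    simp [Nat.add_mod, h, h']

namespace Cost

variable {Γ : Set (X → Bool)} {s t v w : ℕ} {A B : X → ℕ}

theorem carry (hA : bits w A ⊆ Γ) (hB : bits w B ⊆ Γ) {c : ℕ} (hc : c ≤ 1) :
    Cost Γ (w * 6 + 1) {f | ∃ i ≤ w, f = fun x => carryAt i (A x) (B x) c} := by
  have h0 : Cost Γ 1 {f | ∃ i ≤ 0, f = fun x => carryAt i (A x) (B x) c} := by
    refine (const (decide (1 ≤ c))).mono le_rfl ?_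
    rintro _ ⟨i, hi, rfl⟩
    obtain rfl : i = 0 := by omega
    simp [carryAt, Nat.mod_one]
  have h1 := chain (s := 6) (D := fun j => Γ ∪ {f | ∃ i ≤ j, f = fun x => carryAt i (A x) (B x) c})
    w (by
      intro j hj
      have ha : Cost (Γ ∪ {f | ∃ i ≤ j, f = fun x => carryAt i (A x) (B x) c}) 0
        {fun x => (A x).testBit j} := mem (.inl (hA (mem_bits A hj))) _
      have hb : Cost (Γ ∪ {f | ∃ i ≤ j, f = fun x => carryAt i (A x) (B x) c}) 0
        {fun x => (B x).testBit j} := mem (.inl (hB (mem_bits B hj))) _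
      have hcc : Cost (Γ ∪ {f | ∃ i ≤ j, f = fun x => carryAt i (A x) (B x) c}) 0
        {fun x => carryAt j (A x) (B x) c} := mem (.inr ⟨j, le_rfl, rfl⟩) _
      have := (of_subset (subset_refl
        (Γ ∪ {f | ∃ i ≤ j, f = fun x => carryAt i (A x) (B x) c})) 0).union
        ((ha.and hb).or (hcc.and (ha.or hb)))
      refine this.mono (by omega) ?_
      rintro f (hf | ⟨i, hi, rfl⟩)
      · exact .inl (.inl hf)
      · rcases Nat.lt_or_ge j i with h | h
        · obtain rfl : i = j + 1 := by omega
          right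
          simp only [Set.mem_singleton_iff]
          funext x
          exact carryAt_succ _ _ _ _ hc
        · exact .inl (.inr ⟨i, h, rfl⟩))
  have h2 := ((of_subset (subset_refl Γ) 0).union h0).comp h1
  exact h2.mono (by omega) Set.subset_union_right

/-- The last carry is recorded together with the sum because subtraction reads a comparison off it.
-/
theorem addCarry (hA : bits w A ⊆ Γ) (hB : bits w B ⊆ Γ) {c : ℕ} (hc : c ≤ 1) :
    Cost Γ (w * 21 + 1) (bits w (fun x => A x + B x + c) ∪
      {fun x => carryAt w (A x) (B x) c}) := by
  have h := carry hA hB hc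
  have h1 := h.trans (t := w * 15) (E := bits w (fun x => A x + B x + c)) (by
    refine of_bits fun i hi => ?_
    have ha : Cost (Γ ∪ {f | ∃ i ≤ w, f = fun x => carryAt i (A x) (B x) c}) 0
        {fun x => (A x).testBit i} := mem (.inl (hA (mem_bits A hi))) _
    have hb : Cost (Γ ∪ {f | ∃ i ≤ w, f = fun x => carryAt i (A x) (B x) c}) 0
        {fun x => (B x).testBit i} := mem (.inl (hB (mem_bits B hi))) _
    have hcc : Cost (Γ ∪ {f | ∃ i ≤ w, f = fun x => carryAt i (A x) (B x) c}) 0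
        {fun x => carryAt i (A x) (B x) c} := mem (.inr ⟨i, hi.le, rfl⟩) _
    simp only [testBit_add_carry _ _ _ _ hc]
    exact (ha.xor (hb.xor hcc)).le (by omega))
  refine h1.mono (by omega) ?_
  rintro f (hf | hf)
  · exact .inr hf
  · exact .inl ⟨w, le_rfl, hf⟩

theorem add (hA : bits w A ⊆ Γ) (hB : bits w B ⊆ Γ) :
    Cost Γ (w * 21 + 1) (bits w fun x => A x + B x) :=
  (addCarry hA hB (c := 0) (by omega)).mono le_rfl Set.subset_union_left

/-- Two's complement: the complement `2 ^ w - (B + 1)` negates each bit, and it is added to `A` with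
carry-in `1`. The final carry says whether `B ≤ A`; masking the sum with it gives truncated
subtraction. -/
theorem sub (hA : bits w A ⊆ Γ) (hB : bits w B ⊆ Γ) (hA' : ∀ x, A x < 2 ^ w)
    (hB' : ∀ x, B x < 2 ^ w) :
    Cost Γ (w * 23 + 1) (bits w fun x => A x - B x) := by
  have h1 : Cost Γ (w * 1) (bits w fun x => 2 ^ w - (B x + 1)) := by
    refine of_bits fun i hi => ?_
    have : Cost Γ 0 {fun x => (B x).testBit i} := mem (hB (mem_bits B hi)) _
    convert! this.not using 3
    rename_i x
    rw [Nat.testBit_two_pow_sub_succ (hB' x)]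
    simp [hi]
  have h2 := h1.trans (addCarry (A := A) (B := fun x => 2 ^ w - (B x + 1)) (w := w) (c := 1)
    (hA.trans Set.subset_union_left) Set.subset_union_right le_rfl)
  refine (h2.comp (t := w * 1) (of_bits (s := 1) fun i hi => ?_)).le (by omega)
  have ha : Cost (bits w (fun x => 2 ^ w - (B x + 1)) ∪ (bits w
      (fun x => A x + (2 ^ w - (B x + 1)) + 1) ∪
        {fun x => carryAt w (A x) (2 ^ w - (B x + 1)) 1})) 0
      {fun x => (A x + (2 ^ w - (B x + 1)) + 1).testBit i} :=
    mem (.inr (.inl (mem_bits (fun x => A x + (2 ^ w - (B x + 1)) + 1) hi))) 0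
  have hb : Cost (bits w (fun x => 2 ^ w - (B x + 1)) ∪ (bits w
      (fun x => A x + (2 ^ w - (B x + 1)) + 1) ∪
        {fun x => carryAt w (A x) (2 ^ w - (B x + 1)) 1})) 0
      {fun x => carryAt w (A x) (2 ^ w - (B x + 1)) 1} := mem (.inr (.inr rfl)) 0
  convert! ha.and hb using 3
  rename_i x
  have hx := hB' x
  have hx' := hA' x
  have hc : carryAt w (A x) (2 ^ w - (B x + 1)) 1 = decide (B x ≤ A x) := by
    rw [carryAt, Nat.mod_eq_of_lt hx', Nat.mod_eq_of_lt (by omega)]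
    congr 1
    apply propext
    omega
  rw [hc]
  by_cases h : B x ≤ A x
  · rw [show A x + (2 ^ w - (B x + 1)) + 1 = 2 ^ w + (A x - B x) by omega,
      Nat.testBit_two_pow_add_gt hi]
    simp [h]
  · simp [h, show A x - B x = 0 by omega]

theorem half (hA : bits w A ⊆ Γ) (hA' : ∀ x, A x < 2 ^ w) :
    Cost Γ w (bits w fun x => A x / 2) := by
  refine (of_bits (s := 1) fun i hi => ?_).le (by omega)
  simpa only [Nat.testBit_div_two] using testBit hA hA' (i + 1)

theorem eqZero (hA : bits w A ⊆ Γ) (hA' : ∀ x, A x < 2 ^ w) :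
    Cost Γ (w + 2) {fun x => decide (A x = 0)} := by
  have := (any (s := 0) (Finset.range w) (f := fun i x => (A x).testBit i) (Γ := Γ) fun i hi =>
    mem (hA (mem_bits A (Finset.mem_range.1 hi))) 0).not
  convert! this.le (s' := w + 2) (by simp) using 3
  rename_i x
  by_cases h : A x = 0
  · simp [h]
  · obtain ⟨i, hi⟩ := Nat.exists_testBit_of_ne_zero h
    have : i < w := by
      by_contra hlt
      rw [Nat.testBit_lt_two_pow ((hA' x).trans_le
        (Nat.pow_le_pow_right (by omega) (by omega)))] at hi
      simp at hi
    simp only [h, decide_false, Finset.mem_range, Bool.false_eq, Bool.not_eq_false',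
      decide_eq_true_eq]
    exact ⟨i, this, hi⟩

/-- Multiplication by a constant. -/
theorem constMul (hA : bits w A ⊆ Γ) (c : ℕ) :
    Cost Γ ((c.size + 1) * (w * 42 + 2)) (bits w fun x => c * A x) := by
  induction c using Nat.binaryRec' with
  | zero =>
    simpa using (bits_const 0 w).le (show w ≤ (Nat.size 0 + 1) * (w * 42 + 2) by simp; omega)
  | bit b c hb ih =>
    by_cases h0 : Nat.bit b c = 0
    · rw [h0]
      simpa using (bits_const 0 w).le (show w ≤ (Nat.size 0 + 1) * (w * 42 + 2) by simp; omega)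
    -- Horner's scheme on the binary digits of the constant: double, then add `A` if the new digit
    -- is `1`.
    have h1 := ih.trans (add (A := fun x => c * A x) (B := fun x => c * A x) (w := w)
      (Γ := Γ ∪ bits w fun x => c * A x) Set.subset_union_right Set.subset_union_right)
    rw [Nat.size_bit h0]
    cases b
    · refine h1.mono (by rw [Nat.succ_eq_add_one]; nlinarith) ?_
      simp only [Nat.bit_false, show ∀ x, 2 * c * A x = c * A x + c * A x by intro x; ring]
      exact Set.subset_union_right
    · have h2 := h1.trans (add (A := fun x => c * A x + c * A x) (B := A) (w := w)
        (fun f hf => .inr (.inr hf)) (hA.trans Set.subset_union_left))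
      refine h2.mono (by rw [Nat.succ_eq_add_one]; nlinarith) ?_
      simp only [Nat.bit_true, show ∀ x, (2 * c + 1) * A x = c * A x + c * A x + A x by
        intro x; ring]
      exact Set.subset_union_right

end Cost

end Gates

/-! ### Circuits from gate counts -/

theorem Circuit.wires_append {m k k' : ℕ} (l : List Gate) (g : Gate) (o : Fin k → ℕ)
    (o' : Fin k' → ℕ) (x : Fin m → Bool) :
    (Circuit.mk (l ++ [g]) o).wires x =
      (Circuit.mk l o').wires x ++ [g.eval ((Circuit.mk l o').wires x)] := by
  simp [Circuit.wires, List.foldl_append]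

theorem Circuit.length_wires {m k : ℕ} (l : List Gate) (o : Fin k → ℕ) (x : Fin m → Bool) :
    ((Circuit.mk l o).wires x).length = m + l.length := by
  induction l using List.reverseRecOn with
  | nil => simp [Circuit.wires]
  | append_singleton l g ih => rw [wires_append l g o o, List.length_append, ih]; simp; omega

/-- Appending a gate leaves the earlier wires unchanged, so wire numbers found once stay valid. They
do not depend on the output map `o`, which can therefore be chosen afterwards. -/
theorem Built.exists_gates {m : ℕ} (k : ℕ) {s : ℕ} {Δ : Set ((Fin m → Bool) → Bool)}
    (h : Built {f | ∃ i, f = fun x => x i} s Δ) :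
    ∃ l : List Gate, l.length = s ∧ ∀ f ∈ Δ, ∃ i < m + s, ∀ (o : Fin k → ℕ) x,
      ((Circuit.mk l o).wires x).getD i false = f x := by
  induction h with
  | base =>
    refine ⟨[], rfl, ?_⟩
    rintro _ ⟨i, rfl⟩
    exact ⟨i, by omega, fun o x => by simp [Circuit.wires]⟩
  | @gate s Δ f _ hf ih =>
    obtain ⟨l, hl, h⟩ := ih
    obtain ⟨g, hg⟩ : ∃ g : Gate, ∀ (o : Fin k → ℕ) x, g.eval ((Circuit.mk l o).wires x) = f x := by
      cases hf with
      | const b => exact ⟨.const b, fun _ _ => rfl⟩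
      | not hf =>
        obtain ⟨i, _, hi⟩ := h _ hf
        exact ⟨.not i, fun o x => by rw [Gate.eval, hi]⟩
      | and hf hg =>
        obtain ⟨i, _, hi⟩ := h _ hf
        obtain ⟨j, _, hj⟩ := h _ hg
        exact ⟨.and i j, fun o x => by rw [Gate.eval, hi, hj]⟩
      | or hf hg =>
        obtain ⟨i, _, hi⟩ := h _ hf
        obtain ⟨j, _, hj⟩ := h _ hg
        exact ⟨.or i j, fun o x => by rw [Gate.eval, hi, hj]⟩
    refine ⟨l ++ [g], by simp [hl], ?_⟩
    rintro f' (rfl | hf')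
    · refine ⟨m + s, by omega, fun o x => ?_⟩
      rw [Circuit.wires_append l g o o, List.getD_append_right _ _ _ _
        (by rw [Circuit.length_wires, hl]), Circuit.length_wires, hl]
      simp [hg]
    · obtain ⟨i, hi, hi'⟩ := h _ hf'
      refine ⟨i, by omega, fun o x => ?_⟩
      rw [Circuit.wires_append l g o o, List.getD_append _ _ _ _
        (by rw [Circuit.length_wires, hl]; exact hi), hi']

/-- The number with the binary digits `x`. -/
def ofDigits₂ {m : ℕ} (x : Fin m → Bool) : ℕ := ∑ i : Fin m, if x i then 2 ^ (i : ℕ) else 0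

theorem sum_testBit (k a : ℕ) :
    (∑ j : Fin k, if a.testBit j then 2 ^ (j : ℕ) else 0) = a % 2 ^ k := by
  induction k with
  | zero => simp [Nat.mod_one]
  | succ k ih =>
    rw [Fin.sum_univ_castSucc, mod_two_pow_succ']
    simp only [Fin.val_castSucc, Fin.val_last, ih]
    cases a.testBit k <;> simp [add_comm]

theorem ofDigits₂_lt {m : ℕ} (x : Fin m → Bool) : ofDigits₂ x < 2 ^ m := by
  induction m with
  | zero => simp [ofDigits₂]
  | succ m ih =>
    have := ih fun i => x i.castSucc
    simp only [ofDigits₂, Fin.sum_univ_castSucc, Fin.val_castSucc, Fin.val_last, pow_succ] at *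
    split_ifs <;> omega

theorem testBit_ofDigits₂ {m : ℕ} (x : Fin m → Bool) (i : Fin m) :
    (ofDigits₂ x).testBit i = x i := by
  induction m with
  | zero => exact i.elim0
  | succ m ih =>
    have hlt := ofDigits₂_lt fun i => x i.castSucc
    have hx : ofDigits₂ x =
        (ofDigits₂ fun i => x i.castSucc) + if x (Fin.last m) then 2 ^ m else 0 := by
      simp [ofDigits₂, Fin.sum_univ_castSucc]
    rw [hx]
    induction i using Fin.lastCases with
    | last =>
      cases hxm : x (Fin.last m)
      · simp [Nat.testBit_lt_two_pow hlt]
      · simp only [if_true, Fin.val_last]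
        rw [add_comm, Nat.testBit_two_pow_add_eq, Nat.testBit_lt_two_pow hlt]; rfl
    | cast i =>
      rw [← ih (fun i => x i.castSucc) i]
      split_ifs
      · rw [add_comm, Fin.val_castSucc, Nat.testBit_two_pow_add_gt i.2]
      · simp

theorem Cost.exists_circuit {m k s : ℕ} {A : (Fin m → Bool) → ℕ}
    (h : Cost (bits m ofDigits₂) s (bits k A)) :
    ∃ C : Circuit m k, C.size ≤ s ∧ ∀ N < 2 ^ m,
      C.evalNat N = A (fun i => N.testBit i) % 2 ^ k := by
  obtain ⟨s', hs, Δ, hb, hΔ⟩ := h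
  have hin : bits m ofDigits₂ = {f : (Fin m → Bool) → Bool | ∃ i, f = fun x => x i} := by
    ext f
    constructor
    · rintro ⟨i, hi, rfl⟩
      exact ⟨⟨i, hi⟩, funext fun x => testBit_ofDigits₂ x ⟨i, hi⟩⟩
    · rintro ⟨i, rfl⟩
      exact ⟨i, i.2, funext fun x => (testBit_ofDigits₂ x i).symm⟩
  rw [hin] at hb
  obtain ⟨l, hl, h⟩ := hb.exists_gates k
  have h' : ∀ j : Fin k, ∃ i, ∀ (o : Fin k → ℕ) x,
      ((Circuit.mk l o).wires x).getD i false = (A x).testBit j := fun j => by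
    obtain ⟨i, -, hi⟩ := h _ (hΔ (mem_bits A j.2))
    exact ⟨i, hi⟩
  choose o ho using h'
  refine ⟨⟨l, o⟩, by simpa [Circuit.size, hl] using hs, fun N _ => ?_⟩
  simp only [Circuit.evalNat, ho, sum_testBit]

theorem ofDigits₂_testBit {m N : ℕ} (h : N < 2 ^ m) :
    ofDigits₂ (fun i : Fin m => N.testBit i) = N := by
  rw [ofDigits₂, sum_testBit, Nat.mod_eq_of_lt h]

/-! ### Polynomially bounded functions -/

/-- Functions that are bounded by a polynomial. -/
def PolyBdd (f : ℕ → ℕ) : Prop := ∃ c, ∀ n, f n ≤ (n + 2) ^ c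

namespace PolyBdd

variable {f g : ℕ → ℕ}

theorem mono (hg : PolyBdd g) (h : ∀ n, f n ≤ g n) : PolyBdd f := by
  obtain ⟨c, hc⟩ := hg
  exact ⟨c, fun n => (h n).trans (hc n)⟩

theorem const (k : ℕ) : PolyBdd fun _ => k :=
  -- The base `n + 2` is at least `2`, so the exponent `k` already bounds the constant `k`.
  ⟨k, fun n => Nat.lt_two_pow_self.le.trans (Nat.pow_le_pow_left (by omega) _)⟩

theorem id : PolyBdd fun n => n := ⟨1, fun n => by simp⟩

theorem add (hf : PolyBdd f) (hg : PolyBdd g) : PolyBdd fun n => f n + g n := by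
  obtain ⟨c, hc⟩ := hf
  obtain ⟨d, hd⟩ := hg
  refine ⟨c + d + 1, fun n => ?_⟩
  have h1 : (n + 2) ^ c ≤ (n + 2) ^ (c + d) := Nat.pow_le_pow_right (by omega) (by omega)
  have h2 : (n + 2) ^ d ≤ (n + 2) ^ (c + d) := Nat.pow_le_pow_right (by omega) (by omega)
  have := hc n
  have := hd n
  rw [pow_succ]
  nlinarith

theorem mul (hf : PolyBdd f) (hg : PolyBdd g) : PolyBdd fun n => f n * g n := by
  obtain ⟨c, hc⟩ := hf
  obtain ⟨d, hd⟩ := hg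
  exact ⟨c + d, fun n => by rw [pow_add]; exact Nat.mul_le_mul (hc n) (hd n)⟩

theorem pow (hf : PolyBdd f) (k : ℕ) : PolyBdd fun n => f n ^ k := by
  induction k with
  | zero => simpa using const 1
  | succ k ih => simpa only [pow_succ] using ih.mul hf

theorem comp (hf : PolyBdd f) (hg : PolyBdd g) : PolyBdd fun n => f (g n) := by
  obtain ⟨c, hc⟩ := hf
  exact ((hg.add (const 2)).pow c).mono fun n => hc (g n)

theorem eval (P : Polynomial ℕ) : PolyBdd fun n => P.eval n := by
  induction P using Polynomial.induction_on' with
  | add p q hp hq => simpa using hp.add hq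
  | monomial n a => simpa using (const a).mul (id.pow n)

theorem sum {k : ℕ} {f : Fin k → ℕ → ℕ} (h : ∀ i, PolyBdd (f i)) :
    PolyBdd fun n => ∑ i, f i n := by
  induction k with
  | zero => simpa using const 0
  | succ k ih =>
    simp only [Fin.sum_univ_castSucc]
    exact (ih fun i => h i.castSucc).add (h (Fin.last k))

end PolyBdd

theorem eval_le_eval (P : Polynomial ℕ) {m n : ℕ} (h : m ≤ n) : P.eval m ≤ P.eval n := by
  simp only [Polynomial.eval_eq_sum, Polynomial.sum]
  gcongr

/-! ### Circuits for clocked machines -/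

/-- The lists of programs that remain to be executed while `p` is executed, `k` being left to do
afterwards. -/
def Prog.conts : Prog → List Prog → Set (List Prog)
  | .skip, k => {.skip :: k}
  | .assign r e, k => {.assign r e :: k}
  | .seq p q, k => {.seq p q :: k} ∪ (p.conts (q :: k) ∪ q.conts k)
  | .ite r p q, k => {.ite r p q :: k} ∪ (p.conts k ∪ q.conts k)
  | .loop r p, k => {.loop r p :: k} ∪ p.conts (.loop r p :: k)

theorem Prog.conts_finite (p : Prog) (k : List Prog) : (p.conts k).Finite := by
  induction p generalizing k with
  | skip => exact Set.finite_singleton _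
  | assign r e => exact Set.finite_singleton _
  | seq p q hp hq => exact (Set.finite_singleton _).union ((hp _).union (hq _))
  | ite r p q hp hq => exact (Set.finite_singleton _).union ((hp _).union (hq _))
  | loop r p hp => exact (Set.finite_singleton _).union (hp _)

theorem Prog.cons_mem_conts (p : Prog) (k : List Prog) : p :: k ∈ p.conts k := by
  cases p <;> simp [Prog.conts]

/-- The body of a loop returns to the same list from which it was entered, so the stack of pending
programs does not grow with the running time. A fixed finite set of control states results, and a
circuit can represent it by indicator bits. -/
theorem Prog.step_mem_conts (p : Prog) (k a : List Prog) (s : ℕ → ℕ) (h : a ∈ p.conts k) :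
    (Prog.step (a, s)).1 ∈ insert k (p.conts k) := by
  induction p generalizing k with
  | skip => obtain rfl := h; simp [Prog.step]
  | assign r e => obtain rfl := h; simp [Prog.step]
  | seq p q hp hq =>
    rcases h with rfl | h | h
    · exact .inr (.inr (.inl (p.cons_mem_conts _)))
    · rcases hp _ h with h | h
      · rw [h]; exact .inr (.inr (.inr (q.cons_mem_conts _)))
      · exact .inr (.inr (.inl h))
    · rcases hq _ h with h | h
      · exact .inl h
      · exact .inr (.inr (.inr h))
  | ite r p q hp hq =>
    rcases h with rfl | h | h
    · simp only [Prog.step]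
      split_ifs
      · exact .inr (.inr (.inr (q.cons_mem_conts _)))
      · exact .inr (.inr (.inl (p.cons_mem_conts _)))
    · rcases hp _ h with h | h
      · exact .inl h
      · exact .inr (.inr (.inl h))
    · rcases hq _ h with h | h
      · exact .inl h
      · exact .inr (.inr (.inr h))
  | loop r p hp =>
    rcases h with rfl | h
    · simp only [Prog.step]
      split_ifs
      · exact .inl rfl
      · exact .inr (.inr (p.cons_mem_conts _))
    · rcases hp _ h with h | h
      · rw [h]; exact .inr (.inl rfl)
      · exact .inr (.inr h)

/-! ### Bounds for registers and constants -/

/-- All registers in `e` are below `R` and all constants have at most `c` bits. -/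
def Op.Bounded (R c : ℕ) : Op → Prop
  | .const n => n < 2 ^ c
  | .reg a => a < R
  | .add a b => a < R ∧ b < R
  | .sub a b => a < R ∧ b < R
  | .half a => a < R

/-- All registers in `p` are below `R` and all constants have at most `c` bits. -/
def Prog.Bounded (R c : ℕ) : Prog → Prop
  | .skip => True
  | .assign r e => r < R ∧ e.Bounded R c
  | .seq p q => p.Bounded R c ∧ q.Bounded R c
  | .ite r p q => r < R ∧ p.Bounded R c ∧ q.Bounded R c
  | .loop r p => r < R ∧ p.Bounded R c

theorem Op.Bounded.mono {R R' c c' : ℕ} (hR : R ≤ R') (hc : c ≤ c') {e : Op}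
    (h : e.Bounded R c) : e.Bounded R' c' := by
  have := Nat.pow_le_pow_right (show 0 < 2 by omega) hc
  cases e <;> simp only [Op.Bounded] at * <;> omega

theorem Prog.Bounded.mono {R R' c c' : ℕ} (hR : R ≤ R') (hc : c ≤ c') {p : Prog}
    (h : p.Bounded R c) : p.Bounded R' c' := by
  induction p with
  | skip => trivial
  | assign r e => exact ⟨h.1.trans_le hR, h.2.mono hR hc⟩
  | seq p q hp hq => exact ⟨hp h.1, hq h.2⟩
  | ite r p q hp hq => exact ⟨h.1.trans_le hR, hp h.2.1, hq h.2.2⟩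
  | loop r p hp => exact ⟨h.1.trans_le hR, hp h.2⟩

theorem Op.exists_bounded (e : Op) : ∃ R c, e.Bounded R c := by
  cases e with
  | const n => exact ⟨0, n, Nat.lt_two_pow_self⟩
  | reg a => exact ⟨a + 1, 0, Nat.lt_succ_self a⟩
  | add a b => exact ⟨a + b + 1, 0, by simp only [Op.Bounded]; omega⟩
  | sub a b => exact ⟨a + b + 1, 0, by simp only [Op.Bounded]; omega⟩
  | half a => exact ⟨a + 1, 0, Nat.lt_succ_self a⟩

theorem Prog.exists_bounded (p : Prog) : ∃ R c, p.Bounded R c := by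
  induction p with
  | skip => exact ⟨0, 0, trivial⟩
  | assign r e =>
    obtain ⟨R, c, h⟩ := e.exists_bounded
    exact ⟨R + r + 1, c, by omega, h.mono (by omega) le_rfl⟩
  | seq p q hp hq =>
    obtain ⟨R, c, h⟩ := hp
    obtain ⟨R', c', h'⟩ := hq
    exact ⟨R + R', c + c', h.mono (by omega) (by omega), h'.mono (by omega) (by omega)⟩
  | ite r p q hp hq =>
    obtain ⟨R, c, h⟩ := hp
    obtain ⟨R', c', h'⟩ := hq
    exact ⟨R + R' + r + 1, c + c', by omega, h.mono (by omega) (by omega),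
      h'.mono (by omega) (by omega)⟩
  | loop r p hp =>
    obtain ⟨R, c, h⟩ := hp
    exact ⟨R + r + 1, c, by omega, h.mono (by omega) le_rfl⟩

/-- The first program of the list is bounded, if there is one. -/
def HeadBounded (R c : ℕ) (a : List Prog) : Prop := ∀ p l, a = p :: l → p.Bounded R c

theorem Prog.headBounded_of_mem_conts {R c : ℕ} (p : Prog) (hp : p.Bounded R c) (k a : List Prog)
    (h : a ∈ p.conts k) : HeadBounded R c a := by
  induction p generalizing k with
  | skip => obtain rfl := h; rintro q l h; obtain ⟨rfl, rfl⟩ := List.cons.inj h; exact hp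
  | assign r e => obtain rfl := h; rintro q l h; obtain ⟨rfl, rfl⟩ := List.cons.inj h; exact hp
  | seq p q ihp ihq =>
    rcases h with rfl | h | h
    · rintro q l h; obtain ⟨rfl, rfl⟩ := List.cons.inj h; exact hp
    · exact ihp hp.1 _ h
    · exact ihq hp.2 _ h
  | ite r p q ihp ihq =>
    rcases h with rfl | h | h
    · rintro q l h; obtain ⟨rfl, rfl⟩ := List.cons.inj h; exact hp
    · exact ihp hp.2.1 _ h
    · exact ihq hp.2.2 _ h
  | loop r p ihp =>
    rcases h with rfl | h
    · rintro q l h; obtain ⟨rfl, rfl⟩ := List.cons.inj h; exact hp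
    · exact ihp hp.2 _ h

theorem Op.eval_lt {R c v : ℕ} {e : Op} (he : e.Bounded R c) (hc : c ≤ v) {s : ℕ → ℕ}
    (hs : ∀ r, s r < 2 ^ v) : e.eval s < 2 ^ (v + 1) := by
  have h1 := Nat.pow_le_pow_right (show 0 < 2 by omega) hc
  cases e <;> simp only [Op.eval, Op.Bounded, pow_succ] at *
  case const n => omega
  case reg a => have := hs a; omega
  case add a b => have := hs a; have := hs b; omega
  case sub a b => have := hs a; omega
  case half a => have := hs a; omega

theorem Prog.step_lt {R c v : ℕ} {a : List Prog} (ha : HeadBounded R c a) (hc : c ≤ v) {s : ℕ → ℕ}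
    (hs : ∀ r, s r < 2 ^ v) (r : ℕ) : (Prog.step (a, s)).2 r < 2 ^ (v + 1) := by
  have hs' : ∀ r, s r < 2 ^ (v + 1) := fun r =>
    (hs r).trans (Nat.pow_lt_pow_right (by omega) (by omega))
  rcases a with _ | ⟨p, l⟩
  · exact hs' r
  · have hp := ha p l rfl
    cases p with
    | skip => exact hs' r
    | assign r' e =>
      simp only [Prog.step, Function.update_apply]
      split_ifs
      · exact Op.eval_lt hp.2 hc hs
      · exact hs' r
    | seq p q => exact hs' r
    | ite r' p q => exact hs' r
    | loop r' p =>
      simp only [Prog.step]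
      split_ifs <;> exact hs' r

/-! ### Circuits that simulate machine configurations -/

section Layers

variable {X : Type}

theorem Cost.ite {Γ : Set (X → Bool)} {s t u : ℕ} {z : X → Prop} [DecidablePred z]
    {f g : X → Bool} (hz : Cost Γ s {fun x => decide (z x)})
    (hf : Cost Γ t {f}) (hg : Cost Γ u {g}) :
    Cost Γ (2 * s + t + u + 4) {fun x => if z x then f x else g x} := by
  convert! ((hz.and hf).or (hz.not.and hg)).le (s' := 2 * s + t + u + 4) (by omega) using 3
  rename_i x
  by_cases h : z x <;> simp [h]

theorem Cost.op {Γ : Set (X → Bool)} {R c w : ℕ} {e : Op} (he : e.Bounded R c) {S : X → ℕ → ℕ}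
    (hS : ∀ r < R, bits w (fun x => S x r) ⊆ Γ) (hS' : ∀ x r, S x r < 2 ^ w) :
    Cost Γ (w * 23 + 1) (bits w fun x => e.eval (S x)) := by
  cases e with
  | const n => exact (bits_const n w).le (by omega)
  | reg a => exact of_subset (hS a he) _
  | add a b => exact (add (hS a he.1) (hS b he.2)).le (by omega)
  | sub a b => exact sub (hS a he.1) (hS b he.2) (fun x => hS' x a) (fun x => hS' x b)
  | half a => exact (half (hS a he) fun x => hS' x a).le (by omega)

open Classical in
/-- The Boolean functions that describe a configuration: the indicators of the possible control
states, and the bits of the registers. -/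
def layer (K : Finset (List Prog)) (R w : ℕ) (κ : X → List Prog × (ℕ → ℕ)) : Set (X → Bool) :=
  (⋃ a ∈ K, {fun x => decide ((κ x).1 = a)}) ∪ ⋃ r ∈ Finset.range R, bits w fun x => (κ x).2 r

theorem bits_subset_layer (K : Finset (List Prog)) (R w : ℕ) (κ : X → List Prog × (ℕ → ℕ)) {r : ℕ}
    (hr : r < R) : bits w (fun x => (κ x).2 r) ⊆ layer K R w κ := by
  intro f hf
  exact .inr (Set.mem_biUnion (Finset.mem_range.2 hr) hf)

open Classical in
theorem mem_layer {K : Finset (List Prog)} {R w : ℕ} (κ : X → List Prog × (ℕ → ℕ)) {a : List Prog}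
    (ha : a ∈ K) : (fun x => decide ((κ x).1 = a)) ∈ layer K R w κ :=
  .inl (Set.mem_biUnion ha rfl)

/-- The number of gates for one step. -/
def stepCost (K : Finset (List Prog)) (R w : ℕ) : ℕ :=
  K.card * (K.card * (23 * w + 20) + 1) + R * (w * (K.card * (23 * w + 20) + 1))

/-- A case distinction on the control state. In each case the next control state needs at most one
test for zero, and a register bit is either copied or is a bit of a single operation. -/
theorem Cost.step {K : Finset (List Prog)} {R c w : ℕ} {κ : X → List Prog × (ℕ → ℕ)}
    (hK : ∀ a ∈ K, HeadBounded R c a) (hκ : ∀ x, (κ x).1 ∈ K)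
    (hlt : ∀ x r, (κ x).2 r < 2 ^ w) :
    Cost (layer K R w κ) (stepCost K R w) (layer K R w fun x => Prog.step (κ x)) := by
  classical
  refine union (biUnion (s := K.card * (23 * w + 20) + 1) K fun a' _ => ?_) ?_
  · have := select (Γ := layer K R w κ) (s := 2 * w + 10) (t := 0) K (k := fun x => (κ x).1) hκ
      (f := fun a x => decide ((Prog.step (a, (κ x).2)).1 = a')) (fun a ha => ?_)
      (fun a ha => mem (mem_layer κ ha) 0)
    · exact this.le (Nat.add_le_add_right (Nat.mul_le_mul_left _ (by omega)) 1)
    · have hconst : ∀ b : Bool, Cost (layer K R w κ) (2 * w + 10) {fun _ => b} := fun b =>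
        (const b).le (by omega)
      have htest : ∀ r < R, ∀ b b' : Bool,
          Cost (layer K R w κ) (2 * w + 10) {fun x => if (κ x).2 r = 0 then b else b'} := by
        intro r hr b b'
        have hz := eqZero (bits_subset_layer K R w κ hr) fun x => hlt x r
        exact (hz.ite (const b) (const b')).le (by omega)
      have hb := hK a ha
      rcases a with _ | ⟨p, l⟩
      · exact hconst (decide ([] = a'))
      · have hp := hb p l rfl
        cases p with
        | skip => exact hconst (decide (l = a'))
        | assign r e => exact hconst (decide (l = a'))
        | seq p q => exact hconst (decide (p :: q :: l = a'))
        | ite r p q =>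
          convert! htest r hp.1 (decide (q :: l = a')) (decide (p :: l = a')) using 3
          simp only [Prog.step]
          split_ifs <;> rfl
        | loop r p =>
          convert! htest r hp.1 (decide (l = a')) (decide (p :: .loop r p :: l = a')) using 3
          simp only [Prog.step]
          split_ifs <;> rfl
  · have h1 := biUnion (Γ := layer K R w κ) (Finset.range R)
      (D := fun r => bits w fun x => (Prog.step (κ x)).2 r)
      (s := w * (K.card * (23 * w + 20) + 1)) (fun r hr => ?_)
    · simpa using h1
    · refine of_bits fun i hi => ?_
      rw [Finset.mem_range] at hr
      have := select (Γ := layer K R w κ) (s := 23 * w + 1) (t := 0) K (k := fun x => (κ x).1) hκ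
        (f := fun a x => ((Prog.step (a, (κ x).2)).2 r).testBit i) (fun a ha => ?_)
        (fun a ha => mem (mem_layer κ ha) 0)
      · exact this.le (Nat.add_le_add_right (Nat.mul_le_mul_left _ (by omega)) 1)
      · have hold : Cost (layer K R w κ) (23 * w + 1) {fun x => ((κ x).2 r).testBit i} :=
          mem (bits_subset_layer K R w κ hr (mem_bits _ hi)) _
        have hb := hK a ha
        rcases a with _ | ⟨p, l⟩
        · exact hold
        · have hp := hb p l rfl
          cases p with
          | skip => exact hold
          | assign r' e =>
            by_cases hrr : r = r'
            · subst hrr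
              simp only [Prog.step, Function.update_self]
              refine (op hp.2 (fun r hr => bits_subset_layer K R w κ hr) hlt).mono
                (by rw [mul_comm]) ?_
              rintro _ rfl
              exact mem_bits (fun x => e.eval (κ x).2) hi
            · simpa only [Prog.step, Function.update_of_ne hrr] using hold
          | seq p q => exact hold
          | ite r' p q => exact hold
          | loop r' p =>
            have heq : ∀ x, (Prog.step (.loop r' p :: l, (κ x).2)).2 = (κ x).2 := fun x => by
              simp only [Prog.step]
              split_ifs <;> rfl
            simpa only [heq] using hold

theorem step_iterate_lt {K : Finset (List Prog)} {R c v : ℕ}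
    (hK : ∀ a ∈ K, HeadBounded R c a) (hstep : ∀ a ∈ K, ∀ s, (Prog.step (a, s)).1 ∈ K)
    (hc : c ≤ v) (κ : List Prog × (ℕ → ℕ)) (hκ : κ.1 ∈ K) (hs : ∀ r, κ.2 r < 2 ^ v) (t : ℕ) :
    (Prog.step^[t] κ).1 ∈ K ∧ ∀ r, (Prog.step^[t] κ).2 r < 2 ^ (v + t) := by
  induction t with
  | zero => exact ⟨hκ, hs⟩
  | succ t ih =>
    rw [Function.iterate_succ_apply']
    exact ⟨hstep _ ih.1 _, Prog.step_lt (hK _ ih.1) (hc.trans (Nat.le_add_right v t)) ih.2⟩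

/-- Registers gain at most one bit per step, so the fixed width `v + T` accommodates all the steps
and every step costs the same. -/
theorem Cost.iterate_step {K : Finset (List Prog)} {R c v T : ℕ}
    {κ : X → List Prog × (ℕ → ℕ)}
    (hK : ∀ a ∈ K, HeadBounded R c a) (hstep : ∀ a ∈ K, ∀ s, (Prog.step (a, s)).1 ∈ K)
    (hc : c ≤ v) (hκ : ∀ x, (κ x).1 ∈ K) (hs : ∀ x r, (κ x).2 r < 2 ^ v) (t : ℕ) (ht : t ≤ T) :
    Cost (layer K R (v + T) κ) (t * stepCost K R (v + T))
      (layer K R (v + T) fun x => Prog.step^[t] (κ x)) := by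
  refine chain (D := fun t => layer K R (v + T) fun x => Prog.step^[t] (κ x)) t fun i hi => ?_
  simp only [Function.iterate_succ_apply']
  have h := fun x => step_iterate_lt hK hstep hc (κ x) (hκ x) (hs x) i
  exact step hK (fun x => (h x).1) fun x r =>
    ((h x).2 r).trans_le (Nat.pow_le_pow_right (by omega) (by omega))

/-- A length is at most `i` when all bits from position `i` on vanish; equality is the conjunction
of one such test with the negation of the preceding one. -/
theorem Cost.sizeEq {Γ : Set (X → Bool)} {w : ℕ} {A : X → ℕ} (hA : bits w A ⊆ Γ)
    (hA' : ∀ x, A x < 2 ^ w) (i : ℕ) :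
    Cost Γ (2 * w + 6) {fun x => decide ((A x).size = i)} := by
  have key : ∀ i, Cost Γ (w + 2) {fun x => decide ((A x).size ≤ i)} := by
    intro i
    have := (any (s := 0) (Finset.Ico i w) (f := fun j x => (A x).testBit j) fun j hj =>
      mem (hA (mem_bits A (Finset.mem_Ico.1 hj).2)) 0).not
    convert! this.le (s' := w + 2) (by simp) using 3
    rename_i x
    simp only [Finset.mem_Ico, ← decide_not, decide_eq_decide]
    push Not
    rw [Nat.size_le]
    constructor
    · rintro h j ⟨hij, -⟩
      rw [Nat.testBit_lt_two_pow (h.trans_le (Nat.pow_le_pow_right (by omega) hij))]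
      simp
    · intro h
      refine Nat.lt_pow_two_of_testBit _ fun j hj => ?_
      by_cases hjw : j < w
      · simpa using h j ⟨hj, hjw⟩
      · exact Nat.testBit_lt_two_pow ((hA' x).trans_le (Nat.pow_le_pow_right (by omega) (by omega)))
  rcases i with _ | i
  · simpa using (key 0).le (show w + 2 ≤ 2 * w + 6 by omega)
  · convert! ((key (i + 1)).and (key i).not).le (s' := 2 * w + 6) (by omega) using 3
    rw [Bool.eq_iff_iff]
    simp
    omega

/-- The number of gates for computing the indicators of the total length of `k` words. -/
def lengthCost (w : ℕ) : ℕ → ℕ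
  | 0 => 1
  | k + 1 => (w + 1) * (2 * w + 6 + lengthCost w k + 2) + 1

/-- The clock is evaluated at the exact input length, which varies with the input, so a circuit has
to recognise it. All lengths `i` of the last word are tried, leaving `l - i` for the others. -/
theorem Cost.inputLength {Γ : Set (X → Bool)} {w k : ℕ} {A : Fin k → X → ℕ}
    (hA : ∀ a, bits w (A a) ⊆ Γ) (hA' : ∀ a x, A a x < 2 ^ w) (l : ℕ) :
    Cost Γ (lengthCost w k) {fun x => decide (inputLength (fun a => A a x) = l)} := by
  induction k generalizing l with
  | zero => simpa [BoundedArith.inputLength, lengthCost] using const (Γ := Γ) (decide (0 = l))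
  | succ k ih =>
    have := any (Finset.range (w + 1)) (Γ := Γ) (f := fun i x =>
      decide ((A (Fin.last k) x).size = i) &&
        decide (BoundedArith.inputLength (fun a : Fin k => A a.castSucc x) = l - i ∧ i ≤ l))
      (s := 2 * w + 6 + lengthCost w k + 1) (fun i hi => ?_)
    · rw [lengthCost]
      convert! this.le (s' := (w + 1) * (2 * w + 6 + lengthCost w k + 2) + 1) (by simp) using 3
      rename_i x
      simp only [Bool.and_eq_true, decide_eq_true_eq, decide_eq_decide, Finset.mem_range,
        BoundedArith.inputLength, Fin.sum_univ_castSucc]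
      have : (A (Fin.last k) x).size ≤ w := Nat.size_le.2 (hA' _ x)
      constructor
      · intro h
        exact ⟨_, by omega, rfl, by omega, by omega⟩
      · rintro ⟨i, hi, rfl, h, h'⟩
        omega
    · refine (sizeEq (hA _) (hA' _) i).and ?_
      by_cases hil : i ≤ l
      · simpa [hil] using ih (fun a => hA a.castSucc) (fun a => hA' a.castSucc) (l - i)
      · have : 1 ≤ lengthCost w k := by cases k <;> simp [lengthCost]
        simpa [hil] using (const false).le this

end Layers

theorem PolyBdd.lengthCost (k : ℕ) : PolyBdd fun w => lengthCost w k := by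
  induction k with
  | zero => exact const 1
  | succ k ih =>
    exact ((id.add (const 1)).mul (((((const 2).mul id).add (const 6)).add ih).add (const 2))).add
      (const 1)

/-- The functions computed by clocked machines have circuits of polynomial size. -/
theorem ClockedMachine.exists_cost (M : ClockedMachine) (k : ℕ) : ∃ c d : ℕ, ∀ (w : ℕ) {X : Type}
    (A : Fin k → X → ℕ), (∀ a x, A a x < 2 ^ w) →
      (∀ x, M.eval (fun a => A a x) < 2 ^ (w + 2) ^ c) ∧
      Cost (⋃ a, bits w (A a)) ((w + 2) ^ d)
        (bits ((w + 2) ^ c) fun x => M.eval fun a => A a x) := by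
  classical
  obtain ⟨R₀, b, hb₀⟩ := M.prog.exists_bounded
  -- The output register `0` has to be among the registers that are represented.
  obtain ⟨R, hR, hb⟩ : ∃ R, 0 < R ∧ M.prog.Bounded R b :=
    ⟨R₀ + 1, by omega, hb₀.mono (by omega) le_rfl⟩
  set K : Finset (List Prog) := insert [] (M.prog.conts_finite []).toFinset with hKdef
  have hmem : ∀ a, a ∈ K ↔ a ∈ insert [] (M.prog.conts []) := fun a => by
    rw [hKdef]; simp
  have hK : ∀ a ∈ K, HeadBounded R b a := by
    intro a ha
    rcases (hmem a).1 ha with rfl | h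
    · rintro p l h; simp at h
    · exact M.prog.headBounded_of_mem_conts hb [] a h
  have hstep : ∀ a ∈ K, ∀ s, (Prog.step (a, s)).1 ∈ K := by
    intro a ha s
    rw [hmem] at ha ⊢
    rcases ha with rfl | h
    · exact .inl rfl
    · exact M.prog.step_mem_conts [] a s h
  let T : ℕ → ℕ := fun w => M.clock.eval (k * w)
  have hT : PolyBdd T := (PolyBdd.eval M.clock).comp ((PolyBdd.const k).mul .id)
  let V : ℕ → ℕ := fun w => w + b + T w
  have hV : PolyBdd V := (PolyBdd.id.add (.const b)).add hT
  obtain ⟨c, hc⟩ := hV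
  have hV : PolyBdd V := ⟨c, hc⟩
  have hstepc : PolyBdd fun w => stepCost K R (V w) := by
    have h1 := ((PolyBdd.const K.card).mul (((PolyBdd.const 23).mul hV).add (.const 20))).add
      (.const 1)
    exact ((PolyBdd.const K.card).mul h1).add ((PolyBdd.const R).mul (hV.mul h1))
  let D : ℕ → ℕ := fun w => (K.card * 1 + R * (V w)) + T w * stepCost K R (V w) + 1
  have hD : PolyBdd D := ((PolyBdd.const _).add ((PolyBdd.const R).mul hV)).add
    (hT.mul hstepc) |>.add (.const 1)
  let E : ℕ → ℕ := fun w => (w + 2) ^ c * ((k * w + 1) * (D w + lengthCost w k + 2) + 1)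
  have hE : PolyBdd E := ((PolyBdd.id.add (.const 2)).pow c).mul
    (((((PolyBdd.const k).mul .id).add (.const 1)).mul
      ((hD.add (.lengthCost k)).add (.const 2))).add (.const 1))
  obtain ⟨d, hd⟩ := hE
  refine ⟨c, d, fun w X A hA => ?_⟩
  have hlen : ∀ x, inputLength (fun a => A a x) ≤ k * w := by
    intro x
    have : ∑ a : Fin k, (A a x).size ≤ ∑ _a : Fin k, w :=
      Finset.sum_le_sum fun a _ => Nat.size_le.2 (hA a x)
    simpa [inputLength] using this
  set κ : X → List Prog × (ℕ → ℕ) := fun x => ([M.prog], initRegs fun a => A a x) with hκdef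
  have hκ : ∀ x, (κ x).1 ∈ K := fun x => (hmem _).2 (.inr (M.prog.cons_mem_conts []))
  have hs : ∀ x r, (κ x).2 r < 2 ^ (w + b) := by
    intro x r
    simp only [hκdef, initRegs]
    split_ifs
    · exact (hA _ x).trans_le (Nat.pow_le_pow_right (by omega) (by omega))
    · positivity
  have hval : ∀ t ≤ T w, ∀ x r, (Prog.step^[t] (κ x)).2 r < 2 ^ (w + 2) ^ c := fun t ht x r =>
    ((step_iterate_lt hK hstep (by omega) (κ x) (hκ x) (hs x) t).2 r).trans_le
      (Nat.pow_le_pow_right (by omega) (le_trans (by simp only [V]; omega) (hc w)))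
  refine ⟨fun x => hval _ (eval_le_eval _ (hlen x)) x 0, ?_⟩
  refine (Cost.of_bits (s := (k * w + 1) * (D w + lengthCost w k + 2) + 1) fun i hi => ?_).le
    (hd w)
  have hsub : ∀ a, bits w (A a) ⊆ ⋃ a, bits w (A a) := fun a =>
    Set.subset_iUnion (fun a => bits w (A a)) a
  have h0 : Cost (⋃ a, bits w (A a)) (K.card * 1 + R * (V w)) (layer K R (V w) κ) := by
    refine Cost.union (Cost.biUnion K fun a _ => Cost.const (decide ([M.prog] = a))) ?_
    have := Cost.biUnion (Γ := ⋃ a, bits w (A a)) (Finset.range R)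
      (D := fun r => bits (V w) fun x => (κ x).2 r) (s := V w) fun r _ => ?_
    · simpa using this
    · simp only [hκdef, initRegs]
      by_cases hr : r < k
      · simp only [hr, dif_pos]
        exact Cost.bits_extend (hsub ⟨r, hr⟩) (hA ⟨r, hr⟩) (V w)
      · simp only [hr, dif_neg, not_false_eq_true]
        exact Cost.bits_const 0 _
  -- The number of steps depends on the input only through its length. One simulation is run for
  -- each of the `k * w + 1` possible lengths, and the actual length selects the result.
  have h1 := Cost.select (Γ := ⋃ a, bits w (A a)) (Finset.range (k * w + 1))
    (k := fun x => inputLength fun a => A a x) (s := D w) (t := lengthCost w k)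
    (fun x => Finset.mem_range.2 (Nat.lt_succ_of_le (hlen x)))
    (f := fun l x => ((Prog.step^[M.clock.eval l] (κ x)).2 0).testBit i) (fun l hl => ?_)
    (fun l _ => Cost.inputLength hsub hA l)
  · rw [Finset.card_range] at h1
    exact h1
  · have hl' : M.clock.eval l ≤ T w := eval_le_eval _ (Nat.lt_succ_iff.1 (Finset.mem_range.1 hl))
    have h2 := h0.comp (Cost.iterate_step hK hstep (show b ≤ w + b by omega) hκ hs _ hl')
    have h3 := h2.comp (Cost.testBit (w := V w) (i := i) (A := fun x =>
      (Prog.step^[M.clock.eval l] (κ x)).2 0)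
      (bits_subset_layer K R (V w) (fun x => Prog.step^[M.clock.eval l] (κ x)) hR) fun x =>
        ((step_iterate_lt hK hstep (by omega) (κ x) (hκ x) (hs x) _).2 0).trans_le
          (Nat.pow_le_pow_right (by omega) (by simp only [V]; omega)))
    refine h3.le ?_
    simp only [D]
    gcongr

/-! ### Uniform families -/

/-- Numerical functions of a size parameter `ν`, a sequence of numbers `z`, and a small
number `j`. -/
abbrev Fam := ℕ → (ℕ → ℕ) → ℕ → ℕ

/-- The first nonzero number among `f 0, …, f n`, and `0` if there is none. -/
def firstNonzero (f : ℕ → ℕ) : ℕ → ℕ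
  | 0 => f 0
  | n + 1 => if firstNonzero f n = 0 then f (n + 1) else firstNonzero f n

theorem firstNonzero_eq (f : ℕ → ℕ) (n : ℕ) : ∃ i ≤ n, firstNonzero f n = f i := by
  induction n with
  | zero => exact ⟨0, le_rfl, rfl⟩
  | succ n ih =>
    obtain ⟨i, hi, h⟩ := ih
    rw [firstNonzero]
    split_ifs
    · exact ⟨n + 1, le_rfl, rfl⟩
    · exact ⟨i, by omega, h⟩

theorem firstNonzero_ne_zero {f : ℕ → ℕ} {n i : ℕ} (hi : i ≤ n) (h : f i ≠ 0) :
    firstNonzero f n ≠ 0 := by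
  induction n with
  | zero => obtain rfl : i = 0 := by omega
            exact h
  | succ n ih =>
    rw [firstNonzero]
    split_ifs with h0
    · rcases Nat.lt_or_ge i (n + 1) with hlt | hge
      · exact absurd h0 (ih (by omega))
      · obtain rfl : i = n + 1 := by omega
        exact h
    · exact h0

theorem firstNonzero_ne_zero_iff {f : ℕ → ℕ} {n : ℕ} :
    firstNonzero f n ≠ 0 ↔ ∃ i ≤ n, f i ≠ 0 := by
  refine ⟨fun h => ?_, fun ⟨i, hi, h⟩ => firstNonzero_ne_zero hi h⟩
  obtain ⟨i, hi, h'⟩ := firstNonzero_eq f n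
  exact ⟨i, hi, h' ▸ h⟩

/-! ### Codes of sequences with padded members -/

/-- The code of the sequence with first member `y`, padded to `B` bits, followed by the sequence
coded by `t`. -/
def consEntry : ℕ → ℕ → ℕ → ℕ
  | 0, _, t => 2 + 4 * t
  | B + 1, y, t => y % 2 + 4 * consEntry B (y / 2) t

/-- The code of the sequence `f 0, …, f (n - 1)`, with each member padded to `B` bits. -/
def packEntries (B : ℕ) : (ℕ → ℕ) → ℕ → ℕ
  | _, 0 => 0
  | f, n + 1 => consEntry B (f 0) (packEntries B (fun i => f (i + 1)) n)

theorem firstEntry_consEntry (B y t : ℕ) : firstEntry (consEntry B y t) = y % 2 ^ B := by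
  induction B generalizing y with
  | zero =>
    rw [consEntry, firstEntry, dif_neg (by omega), if_pos (by omega)]
    simp [Nat.mod_one]
  | succ B ih =>
    rw [consEntry, firstEntry]
    split_ifs with h0 h2
    · have h1 : consEntry B (y / 2) t = 0 := by omega
      have h2 := ih (y / 2)
      rw [h1, firstEntry] at h2
      simp at h2
      rw [pow_succ', Nat.mod_mul]
      omega
    · omega
    · rw [show (y % 2 + 4 * consEntry B (y / 2) t) / 4 = consEntry B (y / 2) t by omega, ih,
        pow_succ', Nat.mod_mul]
      omega

theorem consEntry_pos (B y t : ℕ) : 0 < consEntry B y t := by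
  induction B generalizing y with
  | zero => rw [consEntry]; omega
  | succ B ih => have := ih (y / 2); rw [consEntry]; omega

theorem dropEntries_consEntry (B y t i : ℕ) :
    dropEntries (consEntry B y t) (i + 1) = dropEntries t i := by
  induction B generalizing y with
  | zero =>
    rw [consEntry, dropEntries, dif_neg (by omega), if_pos (by omega)]
    congr 1
    omega
  | succ B ih =>
    have := consEntry_pos B (y / 2) t
    rw [consEntry, dropEntries, dif_neg (by omega), if_neg (by omega),
      show (y % 2 + 4 * consEntry B (y / 2) t) / 4 = consEntry B (y / 2) t by omega, ih]

theorem entry_packEntries (B : ℕ) (f : ℕ → ℕ) {n i : ℕ} (hi : i < n) :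
    entry (packEntries B f n) i = f i % 2 ^ B := by
  induction n generalizing f i with
  | zero => omega
  | succ n ih =>
    rcases i with _ | i
    · rw [entry, dropEntries, dif_pos (.inl rfl), packEntries, firstEntry_consEntry]
    · rw [entry, packEntries, dropEntries_consEntry, ← entry, ih _ (by omega)]

theorem testBit_add_four_mul (d t p : ℕ) (hd : d < 4) :
    (d + 4 * t).testBit (p + 2) = t.testBit p := by
  rw [Nat.testBit_add, show (d + 4 * t) / 2 ^ 2 = t by omega]

/-- Padding makes the layout independent of the values: the digit at a given position is constant or
a copy of a fixed input digit. Hence packing requires no computation by circuits. -/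
theorem testBit_consEntry (B p : ℕ) :
    (∃ b, ∀ y t, (consEntry B y t).testBit p = b) ∨
    (∃ q, ∀ y t, (consEntry B y t).testBit p = y.testBit q) ∨
    (∃ q, ∀ y t, (consEntry B y t).testBit p = t.testBit q) := by
  induction B generalizing p with
  | zero =>
    rcases p with _ | _ | p
    · refine .inl ⟨false, fun y t => ?_⟩
      simp [consEntry]; omega
    · refine .inl ⟨true, fun y t => ?_⟩
      simp [consEntry, Nat.testBit_add_one]; omega
    · exact .inr (.inr ⟨p, fun y t => testBit_add_four_mul _ _ _ (by omega)⟩)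
  | succ B ih =>
    have h : ∀ y t, (consEntry (B + 1) y t) = y % 2 + 4 * consEntry B (y / 2) t := fun _ _ => rfl
    rcases p with _ | _ | p
    · refine .inr (.inl ⟨0, fun y t => ?_⟩)
      rw [h, Nat.testBit_zero, Nat.testBit_zero]
      congr 1
      apply propext
      omega
    · refine .inl ⟨false, fun y t => ?_⟩
      rw [h, Nat.testBit_add_one, Nat.testBit_zero]
      simp
      omega
    · have h' : ∀ y t, (consEntry (B + 1) y t).testBit (p + 2) =
          (consEntry B (y / 2) t).testBit p :=
        fun y t => testBit_add_four_mul _ _ _ (by omega)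
      rcases ih p with ⟨b, hb⟩ | ⟨q, hq⟩ | ⟨q, hq⟩
      · exact .inl ⟨b, fun y t => by rw [h', hb]⟩
      · exact .inr (.inl ⟨q + 1, fun y t => by rw [h', hq, Nat.testBit_add_one]⟩)
      · exact .inr (.inr ⟨q, fun y t => by rw [h', hq]⟩)

theorem testBit_packEntries (B n p : ℕ) :
    (∃ b, ∀ f, (packEntries B f n).testBit p = b) ∨
    (∃ i < n, ∃ q, ∀ f, (packEntries B f n).testBit p = (f i).testBit q) := by
  induction n generalizing p with
  | zero => exact .inl ⟨false, fun f => by simp [packEntries]⟩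
  | succ n ih =>
    rcases testBit_consEntry B p with ⟨b, hb⟩ | ⟨q, hq⟩ | ⟨q, hq⟩
    · exact .inl ⟨b, fun f => by rw [packEntries, hb]⟩
    · exact .inr ⟨0, by omega, q, fun f => by rw [packEntries, hq]⟩
    · rcases ih q with ⟨b, hb⟩ | ⟨i, hi, q', hq'⟩
      · exact .inl ⟨b, fun f => by rw [packEntries, hq, hb]⟩
      · exact .inr ⟨i + 1, by omega, q', fun f => by rw [packEntries, hq, hq']⟩

theorem consEntry_lt (B y t : ℕ) : consEntry B y t < 4 ^ (B + 1) * (t + 1) := by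
  induction B generalizing y with
  | zero => rw [consEntry]; omega
  | succ B ih =>
    have := ih (y / 2)
    rw [consEntry, pow_succ]
    rw [show 4 ^ (B + 1) * 4 * (t + 1) = 4 * (4 ^ (B + 1) * (t + 1)) by ring]
    omega

theorem packEntries_lt (B : ℕ) (f : ℕ → ℕ) (n : ℕ) :
    packEntries B f n < 2 ^ (2 * (B + 1) * n) := by
  induction n generalizing f with
  | zero => simp [packEntries]
  | succ n ih =>
    have := ih fun i => f (i + 1)
    calc _ < _ := consEntry_lt B _ _
      _ ≤ 4 ^ (B + 1) * 2 ^ (2 * (B + 1) * n) := Nat.mul_le_mul_left _ this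
      _ = _ := by rw [show 4 = 2 ^ 2 by norm_num, ← pow_mul, ← pow_add]; congr 1; ring

/-! ### The closure operations on families -/

/-- Names for the operations on families. -/
inductive FamSym : ℕ → Type
  | pv (k : ℕ) (f : ClockedMachine) : FamSym k
  | fst : FamSym 1
  | snd : FamSym 1
  | search (c : ℕ) : FamSym 1
  | collect (c : ℕ) : FamSym 1

/-- The language of operations on families. -/
def famLang : FirstOrder.Language.{0, 0} := ⟨FamSym, fun _ => Empty⟩

/-- The operations on families: composition with functions computed by clocked machines,
projections of the small number, and search and collection over a further small number. -/
instance famStructure : famLang.Structure Fam where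
  funMap {_} s := match s with
    | .pv _ f => fun g ν z j => f.eval fun a => g a ν z j
    | .fst => fun g ν z j => g 0 ν z j.unpair.1
    | .snd => fun g ν z j => g 0 ν z j.unpair.2
    | .search c => fun g ν z j => firstNonzero (fun i => g 0 ν z (Nat.pair j i)) ((ν + 2) ^ c)
    | .collect c => fun g ν z j =>
        packEntries ((ν + 2) ^ c) (fun i => g 0 ν z (Nat.pair j i)) ((ν + 2) ^ c + 1)
  RelMap r _ := r.elim

/-- The uniform families, obtained from the members of `z` and from `j` by the operations on
families. -/
def uniformFam : famLang.Substructure Fam :=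
  Substructure.closure famLang (insert (fun _ _ j => j) (Set.range fun v _ z _ => z v))

namespace uniformFam

theorem small : (fun _ _ j => j : Fam) ∈ uniformFam := Substructure.subset_closure (.inl rfl)

theorem var (v : ℕ) : (fun _ z _ => z v : Fam) ∈ uniformFam :=
  Substructure.subset_closure (.inr ⟨v, rfl⟩)

theorem pv {k : ℕ} (f : ClockedMachine) {g : Fin k → Fam} (hg : ∀ a, g a ∈ uniformFam) :
    (fun ν z j => f.eval fun a => g a ν z j : Fam) ∈ uniformFam :=
  uniformFam.fun_mem (FamSym.pv k f) g hg

theorem pv₁ (f : ClockedMachine) {g : Fam} (hg : g ∈ uniformFam) :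
    (fun ν z j => f.eval ![g ν z j] : Fam) ∈ uniformFam := by
  have h := pv f (g := ![g]) (by simpa)
  have heq : ∀ ν z j, (fun a => ![g] a ν z j) = ![g ν z j] := fun ν z j => by
    ext a
    fin_cases a; rfl
  simpa only [heq] using h

theorem pv₂ (f : ClockedMachine) {g h : Fam} (hg : g ∈ uniformFam) (hh : h ∈ uniformFam) :
    (fun ν z j => f.eval ![g ν z j, h ν z j] : Fam) ∈ uniformFam := by
  have h' := pv f (g := ![g, h]) (by simp [Fin.forall_fin_two, hg, hh])
  have heq : ∀ ν z j, (fun a => ![g, h] a ν z j) = ![g ν z j, h ν z j] := fun ν z j => by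
    ext a
    fin_cases a <;> rfl
  simpa only [heq] using h'

theorem fst {g : Fam} (hg : g ∈ uniformFam) :
    (fun ν z j => g ν z j.unpair.1 : Fam) ∈ uniformFam :=
  uniformFam.fun_mem FamSym.fst ![g] (by simpa)

theorem snd {g : Fam} (hg : g ∈ uniformFam) :
    (fun ν z j => g ν z j.unpair.2 : Fam) ∈ uniformFam :=
  uniformFam.fun_mem FamSym.snd ![g] (by simpa)

theorem search (c : ℕ) {g : Fam} (hg : g ∈ uniformFam) :
    (fun ν z j => firstNonzero (fun i => g ν z (Nat.pair j i)) ((ν + 2) ^ c) : Fam)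
      ∈ uniformFam :=
  uniformFam.fun_mem (FamSym.search c) ![g] (by simpa)

theorem collect (c : ℕ) {g : Fam} (hg : g ∈ uniformFam) :
    (fun ν z j => packEntries ((ν + 2) ^ c) (fun i => g ν z (Nat.pair j i)) ((ν + 2) ^ c + 1) : Fam)
      ∈ uniformFam :=
  uniformFam.fun_mem (FamSym.collect c) ![g] (by simpa)

theorem induction {P : Fam → Prop} {g : Fam} (hg : g ∈ uniformFam)
    (small : P fun _ _ j => j) (var : ∀ v, P fun _ z _ => z v)
    (pv : ∀ (k : ℕ) (f : ClockedMachine) (g : Fin k → Fam), (∀ a, P (g a)) →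
      P fun ν z j => f.eval fun a => g a ν z j)
    (fst : ∀ g, P g → P fun ν z j => g ν z j.unpair.1)
    (snd : ∀ g, P g → P fun ν z j => g ν z j.unpair.2)
    (search : ∀ c g, P g →
      P fun ν z j => firstNonzero (fun i => g ν z (Nat.pair j i)) ((ν + 2) ^ c))
    (collect : ∀ c g, P g → P fun ν z j =>
      packEntries ((ν + 2) ^ c) (fun i => g ν z (Nat.pair j i)) ((ν + 2) ^ c + 1)) : P g := by
  refine Substructure.closure_induction hg ?_ ?_
  · intro n s
    cases s with
    | pv _ f => exact fun x hx => pv n f x hx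
    | fst => exact fun x hx => fst _ (hx 0)
    | snd => exact fun x hx => snd _ (hx 0)
    | search c => exact fun x hx => search c _ (hx 0)
    | collect c => exact fun x hx => collect c _ (hx 0)
  · rintro _ (rfl | ⟨v, rfl⟩)
    · exact small
    · exact var v

end uniformFam

theorem Op.countable : Countable Op := by
  let f : Op → ℕ × ℕ × ℕ
    | .const n => (0, n, 0)
    | .reg a => (1, a, 0)
    | .add a b => (2, a, b)
    | .sub a b => (3, a, b)
    | .half a => (4, a, 0)
  refine Function.Injective.countable (f := f) fun a b h => ?_
  cases a <;> cases b <;> simp_all [f]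

theorem Prog.countable : Countable Prog := by
  have := Op.countable
  obtain ⟨e, he⟩ := exists_injective_nat Op
  let f : Prog → ℕ := fun p => Prog.rec (motive := fun _ => ℕ) (Nat.pair 0 0)
    (fun r o => Nat.pair 1 (Nat.pair r (e o))) (fun _ _ a b => Nat.pair 2 (Nat.pair a b))
    (fun r _ _ a b => Nat.pair 3 (Nat.pair r (Nat.pair a b)))
    (fun r _ a => Nat.pair 4 (Nat.pair r a)) p
  refine Function.Injective.countable (f := f) fun p => ?_
  induction p with
  | skip => intro q h; cases q <;> simp_all [f]
  | assign r o => intro q h; cases q <;> simp_all [f, he.eq_iff]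
  | seq p p' hp hp' =>
    intro q h
    cases q <;> simp [f] at h
    exact congrArg₂ _ (hp h.1) (hp' h.2)
  | ite r p p' hp hp' =>
    intro q h
    cases q <;> simp [f] at h
    rw [h.1, hp h.2.1, hp' h.2.2]
  | loop r p hp =>
    intro q h
    cases q <;> simp [f] at h
    rw [h.1, hp h.2]

theorem ClockedMachine.countable : Countable ClockedMachine := by
  have := Prog.countable
  have : Countable (Polynomial ℕ) := by
    rw [← Cardinal.mk_le_aleph0_iff]
    exact Polynomial.cardinalMk_le_max.trans (by simp)
  exact Function.Injective.countable (f := fun M : ClockedMachine => (M.prog, M.clock))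
    fun ⟨_, _⟩ ⟨_, _⟩ h => by simpa using h

/-- An enumeration of the families is needed twice: stage `u` takes care of the first `u` families
when the primes are chosen, and the choice scheme is verified by diagonalising against all of them.
-/
theorem uniformFam.countable : Countable uniformFam := by
  have := ClockedMachine.countable
  have : Countable (Σ l, famLang.Functions l) := by
    let f : (ℕ × ClockedMachine) ⊕ Bool ⊕ Bool × ℕ → Σ l, famLang.Functions l
      | .inl (k, M) => ⟨k, FamSym.pv k M⟩
      | .inr (.inl true) => ⟨1, FamSym.fst⟩
      | .inr (.inl false) => ⟨1, FamSym.snd⟩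
      | .inr (.inr (true, c)) => ⟨1, FamSym.search c⟩
      | .inr (.inr (false, c)) => ⟨1, FamSym.collect c⟩
    refine Function.Surjective.countable (f := f) ?_
    rintro ⟨l, s⟩
    cases s with
    | pv k M => exact ⟨.inl (l, M), rfl⟩
    | fst => exact ⟨.inr (.inl true), rfl⟩
    | snd => exact ⟨.inr (.inl false), rfl⟩
    | search c => exact ⟨.inr (.inr (true, c)), rfl⟩
    | collect c => exact ⟨.inr (.inr (false, c)), rfl⟩
  exact Set.Countable.substructure_closure famLang ((Set.countable_range _).insert _)

/-! ### Machines for the operations used below -/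

theorem loopFree_eval (p : Prog) (hp : p.loopFree = true) {k : ℕ} (x : Fin k → ℕ) :
    (ClockedMachine.mk p (p.nodes : Polynomial ℕ)).eval x = p.effect (initRegs x) 0 := by
  obtain ⟨n, hn, h⟩ := Prog.exists_runs_effect p hp (initRegs x)
  rw [ClockedMachine.eval_eq h (hn.trans (by simp))]

/-- The machine with a given program without loops. -/
noncomputable def simpleMachine (l : List Prog) : ClockedMachine :=
  ⟨.block l, ((Prog.block l).nodes : Polynomial ℕ)⟩

/-- Decides `x₀ = x₁`. -/
noncomputable def eqMachine : ClockedMachine := simpleMachine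
  [.assign 2 (.sub 0 1), .assign 3 (.sub 1 0), .assign 2 (.add 2 3), .assign 3 (.const 1),
    .assign 0 (.sub 3 2)]

theorem eqMachine_eval (a b : ℕ) : eqMachine.eval ![a, b] ≠ 0 ↔ a = b := by
  rw [eqMachine, simpleMachine, loopFree_eval _ rfl]
  simp [Prog.block, Prog.effect, Op.eval, initRegs]
  omega

/-- Decides `x₀ ≠ 0 ∧ x₁ = 0`. -/
noncomputable def andNotMachine : ClockedMachine := simpleMachine
  [.ite 1 (.assign 0 (.const 0)) .skip]

theorem andNotMachine_eval (a b : ℕ) : andNotMachine.eval ![a, b] ≠ 0 ↔ a ≠ 0 ∧ b = 0 := by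
  rw [andNotMachine, simpleMachine, loopFree_eval _ rfl]
  by_cases hb : b = 0 <;> simp [Prog.block, Prog.effect, Op.eval, initRegs, hb]

/-- Decides `x₀ = 0`. -/
noncomputable def isZeroMachine : ClockedMachine := simpleMachine
  [.assign 1 (.const 1), .assign 0 (.sub 1 0)]

theorem isZeroMachine_eval (a : ℕ) : isZeroMachine.eval ![a] ≠ 0 ↔ a = 0 := by
  rw [isZeroMachine, simpleMachine, loopFree_eval _ rfl]
  simp [Prog.block, Prog.effect, Op.eval, initRegs]
  omega

/-- Computes `x₁ + 1` if `x₀ ≠ 0`, and `0` otherwise. -/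
noncomputable def guardMachine : ClockedMachine := simpleMachine
  [.assign 2 (.const 1), .ite 0 (.assign 0 (.add 1 2)) .skip]

theorem guardMachine_eval (a b : ℕ) :
    guardMachine.eval ![a, b] = if a = 0 then 0 else b + 1 := by
  rw [guardMachine, simpleMachine, loopFree_eval _ rfl]
  by_cases ha : a = 0 <;> simp [Prog.block, Prog.effect, Op.eval, initRegs, ha]

/-- Computes `x₀` if `x₀ ≠ 0`, and `x₁` otherwise. -/
noncomputable def orElseMachine : ClockedMachine := simpleMachine
  [.ite 0 .skip (.assign 0 (.reg 1))]

theorem orElseMachine_eval (a b : ℕ) : orElseMachine.eval ![a, b] = if a = 0 then b else a := by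
  rw [orElseMachine, simpleMachine, loopFree_eval _ rfl]
  by_cases ha : a = 0 <;> simp [Prog.block, Prog.effect, Op.eval, initRegs, ha]

/-- Computes `x₀ - 1`. -/
noncomputable def predMachine : ClockedMachine := simpleMachine
  [.assign 1 (.const 1), .assign 0 (.sub 0 1)]

theorem predMachine_eval (a : ℕ) : predMachine.eval ![a] = a - 1 := by
  rw [predMachine, simpleMachine, loopFree_eval _ rfl]
  simp [Prog.block, Prog.effect, Op.eval, initRegs]

/-- Computes `x₀` if `1 < x₀ < x₁`, and `0` otherwise. -/
noncomputable def properMachine : ClockedMachine := simpleMachine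
  [.assign 2 (.const 1), .assign 2 (.sub 0 2), .assign 3 (.sub 1 0),
    .ite 2 (.ite 3 .skip (.assign 0 (.const 0))) (.assign 0 (.const 0))]

theorem properMachine_eval (a b : ℕ) :
    properMachine.eval ![a, b] = if 1 < a ∧ a < b then a else 0 := by
  rw [properMachine, simpleMachine, loopFree_eval _ rfl]
  by_cases h1 : a - 1 = 0
  · simp [Prog.block, Prog.effect, Op.eval, initRegs, h1]
    omega
  · by_cases h2 : b - a = 0
    · simp [Prog.block, Prog.effect, Op.eval, initRegs, h1, h2]
      omega
    · simp [Prog.block, Prog.effect, Op.eval, initRegs, h1, h2]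
      omega

/-- Computes the greatest common divisor of `x₀` and `x₁` for odd `x₁`, by the binary algorithm. -/
noncomputable def gcdMachine : ClockedMachine :=
  ⟨.block [
    .loop 0 (.block [
      .assign 2 (.half 0),
      .assign 3 (.add 2 2),
      .assign 3 (.sub 0 3),
      .ite 3
        (.block [
          .assign 4 (.sub 1 0),
          .ite 4
            (.block [.assign 1 (.reg 0), .assign 0 (.reg 4)])
            (.assign 0 (.sub 0 1))])
        (.assign 0 (.reg 2))]),
    .assign 0 (.reg 1)], 200 * Polynomial.X + 200⟩

theorem gcd_half_of_odd {a b : ℕ} (ha : a % 2 = 0) (hb : b % 2 = 1) :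
    Nat.gcd (a / 2) b = Nat.gcd a b := by
  obtain ⟨c, rfl⟩ : ∃ c, a = 2 * c := ⟨a / 2, by omega⟩
  rw [show 2 * c / 2 = c by omega]
  exact (Nat.Coprime.gcd_mul_left_cancel c
    (Nat.coprime_two_left.2 (Nat.odd_iff.2 hb))).symm

theorem gcdMachine_eval (a b : ℕ) (hb : b % 2 = 1) : gcdMachine.eval ![a, b] = Nat.gcd a b := by
  obtain ⟨h0, h1, -⟩ := initRegs_two ![a, b]
  obtain ⟨t, n, hn, hr, ⟨-, ht⟩, ht0⟩ := Runs.exists_loop (r := 0)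
    (p := .block [
      .assign 2 (.half 0),
      .assign 3 (.add 2 2),
      .assign 3 (.sub 0 3),
      .ite 3
        (.block [
          .assign 4 (.sub 1 0),
          .ite 4
            (.block [.assign 1 (.reg 0), .assign 0 (.reg 4)])
            (.assign 0 (.sub 0 1))])
        (.assign 0 (.reg 2))])
    (fun s => s 1 % 2 = 1 ∧ Nat.gcd (s 0) (s 1) = Nat.gcd a b)
    -- Halving removes a bit, which counts twice, and may at worst make register `0` odd.
    -- Subtraction turns register `0` from odd to even without increasing the total length.
    (fun s => 2 * ((s 0).size + (s 1).size) + s 0 % 2) 30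
    (by
      rintro s ⟨hs1, hs⟩ hs0
      obtain ⟨n, hn, h⟩ := Prog.exists_runs_effect (.block [
        .assign 2 (.half 0),
        .assign 3 (.add 2 2),
        .assign 3 (.sub 0 3),
        .ite 3
          (.block [
            .assign 4 (.sub 1 0),
            .ite 4
              (.block [.assign 1 (.reg 0), .assign 0 (.reg 4)])
              (.assign 0 (.sub 0 1))])
          (.assign 0 (.reg 2))]) rfl s
      refine ⟨_, n, hn.trans (by simp [Prog.block, Prog.nodes]), h, ?_⟩
      simp only [Prog.block, Prog.effect, Op.eval, Function.update_apply]
      by_cases hp : s 0 % 2 = 0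
      · have hp' : s 0 - (s 0 / 2 + s 0 / 2) = 0 := by omega
        have := size_half_lt hs0
        simp [hp', hs1]
        refine ⟨by rw [gcd_half_of_odd hp hs1, hs], by omega⟩
      · have hp' : s 0 - (s 0 / 2 + s 0 / 2) ≠ 0 := by omega
        by_cases hlt : s 1 - s 0 = 0
        · have := Nat.size_le_size (show s 0 - s 1 ≤ s 0 by omega)
          simp [hp', hlt, hs1]
          refine ⟨by rw [← hs, Nat.gcd_sub_self_left (by omega)], by omega⟩
        · have := Nat.size_le_size (show s 1 - s 0 ≤ s 1 by omega)
          simp [hp', hlt]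
          refine ⟨⟨by omega, ?_⟩, by omega⟩
          rw [← hs, Nat.gcd_sub_self_left (by omega), Nat.gcd_comm])
    (initRegs ![a, b]) (by simp [h0, h1, hb])
  have hp := Runs.block_cons hr (Runs.block_cons (Runs.assign 0 (.reg 1) t) (Runs.block_nil _))
  rw [ClockedMachine.eval_eq (M := gcdMachine) hp]
  · simp only [Op.eval, Function.update_self]
    simpa [ht0] using ht
  · have hlen : inputLength ![a, b] = a.size + b.size := by simp [inputLength]
    simp [gcdMachine, hlen]
    simp [h0, h1] at hn
    omega

/-! ### Circuits for uniform families -/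

/-- The value of the family depends only on the first `k` members of the sequence. -/
def DependsOn (g : Fam) (k : ℕ) : Prop :=
  ∀ ν z z' j, (∀ v < k, z v = z' v) → g ν z j = g ν z' j

theorem DependsOn.mono {g : Fam} {k k' : ℕ} (h : DependsOn g k) (hk : k ≤ k') : DependsOn g k' :=
  fun ν z z' j hz => h ν z z' j fun v hv => hz v (by omega)

/-- The bits of the first `k` members of a sequence of `ν`-bit numbers. -/
def inputBits {X : Type} (k ν : ℕ) (Z : X → ℕ → ℕ) : Set (X → Bool) :=
  ⋃ v ∈ Finset.range k, bits ν fun x => Z x v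

theorem inputBits_mono {X : Type} {k k' : ℕ} (h : k ≤ k') (ν : ℕ) (Z : X → ℕ → ℕ) :
    inputBits k ν Z ⊆ inputBits k' ν Z :=
  Set.biUnion_subset_biUnion_left fun v hv => by simp at *; omega

/-- The values of the family have at most `w` bits, which are computed by circuits of size `s`. -/
def HasCircuits (g : Fam) (k w s ν j : ℕ) : Prop :=
  ∀ (X : Type) (Z : X → ℕ → ℕ), (∀ x, ∀ v < k, Z x v < 2 ^ ν) →
    (∀ x, g ν (Z x) j < 2 ^ w) ∧ Cost (inputBits k ν Z) s (bits w fun x => g ν (Z x) j)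

theorem HasCircuits.mono {g : Fam} {k k' w w' s ν j : ℕ} (h : HasCircuits g k w s ν j)
    (hk : k ≤ k') (hw : w ≤ w') : HasCircuits g k' w' (s + w') ν j := by
  intro X Z hZ
  obtain ⟨h1, h2⟩ := h X Z fun x v hv => hZ x v (by omega)
  exact ⟨fun x => (h1 x).trans_le (Nat.pow_le_pow_right (by omega) hw),
    (h2.weaken (inputBits_mono hk ν Z)).comp (Cost.bits_extend subset_rfl h1 w')⟩

/-- The family has circuits of size polynomial in `ν` and `j`. -/
def Feasible (g : Fam) : Prop :=
  ∃ k c d, DependsOn g k ∧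
    ∀ ν j, HasCircuits g k ((ν + j + 2) ^ c) ((ν + j + 2) ^ d) ν j

theorem Feasible.of_polyBdd {g : Fam} {k : ℕ} {b s : ℕ → ℕ} (hk : DependsOn g k)
    (hb : PolyBdd b) (hs : PolyBdd s)
    (h : ∀ ν j, ∃ w ≤ b (ν + j), ∃ t ≤ s (ν + j), HasCircuits g k w t ν j) : Feasible g := by
  obtain ⟨c, hc⟩ := hb
  obtain ⟨d, hd⟩ := hs.add ((PolyBdd.id.add (.const 2)).pow c)
  refine ⟨k, c, d, hk, fun ν j => ?_⟩
  obtain ⟨w, hw, t, ht, h⟩ := h ν j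
  intro X Z hZ
  obtain ⟨h1, h2⟩ := h.mono le_rfl (hw.trans (hc _)) X Z hZ
  exact ⟨h1, h2.le (le_trans (by simpa using ht) (hd _))⟩

theorem pow_le_pow_of_le {m n : ℕ} (h : m ≤ n) (c : ℕ) : (m + 2) ^ c ≤ (n + 2) ^ c :=
  Nat.pow_le_pow_left (by omega) c

theorem Feasible.comp_small {g : Fam} (hg : Feasible g) {σ : ℕ → ℕ} (hσ : ∀ j, σ j ≤ j) :
    Feasible fun ν z j => g ν z (σ j) := by
  obtain ⟨k, c, d, hk, h⟩ := hg
  refine of_polyBdd (k := k) (b := fun n => (n + 2) ^ c) (s := fun n => (n + 2) ^ d)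
    (fun ν z z' j hz => hk ν z z' _ hz)
    ((PolyBdd.id.add (.const 2)).pow c) ((PolyBdd.id.add (.const 2)).pow d) fun ν j => ?_
  have := hσ j
  exact ⟨_, pow_le_pow_of_le (by omega) c, _, pow_le_pow_of_le (by omega) d, h ν (σ j)⟩

theorem Cost.firstNonzero {X : Type} {Γ : Set (X → Bool)} {W T : ℕ} {f : ℕ → X → ℕ} {n : ℕ}
    (hlt : ∀ i ≤ n, ∀ x, f i x < 2 ^ W) (h : ∀ i ≤ n, Cost Γ T (bits W (f i))) :
    Cost Γ ((n + 1) * (T + W * (2 * W + 8))) (bits W fun x => firstNonzero (fun i => f i x) n) := by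
  induction n with
  | zero => exact (h 0 le_rfl).le (by omega)
  | succ n ih =>
    have ih := ih (fun i hi => hlt i (by omega)) fun i hi => h i (by omega)
    have hlt' : ∀ x, BoundedArith.firstNonzero (fun i => f i x) n < 2 ^ W := fun x => by
      obtain ⟨i, hi, heq⟩ := firstNonzero_eq (fun i => f i x) n
      rw [heq]
      exact hlt i (by omega) x
    refine ((ih.union (h (n + 1) le_rfl)).comp (t := W * (2 * W + 8))
      (of_bits fun i hi => ?_)).le (le_of_eq (by ring))
    have hz := eqZero (A := fun x => BoundedArith.firstNonzero (fun i => f i x) n) (w := W)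
      (Γ := bits W (fun x => BoundedArith.firstNonzero (fun i => f i x) n) ∪ bits W (f (n + 1)))
      Set.subset_union_left hlt'
    have h1 := hz.ite (mem (.inr (mem_bits (f (n + 1)) hi)) 0)
      (mem (.inl (mem_bits (fun x => BoundedArith.firstNonzero (fun i => f i x) n) hi)) 0)
    convert! h1.le (s' := 2 * W + 8) (by omega) using 3
    rw [BoundedArith.firstNonzero]
    split_ifs <;> rfl

/-- A polynomial bound for a small number paired with another. -/
def pairBound (c n : ℕ) : ℕ := n + (n + (n + 2) ^ c + 1) ^ 2

theorem add_pair_le_pairBound {c ν j i : ℕ} (hi : i ≤ (ν + 2) ^ c) :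
    ν + Nat.pair j i ≤ pairBound c (ν + j) := by
  have h1 := Nat.pair_lt_max_add_one_sq j i
  have h2 : (ν + 2) ^ c ≤ (ν + j + 2) ^ c := pow_le_pow_of_le (by omega) c
  have h3 : (max j i + 1) ^ 2 ≤ (ν + j + (ν + j + 2) ^ c + 1) ^ 2 :=
    Nat.pow_le_pow_left (by omega) 2
  rw [pairBound]
  omega

theorem PolyBdd.pairBound (c : ℕ) : PolyBdd (pairBound c) :=
  id.add (((id.add ((id.add (const 2)).pow c)).add (const 1)).pow 2)

/-- The paired numbers have polynomial magnitude, so polynomially many circuits of polynomial size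
run side by side, and their outputs are merged. -/
theorem Feasible.search {g : Fam} (hg : Feasible g) (c₀ : ℕ) : Feasible fun ν z j =>
    firstNonzero (fun i => g ν z (Nat.pair j i)) ((ν + 2) ^ c₀) := by
  obtain ⟨k, c, d, hk, h⟩ := hg
  have hq := PolyBdd.pairBound c₀
  let W : ℕ → ℕ := fun n => (pairBound c₀ n + 2) ^ c
  let T : ℕ → ℕ := fun n => (pairBound c₀ n + 2) ^ d + W n
  have hW : PolyBdd W := (hq.add (.const 2)).pow c
  have hT : PolyBdd T := ((hq.add (.const 2)).pow d).add hW
  refine of_polyBdd (k := k) (b := W)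
    (s := fun n => ((n + 2) ^ c₀ + 1) * (T n + W n * (2 * W n + 8))) ?_ hW
    ((((PolyBdd.id.add (.const 2)).pow c₀).add (.const 1)).mul
      (hT.add (hW.mul (((PolyBdd.const 2).mul hW).add (.const 8))))) fun ν j => ?_
  · intro ν z z' j hz
    simp only [hk ν z z' _ hz]
  · refine ⟨W (ν + j), le_rfl,
      ((ν + 2) ^ c₀ + 1) * (T (ν + j) + W (ν + j) * (2 * W (ν + j) + 8)), ?_, fun X Z hZ => ?_⟩
    · exact Nat.mul_le_mul_right _ (Nat.add_le_add_right (pow_le_pow_of_le (by omega) c₀) 1)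
    · have key : ∀ i ≤ (ν + 2) ^ c₀, _ := fun i hi =>
        ((h ν (Nat.pair j i)).mono le_rfl
          (pow_le_pow_of_le (add_pair_le_pairBound (j := j) hi) c)) X Z hZ
      refine ⟨fun x => ?_, ?_⟩
      · obtain ⟨i, hi, heq⟩ := firstNonzero_eq (fun i => g ν (Z x) (Nat.pair j i)) ((ν + 2) ^ c₀)
        simp only [heq]
        exact (key i hi).1 x
      · exact Cost.firstNonzero (fun i hi => (key i hi).1) fun i hi => (key i hi).2.le
          (Nat.add_le_add_right (pow_le_pow_of_le (add_pair_le_pairBound hi) d) _)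

theorem Feasible.collect {g : Fam} (hg : Feasible g) (c₀ : ℕ) : Feasible fun ν z j =>
    packEntries ((ν + 2) ^ c₀) (fun i => g ν z (Nat.pair j i)) ((ν + 2) ^ c₀ + 1) := by
  obtain ⟨k, c, d, hk, h⟩ := hg
  have hq := PolyBdd.pairBound c₀
  let B : ℕ → ℕ := fun n => (n + 2) ^ c₀
  have hB : PolyBdd B := (PolyBdd.id.add (.const 2)).pow c₀
  let W : ℕ → ℕ := fun n => 2 * (B n + 1) * (B n + 1)
  have hW : PolyBdd W := ((PolyBdd.const 2).mul (hB.add (.const 1))).mul (hB.add (.const 1))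
  refine of_polyBdd (k := k) (b := W) (s := fun n => W n * ((pairBound c₀ n + 2) ^ d + 1)) ?_ hW
    (hW.mul (((hq.add (.const 2)).pow d).add (.const 1))) fun ν j => ?_
  · intro ν z z' j hz
    simp only [hk ν z z' _ hz]
  · have hBle : B ν ≤ B (ν + j) := pow_le_pow_of_le (by omega) c₀
    have hWle : W ν ≤ W (ν + j) := by simp only [W]; gcongr
    refine ⟨W ν, hWle, W ν * ((pairBound c₀ (ν + j) + 2) ^ d + 1), Nat.mul_le_mul_right _ hWle,
      fun X Z hZ => ⟨fun x => packEntries_lt _ _ _, Cost.of_bits fun p _ => ?_⟩⟩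
    -- Each bit of the code depends on one bit of one member at most, so it needs the circuit of
    -- that member only.
    rcases testBit_packEntries ((ν + 2) ^ c₀) ((ν + 2) ^ c₀ + 1) p with ⟨b, hb⟩ | ⟨i, hi, q, hq⟩
    · simp only [hb]
      exact (Cost.const b).le (by omega)
    · simp only [hq]
      obtain ⟨h1, h2⟩ := h ν (Nat.pair j i) X Z hZ
      exact (h2.comp (Cost.testBit subset_rfl h1 q)).le (Nat.add_le_add_right
        (pow_le_pow_of_le (add_pair_le_pairBound (by omega)) d) 1)

theorem Feasible.pv {n : ℕ} (f : ClockedMachine) {g : Fin n → Fam} (hg : ∀ a, Feasible (g a)) :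
    Feasible fun ν z j => f.eval fun a => g a ν z j := by
  choose k c d hk h using hg
  obtain ⟨c', d', hf⟩ := f.exists_cost n
  -- Sums of the exponents serve as common bounds for all arguments.
  have hkle : ∀ a, k a ≤ ∑ a, k a := fun a => Finset.single_le_sum (f := k) (by simp) (by simp)
  have hcle : ∀ a, c a ≤ ∑ a, c a := fun a => Finset.single_le_sum (f := c) (by simp) (by simp)
  have hdle : ∀ a, d a ≤ ∑ a, d a := fun a => Finset.single_le_sum (f := d) (by simp) (by simp)
  set C := ∑ a, c a
  set D := ∑ a, d a
  have hp : ∀ c, PolyBdd fun n => (n + 2) ^ c := fun c => (PolyBdd.id.add (.const 2)).pow c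
  refine of_polyBdd (k := ∑ a, k a) (b := fun N => ((N + 2) ^ C + 2) ^ c')
    (s := fun N => n * ((N + 2) ^ D + (N + 2) ^ C) + ((N + 2) ^ C + 2) ^ d') ?_
    ((hp c').comp (hp C))
    (((PolyBdd.const n).mul ((hp D).add (hp C))).add ((hp d').comp (hp C))) fun ν j => ?_
  · intro ν z z' j hz
    simp only [fun a => hk a ν z z' j fun v hv => hz v (by have := hkle a; omega)]
  · refine ⟨_, le_rfl, _, le_rfl, fun X Z hZ => ?_⟩
    have key := fun a => ((h a ν j).mono (hkle a)
      (Nat.pow_le_pow_right (by omega) (hcle a))) X Z hZ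
    obtain ⟨h1, h2⟩ := hf ((ν + j + 2) ^ C) (fun a x => g a ν (Z x) j) fun a => (key a).1
    refine ⟨h1, ?_⟩
    have h3 := Cost.biUnion (Finset.univ : Finset (Fin n))
      (s := (ν + j + 2) ^ D + (ν + j + 2) ^ C) fun a _ => (key a).2.le
        (Nat.add_le_add_right (Nat.pow_le_pow_right (by omega) (hdle a)) _)
    simp only [Finset.mem_univ, Set.iUnion_true, Finset.card_univ, Fintype.card_fin] at h3
    exact h3.comp h2

theorem uniformFam.feasible {g : Fam} (hg : g ∈ uniformFam) : Feasible g := by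
  refine uniformFam.induction hg ?_ ?_ (fun k f g => Feasible.pv f)
    (fun g hg => hg.comp_small Nat.unpair_left_le) (fun g hg => hg.comp_small Nat.unpair_right_le)
    (fun c g hg => hg.search c) fun c g hg => hg.collect c
  -- Circuits are built for each pair of `ν` and `j` separately, so the small number is a hard-wired
  -- constant.
  · refine Feasible.of_polyBdd (k := 0) (b := fun n => n) (s := fun n => n)
      (fun _ _ _ _ _ => rfl) .id .id fun ν j => ⟨j, by omega, j, by omega, fun X Z _ => ?_⟩
    exact ⟨fun _ => Nat.lt_two_pow_self, Cost.bits_const j j⟩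
  · intro v
    refine Feasible.of_polyBdd (k := v + 1) (b := fun n => n) (s := fun n => n)
      (fun _ _ _ _ h => h v (by omega)) .id .id
      fun ν j => ⟨ν, by omega, 0, by omega, fun X Z hZ => ⟨fun x => hZ x v (by omega), ?_⟩⟩
    refine Cost.of_subset ?_ 0
    intro f hf
    exact Set.mem_biUnion (x := v) (by simp) hf

/-! ### Evaluation of formulas -/

section Realize

variable {M : Type} [PV.Structure M] {α : Type} {n : ℕ} {v : α → M} {xs : Fin n → M}

theorem realize_one : (one : PV.Term α).realize v = oneIn M := by
  rw [one, Term.realize_constants, oneIn]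
  exact congrArg (Structure.funMap oneSym) (Subsingleton.elim _ _)

theorem realize_two : (two : PV.Term α).realize v = twoIn M := by
  rw [two, Term.realize_constants, twoIn]
  exact congrArg (Structure.funMap twoSym) (Subsingleton.elim _ _)

theorem realize_leF {t u : PV.Term (α ⊕ Fin n)} : (leF t u).Realize v xs ↔
    LeIn (t.realize (Sum.elim v xs)) (u.realize (Sum.elim v xs)) := by
  rw [leF, BoundedFormula.realize_bdEqual, Term.realize_functions_apply₂, realize_one, LeIn]

theorem realize_dvdF {t u : PV.Term (α ⊕ Fin n)} : (dvdF t u).Realize v xs ↔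
    DvdIn (t.realize (Sum.elim v xs)) (u.realize (Sum.elim v xs)) := by
  rw [dvdF, BoundedFormula.realize_bdEqual, Term.realize_functions_apply₂, realize_one, DvdIn]

theorem realize_liftTerm {t : PV.Term (α ⊕ Fin n)} {a : M} :
    (liftTerm t).realize (Sum.elim v (Fin.snoc xs a)) = t.realize (Sum.elim v xs) := by
  rw [liftTerm, Term.realize_relabel]
  congr 1
  ext b
  rcases b with b | i <;> simp

theorem realize_ballF {t : PV.Term (α ⊕ Fin n)} {φ : PV.BoundedFormula α (n + 1)} :
    (ballF t φ).Realize v xs ↔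
      ∀ a : M, LeIn a (t.realize (Sum.elim v xs)) → φ.Realize v (Fin.snoc xs a) := by
  simp [ballF, realize_leF, realize_liftTerm]

theorem realize_bexF {t : PV.Term (α ⊕ Fin n)} {φ : PV.BoundedFormula α (n + 1)} :
    (bexF t φ).Realize v xs ↔
      ∃ a : M, LeIn a (t.realize (Sum.elim v xs)) ∧ φ.Realize v (Fin.snoc xs a) := by
  simp [bexF, realize_leF, realize_liftTerm]

end Realize

theorem oneIn_nat : oneIn ℕ = 1 := constMachine_eval 1 _

theorem leIn_nat {a b : ℕ} : LeIn a b ↔ a ≤ b := by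
  rw [LeIn, oneIn_nat]
  refine (congrArg (· = 1) (leSym_eval ![a, b])).to_iff.trans ?_
  simp

theorem dvdIn_nat {a b : ℕ} : DvdIn a b ↔ a ∣ b := by
  rw [DvdIn, oneIn_nat]
  refine (congrArg (· = 1) (dvdSym_eval ![a, b])).to_iff.trans ?_
  simp

theorem realize_len_nat {α : Type} {v : α → ℕ} {t : PV.Term α} :
    (len t).realize v = (t.realize v).size := by
  rw [len, Term.realize_functions_apply₁]
  exact lenSym_eval _

/-! ### Uniform families for sharply bounded formulas -/

theorem uniformFam.size_le {g : Fam} (hg : g ∈ uniformFam) (e : ℕ) : ∃ c, ∀ ν z j,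
    (∀ v, z v < 2 ^ ν) → j ≤ (ν + 2) ^ e → (g ν z j).size ≤ (ν + 2) ^ c := by
  obtain ⟨k, c, d, -, h⟩ := feasible hg
  obtain ⟨c', hc'⟩ : PolyBdd fun ν => (ν + (ν + 2) ^ e + 2) ^ c :=
    ((PolyBdd.id.add ((PolyBdd.id.add (.const 2)).pow e)).add (.const 2)).pow c
  refine ⟨c', fun ν z j hz hj => ?_⟩
  -- Over a one-point domain, the width of the circuits is a bound for the single sequence `z`.
  have := (h ν j Unit (fun _ => z) fun _ v _ => hz v).1 ()
  exact (Nat.size_le.2 this).trans ((pow_le_pow_of_le (by omega) c).trans (hc' ν))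

theorem exists_pair_le (e c : ℕ) : ∃ e', ∀ ν j i, j ≤ (ν + 2) ^ e → i ≤ (ν + 2) ^ c →
    Nat.pair j i ≤ (ν + 2) ^ e' := by
  have hp : ∀ c, PolyBdd fun n => (n + 2) ^ c := fun c => (PolyBdd.id.add (.const 2)).pow c
  obtain ⟨e', he'⟩ := (((hp e).add (hp c)).add (.const 1)).pow 2
  refine ⟨e', fun ν j i hj hi => ?_⟩
  refine (Nat.pair_lt_max_add_one_sq j i).le.trans (le_trans ?_ (he' ν))
  exact Nat.pow_le_pow_left (by omega) 2

theorem uniformFam.term {β : Type} (t : PV.Term β) {A : β → Fam} (hA : ∀ b, A b ∈ uniformFam) :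
    (fun ν z j => t.realize fun b => A b ν z j : Fam) ∈ uniformFam := by
  induction t with
  | var b => exact hA b
  | func f ts ih => exact pv f ih

theorem sumElim_fam {α : Type} {n : ℕ} (A : α → Fam) (V : Fin n → Fam) (ν : ℕ) (z : ℕ → ℕ) (j : ℕ) :
    (fun b => Sum.elim A V b ν z j) = Sum.elim (fun a => A a ν z j) fun i => V i ν z j := by
  ext b
  rcases b with b | b <;> rfl

/-- Sharply bounded quantifiers become searches over a polynomial range. As `D` vanishes where `P`
holds, a decision family for the matrix can be used directly to look for counterexamples, and its
negation to look for witnesses. -/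
theorem search_truth {D E : Fam} (hD : D ∈ uniformFam) (hE : E ∈ uniformFam) (c e : ℕ)
    {P : ℕ → (ℕ → ℕ) → ℕ → ℕ → Prop}
    (hsize : ∀ ν z j, (∀ v, z v < 2 ^ ν) → j ≤ (ν + 2) ^ e → E ν z j ≤ (ν + 2) ^ c)
    (h : ∀ ν z j i, (∀ v, z v < 2 ^ ν) → j ≤ (ν + 2) ^ e → i ≤ (ν + 2) ^ c →
      (D ν z (Nat.pair j i) = 0 ↔ P ν z j i)) :
    ∃ F ∈ uniformFam, ∀ ν z j, (∀ v, z v < 2 ^ ν) → j ≤ (ν + 2) ^ e →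
      (F ν z j ≠ 0 ↔ ∃ i ≤ E ν z j, P ν z j i) := by
  refine ⟨_, uniformFam.search c (uniformFam.pv₂ andNotMachine
    (uniformFam.pv₂ leSym (uniformFam.snd uniformFam.small) (uniformFam.fst hE)) hD),
    fun ν z j hz hj => ?_⟩
  rw [firstNonzero_ne_zero_iff]
  simp only [andNotMachine_eval, Nat.unpair_pair, leSym_eval]
  constructor
  · rintro ⟨i, hi, hle, h0⟩
    refine ⟨i, ?_, (h ν z j i hz hj hi).1 h0⟩
    by_contra hlt
    simp [hlt] at hle
  · rintro ⟨i, hi, hP⟩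
    have hi' := hi.trans (hsize ν z j hz hj)
    exact ⟨i, hi', by simp [hi], (h ν z j i hz hj hi').2 hP⟩

theorem snoc_fam {n : ℕ} (V : Fin n → Fam) (ν : ℕ) (z : ℕ → ℕ) (j i : ℕ) :
    (fun k : Fin (n + 1) => (Fin.snoc (α := fun _ => Fam) (fun k ν z j => V k ν z j.unpair.1)
      (fun _ _ j => j.unpair.2) k) ν z (Nat.pair j i)) = Fin.snoc (fun k => V k ν z j) i := by
  ext k
  induction k using Fin.lastCases <;> simp

theorem snoc_mem {n : ℕ} {V : Fin n → Fam} (hV : ∀ i, V i ∈ uniformFam) (k : Fin (n + 1)) :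
    Fin.snoc (α := fun _ => Fam) (fun k ν z j => V k ν z j.unpair.1)
      (fun _ _ j => j.unpair.2) k ∈ uniformFam := by
  induction k using Fin.lastCases with
  | last => simpa using uniformFam.snd uniformFam.small
  | cast k => simpa using uniformFam.fst (hV k)

/-- Every quantified variable is bounded by a length, hence small, and is paired into the small
number `j`. Each quantifier thus raises the exponent `e` for which the matrix must be decided, which
is why `e` is arbitrary in the induction. -/
theorem uniformFam.formula {α : Type} {n : ℕ} {φ : PV.BoundedFormula α n} (h : IsSharplyBounded φ)
    {A : α → Fam} {V : Fin n → Fam} (hA : ∀ a, A a ∈ uniformFam) (hV : ∀ i, V i ∈ uniformFam)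
    (e : ℕ) : ∃ D ∈ uniformFam, ∀ ν z j, (∀ v, z v < 2 ^ ν) → j ≤ (ν + 2) ^ e →
      (D ν z j ≠ 0 ↔ φ.Realize (fun a => A a ν z j) fun i => V i ν z j) := by
  induction h generalizing A e with
  | @atomic n φ h =>
    have hAV : ∀ b, Sum.elim A V b ∈ uniformFam := by
      rintro (a | i)
      · exact hA a
      · exact hV i
    cases h with
    | equal t u =>
      refine ⟨_, pv₂ eqMachine (term t hAV) (term u hAV), fun ν z j _ _ => ?_⟩
      simp only [eqMachine_eval, sumElim_fam]
      rw [BoundedFormula.realize_bdEqual]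
    | rel R ts => exact R.elim
  | falsum =>
    refine ⟨_, pv₁ (constMachine 0) small, fun ν z j _ _ => ?_⟩
    simp [constMachine_eval, BoundedFormula.Realize]
  | imp _ _ ih₁ ih₂ =>
    obtain ⟨D, hD, h⟩ := ih₁ hA hV e
    obtain ⟨E, hE, h'⟩ := ih₂ hA hV e
    refine ⟨_, pv₁ isZeroMachine (pv₂ andNotMachine hD hE), fun ν z j hz hj => ?_⟩
    rw [isZeroMachine_eval, ← not_ne_iff, andNotMachine_eval, BoundedFormula.realize_imp,
      ← h ν z j hz hj, ← h' ν z j hz hj]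
    tauto
  | @ball n φ t _ ih =>
    have hAV : ∀ b, Sum.elim A V b ∈ uniformFam := by
      rintro (a | i)
      · exact hA a
      · exact hV i
    obtain ⟨c, hc⟩ := size_le (term t hAV) e
    obtain ⟨e', he'⟩ := exists_pair_le e c
    obtain ⟨D, hD, h⟩ := ih (fun a => fst (hA a)) (snoc_mem hV) e'
    obtain ⟨F, hF, h'⟩ := search_truth hD (pv₁ lenSym (term t hAV)) c e
      (P := fun ν z j i => ¬ φ.Realize (fun a => A a ν z j) (Fin.snoc (fun k => V k ν z j) i))
      (fun ν z j hz hj => by simpa [lenSym_eval] using hc ν z j hz hj)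
      (fun ν z j i hz hj hi => by
        rw [← not_iff_not, not_not, ← ne_eq, h ν z _ hz (he' ν j i hj hi), snoc_fam]
        simp only [Nat.unpair_pair])
    refine ⟨_, pv₁ isZeroMachine hF, fun ν z j hz hj => ?_⟩
    rw [isZeroMachine_eval, ← not_ne_iff, h' ν z j hz hj, realize_ballF, realize_len_nat]
    simp only [leIn_nat, lenSym_eval, sumElim_fam]
    push Not
    rfl
  | @bex n φ t _ ih =>
    have hAV : ∀ b, Sum.elim A V b ∈ uniformFam := by
      rintro (a | i)
      · exact hA a
      · exact hV i
    obtain ⟨c, hc⟩ := size_le (term t hAV) e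
    obtain ⟨e', he'⟩ := exists_pair_le e c
    obtain ⟨D, hD, h⟩ := ih (fun a => fst (hA a)) (snoc_mem hV) e'
    obtain ⟨F, hF, h'⟩ := search_truth (pv₁ isZeroMachine hD) (pv₁ lenSym (term t hAV)) c e
      (P := fun ν z j i => φ.Realize (fun a => A a ν z j) (Fin.snoc (fun k => V k ν z j) i))
      (fun ν z j hz hj => by simpa [lenSym_eval] using hc ν z j hz hj)
      (fun ν z j i hz hj hi => by
        rw [← not_iff_not, ← ne_eq, isZeroMachine_eval, ← not_iff_not, not_not, ← ne_eq,
          h ν z _ hz (he' ν j i hj hi), snoc_fam]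
        simp only [Nat.unpair_pair])
    refine ⟨_, hF, fun ν z j hz hj => ?_⟩
    rw [h' ν z j hz hj, realize_bexF, realize_len_nat]
    simp only [leIn_nat, lenSym_eval, sumElim_fam]
    rfl

/-! ### Primes that are not separated by uniform families -/

/-! ### Averaging over assignments of values to places -/

section Averaging

open Finset

-- An assignment is determined by its restriction to the other places together with its values at
-- `s` and `t`, so each fibre of the restriction embeds in the set of pairs counted in `h`.
open Classical in
theorem card_le_of_fibers {I P : Type} [Fintype I] [DecidableEq I] [Fintype P] {s t : I}
    (hst : s ≠ t) (S : Finset (I → P)) (m : ℕ)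
    (h : ∀ ρ : I → P, #{pq : P × P | Function.update (Function.update ρ s pq.1) t pq.2 ∈ S} ≤ m) :
    #S ≤ m * Fintype.card P ^ (Fintype.card I - 2) := by
  let f : (I → P) → ({i // i ≠ s ∧ i ≠ t} → P) := fun τ i => τ i
  have hcard : Fintype.card {i // i ≠ s ∧ i ≠ t} = Fintype.card I - 2 := by
    have : (Finset.univ.filter fun i => i ≠ s ∧ i ≠ t) = ({s, t} : Finset I)ᶜ := by
      ext i; simp
    rw [Fintype.card_subtype, this, Finset.card_compl, Finset.card_pair hst]
  calc #S ≤ m * #(S.image f) := by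
        refine Finset.card_le_mul_card_image S m fun b hb => ?_
        obtain ⟨ρ, -, rfl⟩ := Finset.mem_image.1 hb
        refine le_trans ?_ (h ρ)
        refine Finset.card_le_card_of_injOn (fun τ => (τ s, τ t)) ?_ ?_
        · intro τ hτ
          simp only [Finset.coe_filter, Set.mem_ofPred_eq, Finset.mem_univ, true_and] at hτ ⊢
          convert hτ.1
          ext i
          by_cases hit : i = t
          · simp [hit]
          by_cases his : i = s
          · simp [his, hst]
          · simp [hit, his]
            exact (congrFun hτ.2 ⟨i, his, hit⟩).symm
        · intro τ hτ τ' hτ' heq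
          simp only [Finset.coe_filter, Set.mem_ofPred_eq, Prod.mk.injEq] at hτ hτ' heq
          ext i
          by_cases hit : i = t
          · rw [hit, heq.2]
          by_cases his : i = s
          · rw [his, heq.1]
          · exact congrFun (hτ.2.trans hτ'.2.symm) ⟨i, his, hit⟩
    _ ≤ m * Fintype.card P ^ (Fintype.card I - 2) := by
        refine Nat.mul_le_mul_left _ ((Finset.card_le_univ _).trans ?_)
        rw [Fintype.card_fun, hcard]

open Classical in
/-- If every injective assignment is bad at some pair of places, then some partial assignment
becomes bad for a constant fraction of the ways to fill in the two places. -/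
theorem exists_fiber_of_forall_injective {I P ι : Type} [Fintype I] [DecidableEq I] [Fintype P]
    [Fintype ι] (hcard : 2 * Fintype.card I ≤ Fintype.card P) (hP : 0 < Fintype.card P)
    (B : ι → I → I → (I → P) → Prop)
    (h : ∀ τ : I → P, Function.Injective τ → ∃ a s t, s ≠ t ∧ B a s t τ) :
    ∃ a s t, s ≠ t ∧ ∃ ρ : I → P, Fintype.card P ^ 2 ≤
      (2 ^ Fintype.card I * Fintype.card ι * Fintype.card I ^ 2) *
        #{pq : P × P | Function.Injective (Function.update (Function.update ρ s pq.1) t pq.2) ∧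
          B a s t (Function.update (Function.update ρ s pq.1) t pq.2)} := by
  by_contra! hcon
  set N := Fintype.card I
  set p := Fintype.card P
  set K := 2 ^ N * Fintype.card ι * N ^ 2 with hK
  -- There are at least `p / 2` choices for each successive value of an injection, as `2 * N ≤ p`;
  -- so a fraction of at least `1 / 2 ^ N` of all assignments is injective.
  have hinj : p ^ N ≤ 2 ^ N * #{τ : I → P | Function.Injective τ} := by
    have h1 : #{τ : I → P | Function.Injective τ} = p.descFactorial N := by
      rw [← Fintype.card_subtype, Fintype.card_congr (Equiv.subtypeInjectiveEquivEmbedding I P),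
        Fintype.card_embedding_eq]
    rw [h1]
    calc p ^ N ≤ (2 * (p + 1 - N)) ^ N := Nat.pow_le_pow_left (by omega) _
      _ = 2 ^ N * (p + 1 - N) ^ N := mul_pow _ _ _
      _ ≤ _ := Nat.mul_le_mul_left _ (Nat.pow_sub_le_descFactorial _ _)
  have hpos : 0 < p ^ N := by positivity
  obtain ⟨τ₀, hτ₀⟩ : ∃ τ : I → P, Function.Injective τ := by
    obtain ⟨τ, hτ⟩ := Finset.card_pos.1 (Nat.pos_of_mul_pos_left (hpos.trans_le hinj))
    exact ⟨τ, (Finset.mem_filter.1 hτ).2⟩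
  obtain ⟨a₀, s₀, t₀, hst₀, -⟩ := h τ₀ hτ₀
  have hN : 2 ≤ N := Fintype.one_lt_card_iff.2 ⟨s₀, t₀, hst₀⟩
  have hKpos : 0 < K := by
    have : 0 < Fintype.card ι := Fintype.card_pos_iff.2 ⟨a₀⟩
    positivity
  -- The largest fibre size `m` with `K * m < p ^ 2`.
  set m := (p ^ 2 - 1) / K
  have hm : K * m ≤ p ^ 2 - 1 := Nat.mul_div_le _ _
  let S : ι × I × I → Finset (I → P) := fun x =>
    {τ | x.2.1 ≠ x.2.2 ∧ Function.Injective τ ∧ B x.1 x.2.1 x.2.2 τ}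
  have hS : ∀ x, #(S x) ≤ m * p ^ (N - 2) := by
    rintro ⟨a, s, t⟩
    by_cases hst : s = t
    · simp [S, hst]
    · refine card_le_of_fibers hst _ m fun ρ => ?_
      rw [Nat.le_div_iff_mul_le hKpos, mul_comm]
      refine Nat.le_sub_one_of_lt (lt_of_le_of_lt ?_ (hcon a s t hst ρ))
      refine Nat.mul_le_mul_left _ (Finset.card_le_card fun pq => ?_)
      simp [S]
  have hsub : ({τ | Function.Injective τ} : Finset (I → P)) ⊆ Finset.univ.biUnion S := by
    intro τ hτ
    obtain ⟨a, s, t, hst, hB⟩ := h τ (Finset.mem_filter.1 hτ).2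
    exact Finset.mem_biUnion.2 ⟨(a, s, t), by simp, by
      simp only [S, Finset.mem_filter, Finset.mem_univ, true_and]
      exact ⟨hst, (Finset.mem_filter.1 hτ).2, hB⟩⟩
  have h2 := (Finset.card_le_card hsub).trans
    (Finset.card_biUnion_le_card_mul _ _ _ fun x _ => hS x)
  rw [Finset.card_univ, Fintype.card_prod, Fintype.card_prod] at h2
  -- Union bound over the index in `ι` and the two places.
  have h3 : p ^ N ≤ (K * m) * p ^ (N - 2) := by
    refine hinj.trans ((Nat.mul_le_mul_left _ h2).trans (le_of_eq ?_))
    rw [hK]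
    ring
  have h4 : p ^ N = p ^ 2 * p ^ (N - 2) := by rw [← pow_add]; congr 1; omega
  rw [h4] at h3
  have h5 := Nat.le_of_mul_le_mul_right h3 (by positivity)
  have : 0 < p ^ 2 := by positivity
  omega

end Averaging

/-! ### Products of primes indexed by the cube -/

/-- Whether the factor at the place `s` occurs in the `v`-th product. -/
def inPart {u : ℕ} : ℕ → (Fin u → Bool) → Bool
  | 0, _ => true
  | v + 1, s => if h : v < u then s ⟨v, h⟩ else false

/-- The product of all `τ s`, and, for each coordinate, of those `τ s` for which this coordinate of
`s` is true. -/
def partProd {u : ℕ} (τ : (Fin u → Bool) → ℕ) (v : ℕ) : ℕ := ∏ s, if inPart v s then τ s else 1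

theorem inPart_congr {u k v : ℕ} {s t : Fin u → Bool} (h : ∀ i : Fin u, (i : ℕ) < k → s i = t i)
    (hv : v < k + 1) : inPart v s = inPart v t := by
  rcases v with _ | v
  · rfl
  · simp only [inPart]
    split_ifs with hu
    · exact h ⟨v, hu⟩ (by simp; omega)
    · rfl

/-- If the coordinate in question does not distinguish `s` from `t`, then `p` and `q` enter the
product together or not at all. The factoring circuit can therefore form it without knowing them
separately. -/
theorem partProd_update {u v : ℕ} (ρ : (Fin u → Bool) → ℕ) {s t : Fin u → Bool} (hst : s ≠ t)
    (p q : ℕ) (h : inPart v s = inPart v t) :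
    partProd (Function.update (Function.update ρ s p) t q) v =
      (∏ i ∈ (Finset.univ.erase s).erase t, if inPart v i then ρ i else 1) *
        if inPart v s then p * q else 1 := by
  rw [partProd, ← Finset.mul_prod_erase _ _ (Finset.mem_univ s),
    ← Finset.mul_prod_erase (Finset.univ.erase s) _ (a := t) (by simp [hst.symm]), ← h,
    ← mul_assoc, mul_comm]
  congr 1
  · refine Finset.prod_congr rfl fun i hi => ?_
    simp only [Finset.mem_erase] at hi
    rw [Function.update_of_ne hi.1, Function.update_of_ne hi.2.1]
  · rw [Function.update_of_ne hst, Function.update_self, Function.update_self]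
    split_ifs <;> simp

/-- The `2 ^ u - 2` remaining factors leave room for the `2 * n` bits of a circuit input within `2 ^
u * n` bits. -/
theorem prod_erase_erase_le {u n v : ℕ} (ρ : (Fin u → Bool) → ℕ) {s t : Fin u → Bool}
    (hst : s ≠ t) (hρ : ∀ i, ρ i < 2 ^ n) :
    (∏ i ∈ (Finset.univ.erase s).erase t, if inPart v i then ρ i else 1) * 2 ^ (2 * n) ≤
      2 ^ (2 ^ u * n) := by
  have h1 : (∏ i ∈ (Finset.univ.erase s).erase t, if inPart v i then ρ i else 1) ≤
      ∏ _i ∈ (Finset.univ.erase s).erase t, 2 ^ n := by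
    refine Finset.prod_le_prod' fun i _ => ?_
    split_ifs
    · exact (hρ i).le
    · exact Nat.one_le_two_pow
  have hcard : ((Finset.univ.erase s).erase t).card + 2 = 2 ^ u := by
    have h1 := Finset.card_erase_add_one (Finset.mem_univ s)
    have h2 := Finset.card_erase_add_one (s := Finset.univ.erase s) (a := t) (by simp [hst.symm])
    have h3 : (Finset.univ : Finset (Fin u → Bool)).card = 2 ^ u := by simp
    omega
  calc _ ≤ _ := Nat.mul_le_mul_right _ h1
    _ = _ := by rw [Finset.prod_const, ← pow_mul, ← pow_add, ← hcard]; congr 1; ring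

theorem eq_or_eq_of_dvd_mul_primes {p q d : ℕ} (hp : p.Prime) (hq : q.Prime) (h : d ∣ p * q)
    (h1 : 1 < d) (hlt : d < p * q) : d = p ∨ d = q := by
  obtain ⟨a, b, ha, hb, rfl⟩ := exists_dvd_and_dvd_of_dvd_mul h
  rcases (Nat.dvd_prime hp).1 ha with rfl | rfl <;>
    rcases (Nat.dvd_prime hq).1 hb with rfl | rfl <;>
    simp at *

/-- A uniform family that separates two primes yields small circuits that factor their product. -/
theorem exists_factoring_circuits {g : Fam} (hg : g ∈ uniformFam) (u k : ℕ)
    (hk : DependsOn g (k + 1)) : ∃ Q : ℕ → ℕ, PolyBdd Q ∧ ∀ n, ∀ s t : Fin u → Bool, s ≠ t →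
      (∀ i : Fin u, (i : ℕ) < k → s i = t i) → ∀ ρ : (Fin u → Bool) → ℕ, (∀ i, ρ i < 2 ^ n) →
      ∃ C : Circuit (2 * n) n, C.size ≤ Q n ∧ ∀ p q, p.Prime → q.Prime → p % 2 = 1 → q % 2 = 1 →
        p < 2 ^ n → q < 2 ^ n →
        (∃ j ≤ (2 ^ u * n + 2) ^ u,
          p ∣ g (2 ^ u * n) (partProd (Function.update (Function.update ρ s p) t q)) j ∧
          ¬ q ∣ g (2 ^ u * n) (partProd (Function.update (Function.update ρ s p) t q)) j) →
        C.evalNat (p * q) = p ∨ C.evalNat (p * q) = q := by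
  -- The family `g` does not depend on the variable `k + 1`, so this variable is free to carry the
  -- number to be factored. The search runs over the small numbers for a value of `g` whose gcd with
  -- it is a proper divisor.
  have hF := uniformFam.search u (uniformFam.snd (uniformFam.pv₂ properMachine
    (uniformFam.pv₂ gcdMachine hg (uniformFam.var (k + 1))) (uniformFam.var (k + 1))))
  set F : Fam := fun ν z j => firstNonzero (fun i =>
    (fun ν z j => properMachine.eval ![gcdMachine.eval ![g ν z j, z (k + 1)], z (k + 1)] : Fam)
      ν z (Nat.unpair (Nat.pair j i)).2) ((ν + 2) ^ u) with hFdef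
  obtain ⟨k', c, d, -, h⟩ := uniformFam.feasible hF
  let Q₀ : ℕ → ℕ := fun ν => k' * (ν + (ν + 1) * (ν * 42 + 2)) + (ν + 2) ^ d
  have hQ₀ : PolyBdd Q₀ :=
    ((PolyBdd.const k').mul (PolyBdd.id.add ((PolyBdd.id.add (.const 1)).mul
      ((PolyBdd.id.mul (.const 42)).add (.const 2))))).add ((PolyBdd.id.add (.const 2)).pow d)
  refine ⟨fun n => Q₀ (2 ^ u * n) + n,
    (hQ₀.comp ((PolyBdd.const _).mul .id)).add .id, fun n s t hst hagree ρ hρ => ?_⟩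
  set ν := 2 ^ u * n with hν
  let cst : ℕ → ℕ := fun v =>
    ∏ i ∈ (Finset.univ.erase s).erase t, if inPart v i then ρ i else 1
  have hcst : ∀ v, cst v * 2 ^ (2 * n) ≤ 2 ^ ν := fun v => prod_erase_erase_le ρ hst hρ
  -- The circuit input stands for `p * q`, and `cst v` collects the hard-wired primes. On inputs of
  -- any other kind only the bound by `2 ^ ν` matters.
  let Z : (Fin (2 * n) → Bool) → ℕ → ℕ := fun x v =>
    if v < k + 1 then (if inPart v s then cst v * ofDigits₂ x else cst v)
    else if v = k + 1 then ofDigits₂ x else 0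
  by_cases hn : n = 0
  -- There are no primes below `2 ^ 0`.
  · refine ⟨⟨[], fun _ => 0⟩, Nat.zero_le _, fun p q hp _ _ _ hlt => ?_⟩
    have := hp.two_le
    simp [hn] at hlt
    omega
  have h2n : 2 ^ (2 * n) ≤ 2 ^ ν := Nat.pow_le_pow_right (by omega) (Nat.mul_le_mul_right n (by
    rcases u with _ | u
    · exact absurd (Subsingleton.elim s t) hst
    · rw [pow_succ]; have := Nat.one_le_two_pow (n := u); omega))
  have hZ : ∀ x, ∀ v < k', Z x v < 2 ^ ν := by
    intro x v _
    have hx := ofDigits₂_lt x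
    have hpos : 1 < 2 ^ (2 * n) := Nat.one_lt_two_pow (by omega)
    have := hcst v
    simp only [Z]
    split_ifs
    · rcases Nat.eq_zero_or_pos (cst v) with h0 | h0
      · rw [h0]; simp
      · exact (Nat.mul_lt_mul_of_pos_left hx h0).trans_le this
    · rcases Nat.eq_zero_or_pos (cst v) with h0 | h0
      · rw [h0]; positivity
      · exact lt_of_lt_of_le (by nlinarith) this
    · omega
    · positivity
  obtain ⟨h1, h2⟩ := h ν 0 _ Z hZ
  have hin : Cost (bits (2 * n) ofDigits₂) (k' * (ν + (ν + 1) * (ν * 42 + 2)))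
      (inputBits k' ν Z) := by
    have := Cost.biUnion (Γ := bits (2 * n) ofDigits₂) (Finset.range k')
      (D := fun v => bits ν fun x => Z x v) (s := ν + (ν + 1) * (ν * 42 + 2)) fun v hv => ?_
    · simpa [inputBits] using this
    have hext := Cost.bits_extend (Γ := bits (2 * n) ofDigits₂) (A := ofDigits₂) subset_rfl
      ofDigits₂_lt ν
    simp only [Z]
    split_ifs
    · have hsz : (cst v).size ≤ ν := by
        have hpos : 1 < 2 ^ (2 * n) := Nat.one_lt_two_pow (by omega)
        have := hcst v
        rcases Nat.eq_zero_or_pos (cst v) with h0 | h0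
        · simp [h0]
        · exact Nat.size_le.2 (lt_of_lt_of_le (by nlinarith) this)
      refine (hext.comp (Cost.constMul subset_rfl (cst v))).le ?_
      gcongr
    · exact (Cost.bits_const _ ν).le (by omega)
    · exact hext.le (by omega)
    · exact (Cost.bits_const _ ν).le (by omega)
  have hcost := (hin.comp h2).comp (Cost.bits_extend subset_rfl h1 n)
  obtain ⟨C, hC, hCe⟩ := hcost.exists_circuit
  refine ⟨C, hC, fun p q hp hq hp2 hq2 hpn hqn ⟨j, hj, hpj, hqj⟩ => ?_⟩
  have hpq : p * q < 2 ^ (2 * n) := by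
    rw [two_mul, pow_add]
    exact Nat.mul_lt_mul'' hpn hqn
  rw [hCe _ hpq]
  set x : Fin (2 * n) → Bool := fun i => (p * q).testBit i with hx
  have hxv : ofDigits₂ x = p * q := ofDigits₂_testBit hpq
  set τ := Function.update (Function.update ρ s p) t q with hτ
  have hZτ : ∀ v < k + 1, Z x v = partProd τ v := by
    intro v hv
    rw [hτ, partProd_update ρ hst p q (inPart_congr hagree hv)]
    simp only [Z, if_pos hv, hxv, cst]
    split_ifs <;> simp
  have hgτ : ∀ j, g ν (Z x) j = g ν (partProd τ) j := fun j => hk _ _ _ _ hZτ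
  have hZk : Z x (k + 1) = p * q := by simp [Z, hxv]
  have hval : F ν (Z x) 0 = firstNonzero (fun i => if 1 < Nat.gcd (g ν (partProd τ) i) (p * q) ∧
      Nat.gcd (g ν (partProd τ) i) (p * q) < p * q then Nat.gcd (g ν (partProd τ) i) (p * q) else 0)
      ((ν + 2) ^ u) := by
    have hodd : p * q % 2 = 1 := by rw [Nat.mul_mod, hp2, hq2]
    simp only [hFdef, Nat.unpair_pair, hZk, hgτ, gcdMachine_eval _ _ hodd, properMachine_eval]
  have hne : F ν (Z x) 0 ≠ 0 := by
    rw [hval]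
    have hpg := Nat.dvd_gcd hpj (Dvd.intro q rfl)
    have hpos : 0 < p * q := Nat.mul_pos hp.pos hq.pos
    have hg1 := Nat.le_of_dvd (Nat.gcd_pos_of_pos_right _ hpos) hpg
    have hg2 := hp.one_lt
    -- The gcd is a multiple of `p`; it is not `p * q`, since `q` does not divide the value of `g`.
    have hlt : Nat.gcd (g ν (partProd τ) j) (p * q) < p * q :=
      lt_of_le_of_ne (Nat.gcd_le_right _ hpos) fun heq =>
        hqj ((Dvd.intro_left p rfl).trans (heq ▸ Nat.gcd_dvd_left _ _))
    refine firstNonzero_ne_zero hj ?_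
    rw [if_pos ⟨by omega, hlt⟩]
    omega
  obtain ⟨i, -, hi⟩ := firstNonzero_eq (fun i => if 1 < Nat.gcd (g ν (partProd τ) i) (p * q) ∧
      Nat.gcd (g ν (partProd τ) i) (p * q) < p * q then Nat.gcd (g ν (partProd τ) i) (p * q) else 0)
      ((ν + 2) ^ u)
  rw [← hval] at hi
  have hif : 1 < Nat.gcd (g ν (partProd τ) i) (p * q) ∧
      Nat.gcd (g ν (partProd τ) i) (p * q) < p * q := by
    by_contra hcon
    rw [if_neg hcon] at hi
    exact hne hi
  rw [if_pos hif] at hi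
  -- The search may stop at an index other than `j`, but any proper divisor of `p * q` is one of the
  -- two primes.
  rcases eq_or_eq_of_dvd_mul_primes hp hq (Nat.gcd_dvd_right _ _) hif.1 hif.2 with heq | heq
  · left
    rw [hi, heq, Nat.mod_eq_of_lt hpn]
  · right
    rw [hi, heq, Nat.mod_eq_of_lt hqn]

theorem exists_const_circuit (n a : ℕ) (ha : a < 2 ^ n) :
    ∃ C : Circuit (2 * n) n, C.size ≤ n ∧ ∀ N < 2 ^ (2 * n), C.evalNat N = a := by
  obtain ⟨C, hC, h⟩ := (Cost.bits_const (Γ := bits (2 * n) ofDigits₂) a n).exists_circuit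
  exact ⟨C, hC, fun N hN => by rw [h N hN, Nat.mod_eq_of_lt ha]⟩

/-! ### From hardness of factoring to unseparated primes -/

theorem mem_primesOfLength {n p : ℕ} : p ∈ primesOfLength n ↔ p < 2 ^ n ∧ p.Prime ∧ p.size = n := by
  simp [primesOfLength]

theorem mul_lt_of_mem_primesOfLength {n p q : ℕ} (hp : p ∈ primesOfLength n)
    (hq : q ∈ primesOfLength n) : p * q < 2 ^ (2 * n) := by
  rw [two_mul, pow_add]
  exact Nat.mul_lt_mul'' (mem_primesOfLength.1 hp).1 (mem_primesOfLength.1 hq).1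

/-- The prime `2` has length `2`, and the only other prime of that length is `3`. -/
theorem odd_of_mem_primesOfLength {n p : ℕ} (hn : 2 < (primesOfLength n).card)
    (hp : p ∈ primesOfLength n) : p % 2 = 1 := by
  obtain ⟨-, hp, hs⟩ := mem_primesOfLength.1 hp
  rcases hp.eq_two_or_odd with rfl | h
  · obtain rfl : n = 2 := by rw [← hs]; rfl
    have : primesOfLength 2 ⊆ {2, 3} := by
      intro q hq
      obtain ⟨hlt, hq, -⟩ := mem_primesOfLength.1 hq
      have := hq.two_le
      simp
      omega
    have := Finset.card_le_card this
    simp at this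
    omega
  · exact h

/-- The success probability is at least `1 / K` if a fraction `1 / K` of the pairs is factored. -/
theorem le_factoringProb {n K : ℕ} {C : Circuit (2 * n) n} (hP : (primesOfLength n).Nonempty)
    (h : (primesOfLength n).card ^ 2 ≤ K * (Finset.card
      {pq ∈ primesOfLength n ×ˢ primesOfLength n |
        C.evalNat (pq.1 * pq.2) = pq.1 ∨ C.evalNat (pq.1 * pq.2) = pq.2})) {r : ℝ}
    (hr : r * K ≤ 1) (hr0 : 0 < r) : r ≤ factoringProb n C := by
  have hpos : (0 : ℝ) < ((primesOfLength n).card : ℝ) ^ 2 := by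
    have := Finset.card_pos.2 hP
    positivity
  rw [factoringProb, Finset.card_product, Nat.cast_mul, ← sq, le_div_iff₀ hpos]
  set S := (Finset.card {pq ∈ primesOfLength n ×ˢ primesOfLength n |
        C.evalNat (pq.1 * pq.2) = pq.1 ∨ C.evalNat (pq.1 * pq.2) = pq.2}) with hS
  have h' : ((primesOfLength n).card : ℝ) ^ 2 ≤ K * S := by exact_mod_cast h
  calc r * ((primesOfLength n).card : ℝ) ^ 2 ≤ r * (K * S) := by gcongr
    _ = (r * K) * S := by ring
    _ ≤ 1 * S := by gcongr
    _ = S := one_mul _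

/-- The primes `τ s` are not separated by the first `u` families. -/
def Unseparated (G : ℕ → Fam) (u n : ℕ) (τ : (Fin u → Bool) → ℕ) : Prop :=
  ∀ e < u, ∀ k < u, DependsOn (G e) (k + 1) → ∀ j ≤ (2 ^ u * n + 2) ^ u, ∀ s t : Fin u → Bool,
    (∀ i : Fin u, (i : ℕ) < k → s i = t i) →
      τ s ∣ G e (2 ^ u * n) (partProd τ) j → τ t ∣ G e (2 ^ u * n) (partProd τ) j

/-- Otherwise, at every length `n` with enough primes, averaging fixes a family, a level `k`, two
places and the other primes such that a constant fraction of the pairs `p, q` is separated, hence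
factored. Only `u ^ 2` combinations of family and level occur, so one polynomial bounds all the
circuits, and they contradict the hypothesis for a suitable constant `r`. -/
theorem exists_unseparated
    (hard : ∀ r : ℝ, 0 < r → ∀ C : (n : ℕ) → Circuit (2 * n) n,
      (∃ P : Polynomial ℕ, ∀ n, (C n).size ≤ P.eval n) →
        ∃ n, (primesOfLength n).Nonempty ∧ factoringProb n (C n) < r)
    (G : ℕ → Fam) (hG : ∀ e, G e ∈ uniformFam) (u : ℕ) :
    ∃ (n : ℕ) (τ : (Fin u → Bool) → ℕ), Function.Injective τ ∧
      (∀ s, (τ s).Prime ∧ τ s % 2 = 1 ∧ τ s < 2 ^ n) ∧ Unseparated G u n τ := by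
  classical
  by_contra! hcon
  -- The size bound is chosen before `n`, the places and the other primes. The dependence condition
  -- is placed behind it so that `Q` exists for all pairs `e, k`.
  have hQ : ∀ e k : Fin u, ∃ Q : ℕ → ℕ, PolyBdd Q ∧ (DependsOn (G e) (k + 1) →
      ∀ n, ∀ s t : Fin u → Bool, s ≠ t →
      (∀ i : Fin u, (i : ℕ) < k → s i = t i) → ∀ ρ : (Fin u → Bool) → ℕ, (∀ i, ρ i < 2 ^ n) →
      ∃ C : Circuit (2 * n) n, C.size ≤ Q n ∧ ∀ p q, p.Prime → q.Prime → p % 2 = 1 → q % 2 = 1 →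
        p < 2 ^ n → q < 2 ^ n →
        (∃ j ≤ (2 ^ u * n + 2) ^ u,
          p ∣ G e (2 ^ u * n) (partProd (Function.update (Function.update ρ s p) t q)) j ∧
          ¬ q ∣ G e (2 ^ u * n) (partProd (Function.update (Function.update ρ s p) t q)) j) →
        C.evalNat (p * q) = p ∨ C.evalNat (p * q) = q) := by
    intro e k
    by_cases hd : DependsOn (G e) (k + 1)
    · obtain ⟨Q, h, h'⟩ := exists_factoring_circuits (hG e) u k hd
      exact ⟨Q, h, fun _ => h'⟩
    · exact ⟨fun _ => 0, .const 0, fun h => absurd h hd⟩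
  choose Q hQ hC using hQ
  have hQsum : PolyBdd fun n => n + ∑ e, ∑ k, Q e k n :=
    PolyBdd.id.add (PolyBdd.sum fun e => PolyBdd.sum fun k => hQ e k)
  have hQle : ∀ e k n, Q e k n ≤ n + ∑ e, ∑ k, Q e k n := fun e k n =>
    (Finset.single_le_sum (f := fun k => Q e k n) (by simp) (Finset.mem_univ k)).trans
      ((Finset.single_le_sum (f := fun e => ∑ k, Q e k n) (by simp) (Finset.mem_univ e)).trans
        (Nat.le_add_left _ _))
  set N := 2 ^ u with hN
  set K := 2 ^ N * Fintype.card (Fin u × Fin u) * N ^ 2 with hK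
  -- Large enough for both cases below: `K` comes from averaging, and `2 * N + 3` exceeds the number
  -- of primes when there are too few of them for averaging.
  set L := K + 2 * N + 3 with hL
  have hr0 : (0 : ℝ) < 1 / L := by positivity
  have hrL : ∀ K' ≤ L, (1 / L : ℝ) * K' ≤ 1 := by
    intro K' hK'
    have : (K' : ℝ) ≤ L := by exact_mod_cast hK'
    rw [one_div, inv_mul_le_iff₀ (by positivity)]
    simpa
  have main : ∀ n, ∃ C : Circuit (2 * n) n, C.size ≤ n + ∑ e, ∑ k, Q e k n ∧
      ((primesOfLength n).Nonempty → (1 / L : ℝ) ≤ factoringProb n C) := by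
    intro n
    by_cases hne : (primesOfLength n).Nonempty
    swap
    · exact ⟨⟨[], fun _ => 0⟩, Nat.zero_le _, fun h => absurd h hne⟩
    by_cases hsmall : (primesOfLength n).card < 2 * N + 3
    · obtain ⟨p₀, hp₀⟩ := hne
      -- With a bounded number of primes, always answering `p₀` succeeds with at least constant
      -- probability.
      obtain ⟨C, hC, h⟩ := exists_const_circuit n p₀ (mem_primesOfLength.1 hp₀).1
      refine ⟨C, hC.trans (Nat.le_add_right _ _), fun hne =>
        le_factoringProb (K := (primesOfLength n).card) hne ?_ (hrL _ (by omega)) hr0⟩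
      rw [sq]
      refine Nat.mul_le_mul_left _ (Finset.card_le_card_of_injOn (fun q => (p₀, q)) ?_ ?_)
      · intro q hq
        simp only [Finset.mem_coe] at hq
        simp only [Finset.coe_filter, Finset.mem_product, Set.mem_ofPred_eq]
        exact ⟨⟨hp₀, hq⟩, .inl (h _ (mul_lt_of_mem_primesOfLength hp₀ hq))⟩
      · intro q _ q' _ h
        exact congrArg Prod.snd h
    · have hodd : ∀ p ∈ primesOfLength n, p % 2 = 1 := fun p hp =>
        odd_of_mem_primesOfLength (by omega) hp
      let P := {p // p ∈ primesOfLength n}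
      have hcardP : Fintype.card P = (primesOfLength n).card := Fintype.card_coe _
      have hcardI : Fintype.card (Fin u → Bool) = N := by simp [hN]
      obtain ⟨⟨e, k⟩, s, t, hst, ρ, hρ⟩ := exists_fiber_of_forall_injective (I := Fin u → Bool)
        (P := P) (ι := Fin u × Fin u) (by omega) (by omega)
        (fun ek s t τ => DependsOn (G ek.1) (ek.2 + 1) ∧
          (∀ i : Fin u, (i : ℕ) < ek.2 → s i = t i) ∧ ∃ j ≤ (N * n + 2) ^ u,
            (τ s : ℕ) ∣ G ek.1 (N * n) (partProd fun i => (τ i : ℕ)) j ∧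
            ¬ (τ t : ℕ) ∣ G ek.1 (N * n) (partProd fun i => (τ i : ℕ)) j) (by
          intro τ hτ
          have := hcon n (fun i => (τ i : ℕ)) (Subtype.val_injective.comp hτ) fun s => by
            obtain ⟨h1, h2, -⟩ := mem_primesOfLength.1 (τ s).2
            exact ⟨h2, hodd _ (τ s).2, h1⟩
          simp only [Unseparated] at this
          push Not at this
          obtain ⟨e, he, k, hk, hd, j, hj, s, t, hst, h1, h2⟩ := this
          refine ⟨(⟨e, he⟩, ⟨k, hk⟩), s, t, ?_, hd, hst, j, hj, h1, h2⟩
          rintro rfl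
          exact h2 h1)
      rw [hcardP, hcardI, ← hK] at hρ
      have hpos : 0 < (primesOfLength n).card ^ 2 := by
        have := Finset.card_pos.2 hne
        positivity
      -- One bad pair suffices to learn the conditions on `e`, `k`, `s` and `t`, which do not
      -- involve the primes.
      obtain ⟨⟨p, q⟩, hpq⟩ := Finset.card_pos.1 (Nat.pos_of_mul_pos_left (hpos.trans_le hρ))
      simp only [Finset.mem_filter, Finset.mem_univ, true_and] at hpq
      obtain ⟨-, hd, hagree, -⟩ := hpq
      obtain ⟨C, hCs, hCe⟩ := hC e k hd n s t hst hagree (fun i => (ρ i : ℕ)) fun i =>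
        (mem_primesOfLength.1 (ρ i).2).1
      refine ⟨C, hCs.trans (hQle e k n), fun hne =>
        le_factoringProb (K := K) hne (hρ.trans ?_) (hrL _ (by omega)) hr0⟩
      refine Nat.mul_le_mul_left _ (Finset.card_le_card_of_injOn
        (fun pq => ((pq.1 : ℕ), (pq.2 : ℕ))) ?_ ?_)
      · rintro ⟨p, q⟩ hpq
        simp only [Finset.coe_filter, Finset.mem_univ, true_and, Set.mem_ofPred_eq] at hpq
        obtain ⟨-, -, -, j, hj, h1, h2⟩ := hpq
        have hup : (fun i => ((Function.update (Function.update ρ s p) t q i : P) : ℕ)) =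
            Function.update (Function.update (fun i => (ρ i : ℕ)) s p) t q := by
          ext i
          by_cases hit : i = t
          · subst hit; simp
          by_cases his : i = s
          · subst his; simp [hst]
          · simp [hit, his]
        rw [hup] at h1 h2
        simp only [Function.update_of_ne hst, Function.update_self] at h1 h2
        simp only [Finset.coe_filter, Finset.mem_product, Set.mem_ofPred_eq]
        obtain ⟨hp1, hp2, -⟩ := mem_primesOfLength.1 p.2
        obtain ⟨hq1, hq2, -⟩ := mem_primesOfLength.1 q.2
        exact ⟨⟨p.2, q.2⟩, hCe p q hp2 hq2 (hodd _ p.2) (hodd _ q.2) hp1 hq1 ⟨j, hj, h1, h2⟩⟩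
      · rintro ⟨p, q⟩ _ ⟨p', q'⟩ _ h
        simp only [Prod.mk.injEq] at h
        exact Prod.ext (Subtype.ext h.1) (Subtype.ext h.2)
  choose C hCs hCp using main
  obtain ⟨c, hc⟩ := hQsum
  obtain ⟨n, hne, hlt⟩ := hard (1 / L) hr0 C ⟨(Polynomial.X + 2) ^ c, fun n => by
    simpa using (hCs n).trans (hc n)⟩
  exact absurd (hCp n hne) (not_le.2 hlt)

/-! ### The model generated by a sequence of instances -/

open Filter

/-- The ultrapower of the standard model. -/
abbrev Ultrapower : Type := ((hyperfilter ℕ : Ultrafilter ℕ) : Filter ℕ).Product fun _ => ℕ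

/-- The element of the ultrapower represented by a sequence. -/
noncomputable def germ (f : ℕ → ℕ) : Ultrapower := ((f : (_ : ℕ) → ℕ) : Ultrapower)

theorem germ_eq {f g : ℕ → ℕ} : germ f = germ g ↔ ∀ᶠ u in (hyperfilter ℕ : Filter ℕ), f u = g u :=
  Quotient.eq''

/-- A sequence of instances for the variables of uniform families. -/
structure Instances where
  /-- The size parameter. -/
  ν : ℕ → ℕ
  /-- The members of the sequence of numbers. -/
  z : ℕ → ℕ → ℕ
  lt : ∀ u v, z u v < 2 ^ ν u

namespace Instances

variable (D : Instances)

/-- Bounds for small numbers. -/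
def IsSmall (c : ℕ) (j : ℕ → ℕ) : Prop := ∀ u, j u ≤ (D.ν u + 2) ^ c

/-- The values of a uniform family. -/
def val (g : Fam) (j : ℕ → ℕ) : ℕ → ℕ := fun u => g (D.ν u) (D.z u) (j u)

/-- The sequences of the values of a uniform family. -/
def IsVal (f : ℕ → ℕ) : Prop := ∃ g ∈ uniformFam, ∃ c j, D.IsSmall c j ∧ f = D.val g j

variable {D}

theorem isSmall_pair {c c' : ℕ} {j i : ℕ → ℕ} (hj : D.IsSmall c j) (hi : D.IsSmall c' i) :
    ∃ e, D.IsSmall e fun u => Nat.pair (j u) (i u) := by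
  obtain ⟨e, he⟩ := exists_pair_le c c'
  exact ⟨e, fun u => he _ _ _ (hj u) (hi u)⟩

/-- Finitely many values can be given by the same small numbers. -/
theorem exists_common {k : ℕ} {f : Fin k → ℕ → ℕ} (hf : ∀ a, D.IsVal (f a)) :
    ∃ c j, D.IsSmall c j ∧ ∃ g : Fin k → Fam, (∀ a, g a ∈ uniformFam) ∧
      ∀ a, f a = D.val (g a) j := by
  induction k with
  | zero => exact ⟨0, fun _ => 0, fun _ => Nat.zero_le _, Fin.elim0, fun a => a.elim0,
      fun a => a.elim0⟩
  | succ k ih =>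
    obtain ⟨c, j, hj, g, hg, h⟩ := ih fun a => hf a.castSucc
    obtain ⟨g', hg', c', j', hj', h'⟩ := hf (Fin.last k)
    obtain ⟨e, he⟩ := isSmall_pair hj hj'
    refine ⟨e, _, he, Fin.snoc (α := fun _ => Fam) (fun a ν z j => g a ν z j.unpair.1)
      (fun ν z j => g' ν z j.unpair.2), fun a => ?_, fun a => ?_⟩
    · induction a using Fin.lastCases with
      | last => simpa using uniformFam.snd hg'
      | cast a => simpa using uniformFam.fst (hg a)
    · induction a using Fin.lastCases with
      | last => simp [h']; ext u; simp [val]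
      | cast a => simp [h]; ext u; simp [val]

theorem IsVal.eval {k : ℕ} (F : ClockedMachine) {f : Fin k → ℕ → ℕ} (hf : ∀ a, D.IsVal (f a)) :
    D.IsVal fun u => F.eval fun a => f a u := by
  obtain ⟨c, j, hj, g, hg, h⟩ := exists_common hf
  refine ⟨_, uniformFam.pv F hg, c, j, hj, ?_⟩
  ext u
  simp only [h, val]

/-- No uniformity is required of the sequence `j`. Hence stagewise counterexamples of small
magnitude always define elements of the model, which is used both for Łoś's theorem and for the
choice scheme. -/
theorem IsVal.small {c : ℕ} {j : ℕ → ℕ} (hj : D.IsSmall c j) : D.IsVal j :=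
  ⟨_, uniformFam.small, c, j, hj, rfl⟩

theorem IsVal.z (v : ℕ) : D.IsVal fun u => D.z u v :=
  ⟨_, uniformFam.var v, 0, fun _ => 0, fun _ => Nat.zero_le _, rfl⟩

/-- Lengths of elements are small, so sharply bounded quantifiers range over small numbers. -/
theorem IsVal.size_le {f : ℕ → ℕ} (hf : D.IsVal f) : ∃ c, ∀ u, (f u).size ≤ (D.ν u + 2) ^ c := by
  obtain ⟨g, hg, e, j, hj, rfl⟩ := hf
  obtain ⟨c, hc⟩ := uniformFam.size_le hg e
  exact ⟨c, fun u => hc _ _ _ (D.lt u) (hj u)⟩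

theorem IsVal.term {β : Type} (t : PV.Term β) {f : β → ℕ → ℕ} (hf : ∀ b, D.IsVal (f b)) :
    D.IsVal fun u => t.realize fun b => f b u := by
  induction t with
  | var b => exact hf b
  | func F ts ih => exact IsVal.eval F ih

variable (D)

/-- The model consisting of the values of uniform families. -/
def model : PV.Substructure Ultrapower where
  carrier := {q | ∃ f, D.IsVal f ∧ germ f = q}
  fun_mem {n} F x hx := by
    choose f hf h using hx
    refine ⟨_, IsVal.eval F hf, ?_⟩
    obtain rfl : (fun a => germ (f a)) = x := funext h
    exact (Ultraproduct.funMap_cast (L := PV) (M := fun _ : ℕ => ℕ) F f).symm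

/-- `f` is a sequence of values that represents `a`. -/
def Reps (f : ℕ → ℕ) (a : D.model) : Prop := D.IsVal f ∧ germ f = a

variable {D}

theorem exists_reps (a : D.model) : ∃ f, D.Reps f a := a.2

theorem IsVal.exists_reps {f : ℕ → ℕ} (hf : D.IsVal f) : ∃ a : D.model, D.Reps f a :=
  ⟨⟨germ f, f, hf, rfl⟩, hf, rfl⟩

theorem Reps.funMap {k : ℕ} (F : PV.Functions k) {f : Fin k → ℕ → ℕ} {a : Fin k → D.model}
    (h : ∀ i, D.Reps (f i) (a i)) :
    D.Reps (fun u => ClockedMachine.eval F fun i => f i u) (Structure.funMap F a) := by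
  refine ⟨IsVal.eval F fun i => (h i).1, ?_⟩
  have h' : (fun i => germ (f i)) = fun i => (a i : Ultrapower) := funext fun i => (h i).2
  have := Ultraproduct.funMap_cast (L := PV) (u := hyperfilter ℕ) (M := fun _ : ℕ => ℕ) F f
  refine this.symm.trans ?_
  exact congrArg (Structure.funMap F) h'

theorem reps_forall₁ {f : ℕ → ℕ} {a : D.model} (h : D.Reps f a) (i : Fin 1) :
    D.Reps ((![f] : Fin 1 → ℕ → ℕ) i) ((![a] : Fin 1 → D.model) i) := by
  fin_cases i; exact h

theorem reps_forall₂ {f g : ℕ → ℕ} {a b : D.model} (h : D.Reps f a) (h' : D.Reps g b)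
    (i : Fin 2) :
    D.Reps ((![f, g] : Fin 2 → ℕ → ℕ) i) ((![a, b] : Fin 2 → D.model) i) := by
  fin_cases i
  exacts [h, h']

/-! ### Łoś's theorem for the model -/

theorem realize_atomic {α : Type} {n : ℕ} {φ : PV.BoundedFormula α n} (hφ : φ.IsAtomic)
    {v : α → D.model} {xs : Fin n → D.model} {f : α → ℕ → ℕ} {g : Fin n → ℕ → ℕ}
    (hf : ∀ a, D.Reps (f a) (v a)) (hg : ∀ i, D.Reps (g i) (xs i)) :
    φ.Realize v xs ↔ ∀ᶠ u in (hyperfilter ℕ : Filter ℕ),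
      φ.Realize (fun a => f a u) fun i => g i u := by
  rw [← hφ.isQF.realize_embedding D.model.subtype,
    ← Ultraproduct.boundedFormula_realize_cast (u := hyperfilter ℕ) (M := fun _ : ℕ => ℕ) φ f g]
  have h1 : (D.model.subtype ∘ v) = fun a => germ (f a) := funext fun a => (hf a).2.symm
  have h2 : (D.model.subtype ∘ xs) = fun a => germ (g a) := funext fun a => (hg a).2.symm
  rw [h1, h2]
  rfl

theorem reps_snoc {n : ℕ} {xs : Fin n → D.model} {g : Fin n → ℕ → ℕ}
    (hg : ∀ i, D.Reps (g i) (xs i)) {a : D.model} {f : ℕ → ℕ} (hf : D.Reps f a) (i : Fin (n + 1)) :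
    D.Reps (Fin.snoc (α := fun _ => ℕ → ℕ) g f i) (Fin.snoc (α := fun _ => D.model) xs a i) := by
  induction i using Fin.lastCases with
  | last => simpa using hf
  | cast i => simpa using hg i

theorem snoc_apply {n : ℕ} (g : Fin n → ℕ → ℕ) (f : ℕ → ℕ) (u : ℕ) :
    (fun i => Fin.snoc (α := fun _ => ℕ → ℕ) g f i u) =
      (Fin.snoc (fun i => g i u) (f u) : Fin (n + 1) → ℕ) := by
  ext i
  induction i using Fin.lastCases <;> simp

theorem sumElim_isVal {α : Type} {n : ℕ} {f : α → ℕ → ℕ} {g : Fin n → ℕ → ℕ}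
    (hf : ∀ a, D.IsVal (f a)) (hg : ∀ i, D.IsVal (g i)) (b : α ⊕ Fin n) :
    D.IsVal (Sum.elim f g b) := by
  rcases b with a | i
  exacts [hf a, hg i]

/-- A sharply bounded quantifier over the model. -/
theorem forall_le_len_iff {α : Type} {n : ℕ} {φ : PV.BoundedFormula α (n + 1)}
    (t : PV.Term (α ⊕ Fin n)) {v : α → D.model} {xs : Fin n → D.model} {f : α → ℕ → ℕ}
    {g : Fin n → ℕ → ℕ} (hf : ∀ a, D.Reps (f a) (v a)) (hg : ∀ i, D.Reps (g i) (xs i))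
    (ih : ∀ (a : D.model) (h : ℕ → ℕ), D.Reps h a → (φ.Realize v (Fin.snoc xs a) ↔
      ∀ᶠ u in (hyperfilter ℕ : Filter ℕ),
        φ.Realize (fun a => f a u) (Fin.snoc (fun i => g i u) (h u)))) :
    (ballF (len t) φ).Realize v xs ↔ ∀ᶠ u in (hyperfilter ℕ : Filter ℕ),
      (ballF (len t) φ).Realize (fun a => f a u) fun i => g i u := by
  simp only [realize_ballF, leIn_nat]
  have hle : ∀ (a : D.model) (h : ℕ → ℕ), D.Reps h a →
      (LeIn a ((len t).realize (Sum.elim v xs)) ↔ ∀ᶠ u in (hyperfilter ℕ : Filter ℕ),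
        h u ≤ (len t).realize (Sum.elim (fun a => f a u) fun i => g i u)) := by
    intro a h hh
    have := realize_atomic (φ := leF (&(Fin.last n)) (liftTerm (len t)))
      (BoundedFormula.IsAtomic.equal _ _) hf (reps_snoc hg hh)
    simp only [snoc_apply, realize_leF, realize_liftTerm, leIn_nat] at this
    simpa using this
  constructor
  · intro H
    by_contra hcon
    rw [← Ultrafilter.eventually_not] at hcon
    -- A counterexample is chosen at each stage that has one, and `0` at the others. Being bounded
    -- by a length, the resulting sequence is small and so lies in the model.
    have hch : ∀ u, ∃ i, i ≤ (len t).realize (Sum.elim (fun a => f a u) fun i => g i u) ∧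
        ((¬ ∀ a ≤ (len t).realize (Sum.elim (fun a => f a u) fun i => g i u),
          φ.Realize (fun a => f a u) (Fin.snoc (fun i => g i u) a)) →
        ¬ φ.Realize (fun a => f a u) (Fin.snoc (fun i => g i u) i)) := by
      intro u
      by_cases hc : ∀ a ≤ (len t).realize (Sum.elim (fun a => f a u) fun i => g i u),
          φ.Realize (fun a => f a u) (Fin.snoc (fun i => g i u) a)
      · exact ⟨0, Nat.zero_le _, fun h => absurd hc h⟩
      · push Not at hc
        obtain ⟨i, hi, h⟩ := hc
        exact ⟨i, hi, fun _ => h⟩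
    choose i hi hi' using hch
    have hval : D.IsVal fun u => t.realize (Sum.elim (fun a => f a u) fun i => g i u) := by
      have := IsVal.term t (sumElim_isVal (fun a => (hf a).1) fun i => (hg i).1)
      convert! this using 3
      ext b
      rcases b with b | b <;> rfl
    obtain ⟨c, hc⟩ := hval.size_le
    obtain ⟨a, ha⟩ := (IsVal.small (D := D) (c := c) (j := i) fun u =>
      (hi u).trans (by rw [realize_len_nat]; exact hc u)).exists_reps
    have h1 := (ih a i ha).1 (H a ((hle a i ha).2 (Eventually.of_forall hi)))
    obtain ⟨u, hu, hu'⟩ := (h1.and hcon).exists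
    exact hi' u hu' hu
  · intro H a ha
    obtain ⟨h, hh⟩ := exists_reps a
    rw [ih a h hh]
    filter_upwards [H, (hle a h hh).1 ha] with u h1 h2
    exact h1 _ h2

/-- Łoś's theorem for sharply bounded formulas. -/
theorem realize_sharplyBounded {α : Type} {n : ℕ} {φ : PV.BoundedFormula α n}
    (hφ : IsSharplyBounded φ)
    {v : α → D.model} {xs : Fin n → D.model} {f : α → ℕ → ℕ} {g : Fin n → ℕ → ℕ}
    (hf : ∀ a, D.Reps (f a) (v a)) (hg : ∀ i, D.Reps (g i) (xs i)) :
    φ.Realize v xs ↔ ∀ᶠ u in (hyperfilter ℕ : Filter ℕ),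
      φ.Realize (fun a => f a u) fun i => g i u := by
  induction hφ with
  | atomic h => exact realize_atomic h hf hg
  | falsum => simp only [BoundedFormula.Realize, eventually_const]
  | imp _ _ ih₁ ih₂ =>
    simp only [BoundedFormula.realize_imp, ih₁ hg, ih₂ hg, Ultrafilter.eventually_imp]
  | @ball n φ t _ ih =>
    refine forall_le_len_iff t hf hg fun a h hh => ?_
    rw [ih (reps_snoc hg hh)]
    simp only [snoc_apply]
  | @bex n φ t _ ih =>
    -- The existential quantifier is reduced to the universal one for the negation, since an
    -- ultrafilter commutes with negation.
    have key := forall_le_len_iff (φ := φ.not) t hf hg fun a h hh => by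
      rw [BoundedFormula.realize_not, ih (reps_snoc hg hh), ← Ultrafilter.eventually_not]
      simp only [snoc_apply, BoundedFormula.realize_not]
    rw [← not_iff_not, ← Ultrafilter.eventually_not]
    simp only [realize_ballF, BoundedFormula.realize_not] at key
    simp only [realize_bexF]
    push Not
    exact key

theorem leIn_iff {f g : ℕ → ℕ} {a b : D.model} (hf : D.Reps f a) (hg : D.Reps g b) :
    LeIn a b ↔ ∀ᶠ u in (hyperfilter ℕ : Filter ℕ), f u ≤ g u := by
  have := realize_atomic (α := Empty) (φ := leF (&0) (&1)) (BoundedFormula.IsAtomic.equal _ _)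
    (v := Empty.elim) (f := Empty.elim) (fun a => a.elim) (reps_forall₂ hf hg)
  simpa [realize_leF, leIn_nat] using this

theorem dvdIn_iff {f g : ℕ → ℕ} {a b : D.model} (hf : D.Reps f a) (hg : D.Reps g b) :
    DvdIn a b ↔ ∀ᶠ u in (hyperfilter ℕ : Filter ℕ), f u ∣ g u := by
  have := realize_atomic (α := Empty) (φ := dvdF (&0) (&1)) (BoundedFormula.IsAtomic.equal _ _)
    (v := Empty.elim) (f := Empty.elim) (fun a => a.elim) (reps_forall₂ hf hg)
  simpa [realize_dvdF, dvdIn_nat] using this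

theorem reps_eq_iff {f g : ℕ → ℕ} {a b : D.model} (hf : D.Reps f a) (hg : D.Reps g b) :
    a = b ↔ ∀ᶠ u in (hyperfilter ℕ : Filter ℕ), f u = g u := by
  rw [← germ_eq, hf.2, hg.2, Subtype.ext_iff]

theorem reps_oneIn : D.Reps (fun _ => 1) (oneIn D.model) := by
  have h := Reps.funMap (D := D) oneSym (f := ![]) (a := ![]) fun i => i.elim0
  have h' : ∀ u : ℕ, ClockedMachine.eval oneSym (fun i => (![] : Fin 0 → ℕ → ℕ) i u) = 1 :=
    fun _ => constMachine_eval 1 _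
  simp only [h'] at h
  exact h

theorem reps_twoIn : D.Reps (fun _ => 2) (twoIn D.model) := by
  have h := Reps.funMap (D := D) twoSym (f := ![]) (a := ![]) fun i => i.elim0
  have h' : ∀ u : ℕ, ClockedMachine.eval twoSym (fun i => (![] : Fin 0 → ℕ → ℕ) i u) = 2 :=
    fun _ => constMachine_eval 2 _
  simp only [h'] at h
  exact h

theorem Reps.len {f : ℕ → ℕ} {a : D.model} (h : D.Reps f a) :
    D.Reps (fun u => (f u).size) (Structure.funMap lenSym ![a]) := by
  have := Reps.funMap (D := D) lenSym (reps_forall₁ h)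
  simpa only [lenSym_eval, Matrix.cons_val_zero] using this

theorem Reps.entry {f g : ℕ → ℕ} {a b : D.model} (h : D.Reps f a) (h' : D.Reps g b) :
    D.Reps (fun u => entry (f u) (g u)) (Structure.funMap entrySym ![a, b]) := by
  have := Reps.funMap (D := D) entrySym (reps_forall₂ h h')
  simpa only [entrySym_eval, Matrix.cons_val_zero, Matrix.cons_val_one] using this

/-- Łoś's theorem gives truth in the full ultrapower, and universal sentences pass to substructures.
-/
theorem model_TPV : D.model ⊨ TPV := by
  refine ⟨fun σ hσ => ?_⟩
  have h1 : Ultrapower ⊨ σ :=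
    (Ultraproduct.sentence_realize (u := hyperfilter ℕ) (M := fun _ : ℕ => ℕ) σ).2
      (Eventually.of_forall fun _ => hσ.2)
  refine hσ.1.realize_embedding D.model.subtype ?_
  rw [Sentence.Realize, Formula.Realize] at h1
  convert! h1

end Instances

/-! ### Sharply bounded choice in the model -/

/-- An assignment for the variables in an instance of the choice scheme. -/
def ChoiceVar.assign {m : ℕ} {M : Type} (p : Fin m → M) (a i y : M) : ChoiceVar m → M
  | .param j => p j
  | .a => a
  | .i => i
  | .y => y

/-- Isolates the bookkeeping of bound variables: behind `a` come `i, y` in the premise but `w, i` in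
the conclusion, where the `i`-th entry of `w` is substituted for `y`. -/
theorem realize_choiceAxiom {M : Type} [PV.Structure M] {m : ℕ} (φ : PV.Formula (ChoiceVar m))
    (h : ∀ (p : Fin m → M) (a : M),
      (∀ i, LeIn i (Structure.funMap lenSym ![a]) →
        ∃ y, LeIn y a ∧ φ.Realize (ChoiceVar.assign p a i y)) →
      ∃ w, ∀ i, LeIn i (Structure.funMap lenSym ![a]) →
        φ.Realize (ChoiceVar.assign p a i (Structure.funMap entrySym ![w, i]))) :
    M ⊨ choiceAxiom φ := by
  rw [choiceAxiom, Sentence.Realize, BoundedFormula.realize_alls]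
  intro xs
  rw [BoundedFormula.realize_imp, realize_ballF, BoundedFormula.realize_ex]
  intro H
  obtain ⟨w, hw⟩ := h (fun j => xs j.castSucc) (xs (Fin.last m)) fun i hi => by
    have := H i (by simpa [len, Term.realize_functions_apply₁] using hi)
    rw [realize_bexF] at this
    obtain ⟨y, hy, hφ⟩ := this
    refine ⟨y, by simpa using hy, ?_⟩
    rw [BoundedFormula.realize_relabel] at hφ
    rw [Formula.Realize]
    convert! hφ using 1
    ext x
    cases x with
    | param j =>
      simp only [ChoiceVar.place, ChoiceVar.assign, Fin.snoc, Function.comp_apply, Sum.elim_inr]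
      rw [dif_pos (by simp; omega), dif_pos (by simp)]
      rfl
    | a => simp [ChoiceVar.place, ChoiceVar.assign, Fin.snoc]; rfl
    | _ => simp [ChoiceVar.place, ChoiceVar.assign, Fin.snoc]
  refine ⟨w, ?_⟩
  rw [realize_ballF]
  intro i hi
  have := hw i (by simpa [len, Term.realize_functions_apply₁] using hi)
  rw [BoundedFormula.realize_relabel, BoundedFormula.realize_subst]
  rw [Formula.Realize] at this
  convert! this using 1
  ext x
  cases x with
  | param j =>
    simp only [ChoiceVar.place, ChoiceVar.assign, ChoiceVar.entrySubst, Fin.snoc,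
      Function.comp_apply, Sum.elim_inr, Term.realize_var]
    rw [dif_pos (by simp; omega), dif_pos (by simp)]
    rfl
  | a => simp [ChoiceVar.place, ChoiceVar.assign, ChoiceVar.entrySubst, Fin.snoc]; rfl
  | _ => simp [ChoiceVar.place, ChoiceVar.assign, ChoiceVar.entrySubst, Fin.snoc]

namespace Instances

open Filter

variable {D : Instances}

/-- A diagonal argument. If no `e` sufficed, one could choose at stage `u` an `i` without witnesses
among the first families, for as many of them as possible. This sequence is small, hence in the
model, and has a witness there; but the witness comes from a single family in the enumeration. -/
theorem exists_uniform_bound {G : ℕ → Fam × ℕ} (hG : ∀ g ∈ uniformFam, ∀ c, ∃ e, G e = (g, c))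
    (Ψ : ℕ → ℕ → ℕ → Prop) {b : ℕ → ℕ} {c₁ : ℕ} (hb : D.IsSmall c₁ b)
    (h : ∀ i, D.IsVal i → (∀ᶠ u in (hyperfilter ℕ : Filter ℕ), i u ≤ b u) → ∃ y, D.IsVal y ∧
      ∀ᶠ u in (hyperfilter ℕ : Filter ℕ), Ψ u (i u) (y u)) :
    ∃ e, ∀ᶠ u in (hyperfilter ℕ : Filter ℕ), ∀ i ≤ b u, ∃ e' ≤ e,
      ∃ j ≤ (D.ν u + 2) ^ (G e').2, Ψ u i ((G e').1 (D.ν u) (D.z u) j) := by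
  classical
  by_contra! hcon
  have hch : ∀ u, ∃ i ≤ b u, ∀ e ≤ u, (∃ i ≤ b u, ∀ e' ≤ e, ∀ j ≤ (D.ν u + 2) ^ (G e').2,
      ¬ Ψ u i ((G e').1 (D.ν u) (D.z u) j)) → ∀ e' ≤ e, ∀ j ≤ (D.ν u + 2) ^ (G e').2,
      ¬ Ψ u i ((G e').1 (D.ν u) (D.z u) j) := by
    intro u
    by_cases hne : ∃ e ≤ u, ∃ i ≤ b u, ∀ e' ≤ e, ∀ j ≤ (D.ν u + 2) ^ (G e').2,
      ¬ Ψ u i ((G e').1 (D.ν u) (D.z u) j)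
    · obtain ⟨e₀, he₀, h₀⟩ := hne
      -- Taking the greatest failing `e ≤ u` makes the same `i` a counterexample for all smaller
      -- failing `e`.
      obtain ⟨i, hi, h⟩ := Nat.findGreatest_spec (P := fun e => ∃ i ≤ b u, ∀ e' ≤ e,
        ∀ j ≤ (D.ν u + 2) ^ (G e').2, ¬ Ψ u i ((G e').1 (D.ν u) (D.z u) j)) he₀ h₀
      exact ⟨i, hi, fun e he h' e' he' => h e' (he'.trans (Nat.le_findGreatest he h'))⟩
    · push Not at hne
      exact ⟨0, Nat.zero_le _, fun e he ⟨i, hi, h⟩ => by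
        obtain ⟨e', he', j, hj, h'⟩ := hne e he i hi
        exact absurd h' (h e' he' j hj)⟩
  choose i hi hi' using hch
  obtain ⟨y, ⟨g, hg, c, j, hj, rfl⟩, hΨ⟩ := h i
    (IsVal.small (c := c₁) fun u => (hi u).trans (hb u)) (Eventually.of_forall hi)
  obtain ⟨e, he⟩ := hG g hg c
  -- The diagonal choice at stage `u` handles only `e ≤ u`; as the ultrafilter is nonprincipal, this
  -- excludes a negligible set of stages.
  have hge : ∀ᶠ u in (hyperfilter ℕ : Filter ℕ), e ≤ u :=
    (Nat.hyperfilter_le_atTop) (eventually_ge_atTop e)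
  obtain ⟨u, ⟨hΨu, hbad⟩, hu⟩ := ((hΨ.and (hcon e)).and hge).exists
  have := hi' u e hu hbad e le_rfl (j u) (by rw [he]; exact hj u)
  rw [he] at this
  exact this hΨu

/-- A uniform family that finds witnesses among the values of finitely many families. -/
theorem exists_search_family {Ψ : ℕ → ℕ → ℕ → Prop} {G : ℕ → Fam × ℕ}
    (hG : ∀ e, (G e).1 ∈ uniformFam) {j₀ : ℕ → ℕ} {c₁ : ℕ}
    (hΨ : ∀ g ∈ uniformFam, ∀ c, ∃ E ∈ uniformFam, ∀ u, ∀ i ≤ (D.ν u + 2) ^ c₁,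
      ∀ j ≤ (D.ν u + 2) ^ c, (E (D.ν u) (D.z u) (Nat.pair (Nat.pair (j₀ u) i) j) ≠ 0 ↔
        Ψ u i (g (D.ν u) (D.z u) j))) (e : ℕ) :
    ∃ H ∈ uniformFam, ∀ u, ∀ i ≤ (D.ν u + 2) ^ c₁,
      ((∃ e' ≤ e, ∃ j ≤ (D.ν u + 2) ^ (G e').2, Ψ u i ((G e').1 (D.ν u) (D.z u) j)) →
        H (D.ν u) (D.z u) (Nat.pair (j₀ u) i) ≠ 0) ∧
      (H (D.ν u) (D.z u) (Nat.pair (j₀ u) i) ≠ 0 →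
        Ψ u i (H (D.ν u) (D.z u) (Nat.pair (j₀ u) i) - 1)) := by
  have single : ∀ e, ∃ H ∈ uniformFam, ∀ u, ∀ i ≤ (D.ν u + 2) ^ c₁,
      ((∃ j ≤ (D.ν u + 2) ^ (G e).2, Ψ u i ((G e).1 (D.ν u) (D.z u) j)) →
        H (D.ν u) (D.z u) (Nat.pair (j₀ u) i) ≠ 0) ∧
      (H (D.ν u) (D.z u) (Nat.pair (j₀ u) i) ≠ 0 →
        Ψ u i (H (D.ν u) (D.z u) (Nat.pair (j₀ u) i) - 1)) := by
    intro e
    obtain ⟨E, hE, h⟩ := hΨ _ (hG e) (G e).2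
    -- Witnesses are shifted by one so that the witness `0` differs from failure.
    refine ⟨_, uniformFam.search (G e).2 (uniformFam.pv₂ guardMachine hE (uniformFam.snd (hG e))),
      fun u i hi => ⟨?_, fun hne => ?_⟩⟩
    · rintro ⟨j, hj, hj'⟩
      refine firstNonzero_ne_zero hj ?_
      rw [guardMachine_eval, if_neg ((h u i hi j hj).2 hj')]
      omega
    · obtain ⟨j, hj, heq⟩ := firstNonzero_eq (fun j => guardMachine.eval
        ![E (D.ν u) (D.z u) (Nat.pair (Nat.pair (j₀ u) i) j),
          (G e).1 (D.ν u) (D.z u) (Nat.unpair (Nat.pair (Nat.pair (j₀ u) i) j)).2])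
        ((D.ν u + 2) ^ (G e).2)
      rw [heq] at hne ⊢
      rw [guardMachine_eval] at hne ⊢
      split_ifs at hne ⊢ with h0
      · exact absurd rfl hne
      · simpa using (h u i hi j hj).1 h0
  induction e with
  | zero =>
    obtain ⟨H, hH, h⟩ := single 0
    refine ⟨H, hH, fun u i hi => ⟨fun ⟨e', he', h'⟩ => ?_, (h u i hi).2⟩⟩
    obtain rfl : e' = 0 := by omega
    exact (h u i hi).1 h'
  | succ e ih =>
    obtain ⟨H, hH, h⟩ := ih
    obtain ⟨H', hH', h'⟩ := single (e + 1)
    refine ⟨_, uniformFam.pv₂ orElseMachine hH hH', fun u i hi => ?_⟩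
    simp only [orElseMachine_eval]
    split_ifs with h0
    · refine ⟨fun ⟨e', he', hj⟩ => ?_, (h' u i hi).2⟩
      rcases Nat.lt_or_ge e' (e + 1) with hlt | hge
      · exact absurd h0 ((h u i hi).1 ⟨e', by omega, hj⟩)
      · obtain rfl : e' = e + 1 := by omega
        exact (h' u i hi).1 hj
    · exact ⟨fun _ => h0, (h u i hi).2⟩

theorem assign_apply {m : ℕ} (p : Fin m → ℕ → ℕ) (a i y : ℕ → ℕ) (u : ℕ) :
    (fun x => ChoiceVar.assign p a i y x u) =
      ChoiceVar.assign (fun k => p k u) (a u) (i u) (y u) := by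
  ext x
  cases x <;> rfl

theorem reps_assign {m : ℕ} {p : Fin m → D.model} {a i y : D.model} {fp : Fin m → ℕ → ℕ}
    {fa fi fy : ℕ → ℕ} (hp : ∀ k, D.Reps (fp k) (p k)) (ha : D.Reps fa a) (hi : D.Reps fi i)
    (hy : D.Reps fy y) (x : ChoiceVar m) :
    D.Reps (ChoiceVar.assign fp fa fi fy x) (ChoiceVar.assign p a i y x) := by
  cases x
  exacts [hp _, ha, hi, hy]

theorem realize_formula_assign {m : ℕ} {φ : PV.Formula (ChoiceVar m)} (hφ : IsSharplyBounded φ)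
    {p : Fin m → D.model} {a i y : D.model} {fp : Fin m → ℕ → ℕ}
    {fa fi fy : ℕ → ℕ} (hp : ∀ k, D.Reps (fp k) (p k)) (ha : D.Reps fa a) (hi : D.Reps fi i)
    (hy : D.Reps fy y) : φ.Realize (ChoiceVar.assign p a i y) ↔
      ∀ᶠ u in (hyperfilter ℕ : Filter ℕ),
        φ.Realize (ChoiceVar.assign (fun k => fp k u) (fa u) (fi u) (fy u)) := by
  rw [Formula.Realize, realize_sharplyBounded hφ (reps_assign hp ha hi hy) (g := default)
    fun i => i.elim0]
  simp only [assign_apply, Formula.Realize]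
  refine eventually_congr (Eventually.of_forall fun u => ?_)
  exact iff_of_eq (congrArg _ (Subsingleton.elim _ _))

theorem model_choiceAxiom {m : ℕ} {φ : PV.Formula (ChoiceVar m)} (hφ : IsSharplyBounded φ) :
    D.model ⊨ choiceAxiom φ := by
  refine realize_choiceAxiom φ fun p a H => ?_
  choose fp hfp using fun k => exists_reps (p k)
  obtain ⟨fa, hfa⟩ := exists_reps a
  -- All parameters and `a` are computed from one small number `j₀`, with which `i` can then be
  -- paired.
  obtain ⟨c₀, j₀, hj₀, g, hg, hval⟩ := exists_common
    (f := Fin.snoc (α := fun _ => ℕ → ℕ) fp fa) (D := D) (fun k => by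
      induction k using Fin.lastCases with
      | last => simpa using hfa.1
      | cast k => simpa using (hfp k).1)
  have hpval : ∀ k, fp k = D.val (g k.castSucc) j₀ := fun k => by simpa using hval k.castSucc
  have haval : fa = D.val (g (Fin.last m)) j₀ := by simpa using hval (Fin.last m)
  -- The same bound serves for the range of `i ≤ |a|` and for the number of bits of the witnesses `y
  -- ≤ a`.
  obtain ⟨c₁, hc₁⟩ := hfa.1.size_le
  set Ψ : ℕ → ℕ → ℕ → Prop := fun u i y =>
    y ≤ fa u ∧ φ.Realize (ChoiceVar.assign (fun k => fp k u) (fa u) i y) with hΨ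
  have := uniformFam.countable
  have : Nonempty uniformFam := ⟨⟨_, uniformFam.small⟩⟩
  obtain ⟨G₀, hG₀⟩ := exists_surjective_nat (uniformFam × ℕ)
  set G : ℕ → Fam × ℕ := fun e => ((G₀ e).1, (G₀ e).2) with hGdef
  have hG : ∀ e, (G e).1 ∈ uniformFam := fun e => (G₀ e).1.2
  have hGs : ∀ g ∈ uniformFam, ∀ c, ∃ e, G e = (g, c) := fun g hg c => by
    obtain ⟨e, he⟩ := hG₀ (⟨g, hg⟩, c)
    exact ⟨e, by simp [hGdef, he]⟩
  obtain ⟨e, he⟩ := exists_uniform_bound hGs Ψ hc₁ fun i hi hle => by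
    obtain ⟨i', hi'⟩ := hi.exists_reps
    obtain ⟨y, hy, hφy⟩ := H i' ((leIn_iff hi' hfa.len).2 hle)
    obtain ⟨fy, hfy⟩ := exists_reps y
    exact ⟨fy, hfy.1, ((leIn_iff hfy hfa).1 hy).and
      ((realize_formula_assign hφ hfp hfa hi' hfy).1 hφy)⟩
  obtain ⟨F, hF, hFΨ⟩ := exists_search_family (Ψ := Ψ) hG (j₀ := j₀) (c₁ := c₁) (fun g' hg' c => by
    obtain ⟨e₁, he₁⟩ := exists_pair_le c₀ c₁
    obtain ⟨e₂, he₂⟩ := exists_pair_le e₁ c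
    let A : ChoiceVar m → Fam := ChoiceVar.assign
      (fun k ν z j => g k.castSucc ν z j.unpair.1.unpair.1)
      (fun ν z j => g (Fin.last m) ν z j.unpair.1.unpair.1) (fun _ _ j => j.unpair.1.unpair.2)
      (fun ν z j => g' ν z j.unpair.2)
    have hA : ∀ x, A x ∈ uniformFam := by
      intro x
      cases x with
      | param k => exact uniformFam.fst (uniformFam.fst (hg _))
      | a => exact uniformFam.fst (uniformFam.fst (hg _))
      | i => exact uniformFam.fst (uniformFam.snd uniformFam.small)
      | y => exact uniformFam.snd hg'
    obtain ⟨E, hE, hEφ⟩ := uniformFam.formula hφ (V := Fin.elim0) hA (fun i => i.elim0) e₂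
    refine ⟨_, uniformFam.pv₂ andNotMachine hE (uniformFam.pv₁ isZeroMachine
      (uniformFam.pv₂ leSym (hA .y) (hA .a))), fun u i hi j hj => ?_⟩
    rw [andNotMachine_eval, hEφ _ _ _ (D.lt u) (he₂ _ _ _ (he₁ _ _ _ (hj₀ u) hi) hj), ← not_ne_iff,
      isZeroMachine_eval, leSym_eval, hΨ]
    have h1 : (fun x => A x (D.ν u) (D.z u) (Nat.pair (Nat.pair (j₀ u) i) j)) =
        ChoiceVar.assign (fun k => fp k u) (fa u) i (g' (D.ν u) (D.z u) j) := by
      ext x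
      cases x <;> simp [A, ChoiceVar.assign, hpval, haval, val]
    have h2 := congrFun h1 .y
    have h3 := congrFun h1 .a
    simp only [ChoiceVar.assign] at h2 h3
    simp only [h1, h2, h3, Formula.Realize, Matrix.cons_val_zero, Matrix.cons_val_one]
    rw [and_comm]
    simp only [ite_eq_right_iff, one_ne_zero, imp_false, not_not]
    exact and_congr_right fun _ => iff_of_eq (congrArg _ (Subsingleton.elim _ _))) e
  -- Collecting the unshifted witnesses for all `i ≤ (ν + 2) ^ c₁` gives the required code; padding
  -- to `(ν + 2) ^ c₁` bits truncates none of those that are at most `a`.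
  obtain ⟨w, hw⟩ := IsVal.exists_reps (D := D) (f := D.val _ j₀)
    ⟨_, uniformFam.collect c₁ (uniformFam.pv₁ predMachine hF), c₀, j₀, hj₀, rfl⟩
  refine ⟨w, fun i hi => ?_⟩
  obtain ⟨fi, hfi⟩ := exists_reps i
  rw [realize_formula_assign hφ hfp hfa hfi (hw.entry hfi)]
  filter_upwards [(leIn_iff hfi hfa.len).1 hi, he] with u hu hgood
  have hiu := hu.trans (hc₁ u)
  have h1 := (hFΨ u (fi u) hiu).2 ((hFΨ u (fi u) hiu).1 (hgood _ hu))
  have h2 : entry (D.val (fun ν z j => packEntries ((ν + 2) ^ c₁)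
      (fun i => predMachine.eval ![F ν z (Nat.pair j i)]) ((ν + 2) ^ c₁ + 1)) j₀ u) (fi u) =
      F (D.ν u) (D.z u) (Nat.pair (j₀ u) (fi u)) - 1 := by
    rw [val, entry_packEntries _ _ (by omega), predMachine_eval, Nat.mod_eq_of_lt]
    exact (h1.1.trans_lt (Nat.lt_size_self _)).trans_le (Nat.pow_le_pow_right (by omega) (hc₁ u))
  rw [h2]
  exact h1.2

theorem model_theory : D.model ⊨ TPV ∪ BB := by
  refine Theory.model_union_iff.2 ⟨model_TPV, ⟨?_⟩⟩
  rintro _ ⟨m, φ, hφ, rfl⟩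
  exact model_choiceAxiom hφ

end Instances

/-! ### An element without prime factors -/

section Stage

variable {u : ℕ} {τ : (Fin u → Bool) → ℕ}

theorem prime_dvd_partProd {p v : ℕ} (hp : p.Prime) (hτ : ∀ s, (τ s).Prime)
    (h : p ∣ partProd τ v) : ∃ s, inPart v s = true ∧ p = τ s := by
  obtain ⟨s, -, hs⟩ := (Prime.dvd_finsetProd_iff hp.prime _).1 h
  split_ifs at hs with hv
  · exact ⟨s, hv, (Nat.prime_dvd_prime_iff_eq hp (hτ s)).1 hs⟩
  · exact absurd (Nat.dvd_one.1 hs) hp.ne_one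

theorem dvd_partProd {v : ℕ} {s : Fin u → Bool} (h : inPart v s = true) :
    τ s ∣ partProd τ v := by
  have := Finset.dvd_prod_of_mem (fun s => if inPart v s then τ s else 1) (Finset.mem_univ s)
  rwa [if_pos h] at this

theorem partProd_odd (hτ : ∀ s, τ s % 2 = 1) (v : ℕ) : partProd τ v % 2 = 1 := by
  rw [← Nat.odd_iff, partProd]
  refine Finset.prod_induction _ Odd (fun _ _ => Odd.mul) odd_one fun s _ => ?_
  split_ifs
  · exact Nat.odd_iff.2 (hτ s)
  · exact odd_one

theorem two_le_partProd (hτ : ∀ s, (τ s).Prime) (hodd : ∀ s, τ s % 2 = 1) :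
    2 ≤ partProd τ 0 := by
  have h0 := partProd_odd hodd 0
  exact (hτ fun _ => true).two_le.trans (Nat.le_of_dvd (by omega) (dvd_partProd rfl))

theorem partProd_lt {n : ℕ} (hτ : ∀ s, (τ s).Prime ∧ τ s < 2 ^ n) (v : ℕ) :
    partProd τ v < 2 ^ (2 ^ u * n) := by
  have hn : 1 < 2 ^ n := (hτ fun _ => true).1.one_lt.trans (hτ fun _ => true).2
  calc partProd τ v < ∏ _s : Fin u → Bool, 2 ^ n := by
        refine Finset.prod_lt_prod_of_nonempty (fun s _ => ?_) (fun s _ => ?_)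
          Finset.univ_nonempty
        · split_ifs
          exacts [(hτ s).1.pos, one_pos]
        · split_ifs
          exacts [(hτ s).2, hn]
    _ = 2 ^ (2 ^ u * n) := by
        rw [Finset.prod_const, Finset.card_univ, Fintype.card_fun, ← pow_mul, Fintype.card_bool,
          Fintype.card_fin, mul_comm]

/-- A divisor of the product of all primes that does not separate the primes with indices that
agree below `k` is split by the product of one half of them. -/
theorem gcd_partProd_succ {k a : ℕ} (hk : k < u) (hinj : Function.Injective τ)
    (hτ : ∀ s, (τ s).Prime) (ha : 2 ≤ a) (hdvd : a ∣ partProd τ 0)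
    (h : ∀ s t : Fin u → Bool, (∀ i : Fin u, (i : ℕ) < k → s i = t i) → τ s ∣ a → τ t ∣ a) :
    Nat.gcd a (partProd τ (k + 1)) ≠ 1 ∧ Nat.gcd a (partProd τ (k + 1)) ≠ a := by
  have hmin := Nat.minFac_prime (n := a) (by omega)
  obtain ⟨s, -, hs⟩ := prime_dvd_partProd hmin hτ ((Nat.minFac_dvd a).trans hdvd)
  have hsa : τ s ∣ a := hs ▸ Nat.minFac_dvd a
  -- Changing coordinate `k` keeps the coordinates below `k`, so the prime at the new index also
  -- divides `a`.
  have hupd : ∀ b, τ (Function.update s ⟨k, hk⟩ b) ∣ a := fun b =>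
    h s _ (fun i hi => by
      rw [Function.update_of_ne]
      rintro rfl
      exact lt_irrefl _ hi) hsa
  have hin : ∀ b, inPart (k + 1) (Function.update s ⟨k, hk⟩ b) = b := fun b => by
    simp [inPart, hk]
  refine ⟨fun h1 => ?_, fun h1 => ?_⟩
  · have := Nat.dvd_gcd (hupd true) (dvd_partProd (hin true))
    rw [h1] at this
    exact (hτ _).ne_one (Nat.dvd_one.1 this)
  -- If `a` divided the half product, so would the prime whose index is false at `k`; by injectivity
  -- it is not one of the factors.
  · obtain ⟨t, ht, hst⟩ := prime_dvd_partProd (hτ _) hτ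
      ((hupd false).trans (Nat.gcd_eq_left_iff_dvd.1 h1))
    rw [← hinj hst, hin] at ht
    exact absurd ht (by simp)

end Stage

namespace Instances

open Filter

variable {D : Instances} {G : ℕ → Fam} {n : ℕ → ℕ} {τ : (u : ℕ) → (Fin u → Bool) → ℕ}

/-- Every nontrivial divisor of the product of all primes has a proper divisor. -/
theorem exists_proper_divisor (hG : ∀ g ∈ uniformFam, ∃ e, G e = g)
    (hinj : ∀ u, Function.Injective (τ u)) (hτ : ∀ u s, (τ u s).Prime)
    (hodd : ∀ u s, τ u s % 2 = 1) (hsep : ∀ u, Unseparated G u (n u) (τ u))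
    (hν : ∀ u, D.ν u = 2 ^ u * n u) (hz : ∀ u, D.z u = partProd (τ u))
    {m : D.model} (hm : D.Reps (fun u => D.z u 0) m) {a : D.model}
    (ha : LeIn (twoIn D.model) a) (ham : DvdIn a m) :
    ∃ d : D.model, LeIn d a ∧ DvdIn d a ∧ d ≠ oneIn D.model ∧ d ≠ a := by
  obtain ⟨f, hf⟩ := exists_reps a
  obtain ⟨g, hg, c, j, hj, hfg⟩ := hf.1
  obtain ⟨e, rfl⟩ := hG g hg
  obtain ⟨k, -, -, hk, -⟩ := uniformFam.feasible hg
  -- The first generator that the family representing `a` is not known to depend on.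
  obtain ⟨b, hb⟩ := (IsVal.z (D := D) (k + 1)).exists_reps
  have hgcd := Reps.funMap (D := D) gcdMachine (reps_forall₂ hf hb)
  have hgcd' : D.Reps (fun u => Nat.gcd (f u) (D.z u (k + 1)))
      (Structure.funMap (L := PV) (gcdMachine : PV.Functions 2) ![a, b]) := by
    convert! hgcd using 2 with u
    rw [← gcdMachine_eval _ _ (by rw [hz]; exact partProd_odd (hodd u) _)]
    congr 1
    ext i
    fin_cases i <;> rfl
  have h2 := (leIn_iff reps_twoIn hf).1 ha
  have hdvd := (dvdIn_iff hf hm).1 ham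
  -- Once `u` exceeds the index `e` of the family, the exponent `c` of its small number and the
  -- level `k`, the choice of the primes at stage `u` takes this family into account.
  have hkey : ∀ᶠ u in (hyperfilter ℕ : Filter ℕ),
      Nat.gcd (f u) (D.z u (k + 1)) ≠ 1 ∧ Nat.gcd (f u) (D.z u (k + 1)) ≠ f u := by
    filter_upwards [h2, hdvd, Nat.hyperfilter_le_atTop (eventually_gt_atTop (max e (max c k)))]
      with u h2 hdvd hu
    simp only [max_lt_iff] at hu
    rw [hz] at hdvd ⊢
    refine gcd_partProd_succ hu.2.2 (hinj u) (hτ u) h2 hdvd ?_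
    have hju : j u ≤ (2 ^ u * n u + 2) ^ u := by
      rw [← hν]
      exact (hj u).trans (Nat.pow_le_pow_right (by omega) hu.2.1.le)
    have := hsep u e hu.1 k hu.2.2 (hk.mono (Nat.le_succ k)) (j u) hju
    rw [← hν, ← hz] at this
    rw [hfg]
    exact this
  refine ⟨_, (leIn_iff hgcd' hf).2 ?_, (dvdIn_iff hgcd' hf).2
    (Eventually.of_forall fun u => Nat.gcd_dvd_left _ _), fun h => ?_, fun h => ?_⟩
  · filter_upwards [h2] with u h2
    exact Nat.gcd_le_left _ (by omega)
  · obtain ⟨u, hu, hu'⟩ := (((reps_eq_iff hgcd' reps_oneIn).1 h).and hkey).exists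
    exact hu'.1 hu
  · obtain ⟨u, hu, hu'⟩ := (((reps_eq_iff hgcd' hf).1 h).and hkey).exists
    exact hu'.2 hu

end Instances

theorem realize_primeFactor {M : Type} [PV.Structure M] (h : M ⊨ primeFactor) {x : M}
    (hx : LeIn (twoIn M) x) : ∃ y, LeIn y x ∧ ∀ z, LeIn z y → LeIn (twoIn M) y ∧ DvdIn y x ∧
      (DvdIn z y → z = oneIn M ∨ z = y) := by
  rw [primeFactor, Sentence.Realize, Formula.Realize, BoundedFormula.realize_all] at h
  have h := h x
  rw [BoundedFormula.realize_imp, realize_leF, realize_two, realize_bexF] at h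
  obtain ⟨y, hy, h⟩ := h (by simpa [Fin.snoc] using hx)
  refine ⟨y, by simpa [Fin.snoc] using hy, fun z hz => ?_⟩
  rw [realize_ballF] at h
  have h := h z (by simpa [Fin.snoc] using hz)
  simpa [primeFactor₀, realize_leF, realize_dvdF, realize_one, realize_two, Fin.snoc] using h

/-- If factoring is hard, there is a model of the theory in which some element has the property
that each of its nontrivial divisors has a proper divisor. -/
theorem exists_model
    (hard : ∀ r : ℝ, 0 < r → ∀ C : (n : ℕ) → Circuit (2 * n) n,
      (∃ P : Polynomial ℕ, ∀ n, (C n).size ≤ P.eval n) →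
        ∃ n, (primesOfLength n).Nonempty ∧ factoringProb n (C n) < r) :
    ∃ (M : Theory.ModelType.{0, 0, 0} (TPV ∪ BB)) (m : M), LeIn (twoIn M) m ∧
      (∀ a : M, LeIn a a) ∧ ∀ a : M, LeIn (twoIn M) a → DvdIn a m →
        ∃ d : M, LeIn d a ∧ DvdIn d a ∧ d ≠ oneIn M ∧ d ≠ a := by
  have := uniformFam.countable
  have : Nonempty uniformFam := ⟨⟨_, uniformFam.small⟩⟩
  obtain ⟨G, hG⟩ := exists_surjective_nat uniformFam
  -- The primes at different stages are chosen independently; every family is taken care of at all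
  -- sufficiently late stages.
  choose n τ hinj hτ hsep using exists_unseparated hard (fun e => (G e : Fam)) fun e => (G e).2
  let D : Instances := ⟨fun u => 2 ^ u * n u, fun u => partProd (τ u),
    fun u v => partProd_lt (fun s => ⟨(hτ u s).1, (hτ u s).2.2⟩) v⟩
  obtain ⟨m, hm⟩ := (Instances.IsVal.z (D := D) 0).exists_reps
  have := Instances.model_theory (D := D)
  have : Nonempty D.model := ⟨m⟩
  refine ⟨Theory.ModelType.of (TPV ∪ BB) D.model, m, ?_, fun a => ?_, fun a ha ham => ?_⟩
  · exact (Instances.leIn_iff Instances.reps_twoIn hm).2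
      (Filter.Eventually.of_forall fun u => two_le_partProd (fun s => (hτ u s).1)
        fun s => (hτ u s).2.1)
  · obtain ⟨f, hf⟩ := Instances.exists_reps (D := D) a
    exact (Instances.leIn_iff hf hf).2 (Filter.Eventually.of_forall fun u => le_rfl)
  · exact Instances.exists_proper_divisor (fun g hg => (hG ⟨g, hg⟩).imp fun e he => by rw [he])
      hinj (fun u s => (hτ u s).1) (fun u s => (hτ u s).2.1) hsep (fun _ => rfl) (fun _ => rfl)
      hm ha ham

end BoundedArith

theorem theorem4p5
    (hard : ∀ r : ℝ, 0 < r → ∀ C : (n : ℕ) → BoundedArith.Circuit (2 * n) n,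
      (∃ P : Polynomial ℕ, ∀ n, (C n).size ≤ P.eval n) →
        ∃ n, (BoundedArith.primesOfLength n).Nonempty ∧ BoundedArith.factoringProb n (C n) < r) :
    (¬ (BoundedArith.TPV ∪ BoundedArith.BB) ⊨ᵇ BoundedArith.primeFactor) ∧
    ∃ (M : FirstOrder.Language.Theory.ModelType.{0, 0, 0} (BoundedArith.TPV ∪ BoundedArith.BB)) (m : M),
      BoundedArith.LeIn (BoundedArith.twoIn M) m ∧
      ∀ p : M, BoundedArith.PrimeIn p → ¬ BoundedArith.DvdIn p m := by
  obtain ⟨M, m, hm, hle, h⟩ := BoundedArith.exists_model hard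
  refine ⟨fun hpf => ?_, M, m, hm, fun p hp hpm => ?_⟩
  · obtain ⟨y, -, hy⟩ := BoundedArith.realize_primeFactor (hpf.realize_sentence M) hm
    -- The conditions on `y` alone also stand under the quantifier over `z ≤ y`, so they are
    -- extracted with `z = y`; this is where reflexivity of `≤` in the model is needed.
    obtain ⟨h2, hym, -⟩ := hy y (hle y)
    obtain ⟨d, hdy, hd, h1, h1'⟩ := h y h2 hym
    exact ((hy d hdy).2.2 hd).elim h1 h1'
  · obtain ⟨d, -, hd, h1, h1'⟩ := h p hp.1 hpm
    exact (hp.2 d hd).elim h1 h1'
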